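/- Let $X$ be a compact connected complex surface, $B$ a compact connected Riemann surface, and let $f:X\to B$ be a semi-stable fibration of genus $g$: a surjective holomorphic map all of whose (scheme-theoretic) fibres $X_s=f^{-1}(s)$ are semi-stable curves and whose general fibre is a smooth curve of genus $g$. Here a semi-stable curve is a connected reduced compact curve whose only singularities are ordinary double points and each of whose smooth rational components meets the union of the other components in at least two points. For a topological space $Y$ with finite-dimensional total rational homology let $e(Y)=\sum_n(-1)^n\dim_{\mathbb Q}H_n(Y;\mathbb Q)$ denote its Euler number. Then for every $s\in B$ and every smooth fibre $X_{\rm gen}$ of $f$ the fibres $X_s$ and $X_{\rm gen}$ have finite-dimensional total rational homology, $X_s$ has only finitely many double points, and \[ \delta_s:=e(X_s)-e(X_{\rm gen})=\#\{\text{double points of }X_s\}. \] -/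

import Mathlib

open scoped Manifold ContDiff

universe u

noncomputable section

namespace SurfaceFibration

/-! ### Euler numbers -/

/-- The rational singular chain complex of a topological space. -/
def singularChains (Y : Type u) [TopologicalSpace Y] : ChainComplex (ModuleCat.{u} ℚ) ℕ :=
  ((AlgebraicTopology.singularChainComplexFunctor (ModuleCat.{u} ℚ)).obj
    (ModuleCat.of ℚ (ULift.{u} ℚ))).obj (TopCat.of Y)

/-- Rational singular homology `H_n(Y; ℚ)`. -/
abbrev singularHomology (n : ℕ) (Y : Type u) [TopologicalSpace Y] : ModuleCat.{u} ℚ :=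
  (singularChains Y).homology n

/-- The total rational homology of `Y` is finite dimensional, so that its Euler number is
defined. -/
def HasFiniteHomology (Y : Type u) [TopologicalSpace Y] : Prop :=
  (∀ n, Module.Finite ℚ (singularHomology n Y)) ∧
    ∃ N : ℕ, ∀ n, N < n → Subsingleton (singularHomology n Y)

/-- The Euler number `e(Y) = ∑ (-1)^n dim H_n(Y; ℚ)`. -/
def eulerNumber (Y : Type u) [TopologicalSpace Y] : ℤ :=
  (singularChains Y).homologyEulerChar

/-- The genus condition for compact connected Riemann surfaces: the first Betti number is `2g`. -/
def HasGenus (g : ℕ) (Y : Type u) [TopologicalSpace Y] : Prop :=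
  Module.finrank ℚ (singularHomology 1 Y) = 2 * g

/-! ### Fibres of a map from a complex surface to a complex curve -/

section

variable {X B : Type u} [TopologicalSpace X] [ChartedSpace (ℂ × ℂ) X]
  [TopologicalSpace B] [ChartedSpace ℂ B]

/-- The fibre `X_s` as a subset of `X` (with the subspace topology). -/
def fibre (f : X → B) (s : B) : Set X := f ⁻¹' {s}

/-- `f` is submersive at `p`, i.e. the analytic fibre through `p` is reduced and smooth at `p`. -/
def IsSmoothPoint (f : X → B) (p : X) : Prop :=
  mfderiv 𝓘(ℂ, ℂ × ℂ) 𝓘(ℂ, ℂ) f p ≠ 0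

/-- The analytic fibre through `p` has an ordinary double point at `p`: in suitable holomorphic
coordinates `(x, y)` of the surface centred at `p`, the local equation of the fibre (the function
`t ∘ f - t (f p)` for a local coordinate `t` of the base curve at `f p`) is `x * y`. -/
def IsDoublePoint (f : X → B) (p : X) : Prop :=
  ∃ φ ∈ IsManifold.maximalAtlas 𝓘(ℂ, ℂ × ℂ) ω X, p ∈ φ.source ∧ φ p = 0 ∧
    ∀ q ∈ φ.source, f q ∈ (chartAt ℂ (f p)).source ∧
      chartAt ℂ (f p) (f q) - chartAt ℂ (f p) (f p) = (φ q).1 * (φ q).2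

/-- The double points of `X_s`. -/
def doublePoints (f : X → B) (s : B) : Set X := {p ∈ fibre f s | IsDoublePoint f p}

/-- The fibre `X_s` is reduced and smooth. -/
def IsSmoothFibre (f : X → B) (s : B) : Prop := ∀ p ∈ fibre f s, IsSmoothPoint f p

/-- The irreducible components of a fibre `X_s` which is reduced with at most ordinary double
points: the closures of the connected components of the complement of the double points. -/
def fibreComponents (f : X → B) (s : B) : Set (Set X) :=
  {C | ∃ p ∈ fibre f s \ doublePoints f s,
    C = closure (connectedComponentIn (fibre f s \ doublePoints f s) p)}

/-- `X_s` is a semi-stable curve: it is connected, reduced, its only singularities are ordinary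
double points, and every smooth rational component meets the union of the other components in at
least two points. (Among the irreducible components of such a curve the smooth rational ones are
exactly those homeomorphic to the Riemann sphere.) -/
structure IsSemistableFibre (f : X → B) (s : B) : Prop where
  connected : IsConnected (fibre f s)
  nodal : ∀ p ∈ fibre f s, IsSmoothPoint f p ∨ IsDoublePoint f p
  rational : ∀ C ∈ fibreComponents f s, Nonempty (C ≃ₜ OnePoint ℂ) →
    2 ≤ (C ∩ ⋃₀ (fibreComponents f s \ {C})).encard

/-- A semi-stable genus `g` fibration: a surjective holomorphic map from a complex surface to a
complex curve all of whose fibres are semi-stable, with a smooth fibre of genus `g`. -/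
structure IsSemistableFibration (g : ℕ) (f : X → B) : Prop where
  holomorphic : ContMDiff 𝓘(ℂ, ℂ × ℂ) 𝓘(ℂ, ℂ) ω f
  surjective : Function.Surjective f
  semistable : ∀ s, IsSemistableFibre f s
  genus : ∃ t, IsSmoothFibre f t ∧ HasGenus g (fibre f t)

end

end SurfaceFibration

end

/-! The theorem follows once `e(X_s) - #{double points of X_s}` is known to be locally constant in
`s`: `B` is connected, and a smooth fibre has no double points, since a double point is a critical
point of `f`. Critical points near the compact fibre `X_s` are isolated, so every fibre close to
`X_s` and different from it is smooth. The local statement is therefore that `e(X_s)` exceeds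
`e(X_s')` by the number of double points of `X_s`, for `s' ≠ s` near `s` (`eventually_euler`).

Let `F` be `f` read in a coordinate of `B` centred at `s`. For a function `σ` with values in `[0,
1]` and a small constant `c`, consider the locus `F = c σ` (`hybrid`). It is `X_s` for `σ = 0` and a
nearby fibre for `σ = 1`. The comparison passes through a function `τ` that vanishes near the double
points and equals `1` away from them.

The locus `F = c τ` is homeomorphic to `X_s`. Away from the double points there are charts `(F, z)`,
in which the locus `F = c σ` is the graph of `c U(z)`, where `u = U(z)` solves `u = σ(c u, z)`. For
Lipschitz `σ` and small `c` this is a fixed point of a contraction, so changing `σ` inside one chart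
only slides the locus along the first coordinate (`nonempty_homeomorph_hybrid`). Finitely many such
changes lead from `0` to `τ` (`eventually_homeomorph_hybrid`).

The loci `F = c τ` and `F = c` differ only near the double points, where `F = x y`. There `x y = c`
is an annulus, of Euler number `0`, while `F = c τ` is a pair of discs crossing at a point, which is
contractible; near the boundary of the bidisc both consist of the same two annuli. By Mayer–Vietoris
each double point contributes `1` (`euler_node`, `euler_nodes`). The two comparisons combine to
`euler_degeneration`.

Two pieces of homology theory carry this. Mayer–Vietoris rests on barycentric subdivision: chains
that are small for a cover compute the homology (`isIso_homologyMap_small`). Moreover the nearby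
smooth fibre must have finite homology before anything can be counted, and this is proved for all
compact surfaces without a triangulation (`hasFiniteHomology_of_charts`): every neighbourhood of a
compact set contains a smaller one whose inclusion has finite rank in homology, a property that
passes to unions by a ladder of Mayer–Vietoris sequences and, for the whole space, says that the
identity has finite rank. -/

noncomputable section

section

/-! ### Subdivision of formal affine simplices -/

namespace AffineChain

/-- Formal chains of ordered `p`-tuples of points; `p = 0` is the augmentation. -/
abbrev Tuples (K : Type*) (p : ℕ) := (Fin p → K) →₀ ℚ

variable {K K' : Type*}

/-- The alternating sum of the faces of a tuple. -/
def bdry (K : Type*) (p : ℕ) : Tuples K (p + 1) →ₗ[ℚ] Tuples K p :=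
  Finsupp.linearCombination ℚ fun v : Fin (p + 1) → K =>
    ∑ i : Fin (p + 1), (-1 : ℚ) ^ (i : ℕ) • Finsupp.single (v ∘ i.succAbove) (1 : ℚ)

/-- The cone with apex `a`. -/
def cone (a : K) (p : ℕ) : Tuples K p →ₗ[ℚ] Tuples K (p + 1) :=
  Finsupp.lmapDomain ℚ ℚ fun v : Fin p → K => (Fin.cons a v : Fin (p + 1) → K)

lemma bdry_single {p : ℕ} (v : Fin (p + 1) → K) :
    bdry K p (Finsupp.single v 1) =
      ∑ i : Fin (p + 1), (-1 : ℚ) ^ (i : ℕ) • Finsupp.single (v ∘ i.succAbove) (1 : ℚ) := by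
  simp [bdry]

lemma cone_single {p : ℕ} (a : K) (v : Fin p → K) :
    cone a p (Finsupp.single v 1) = Finsupp.single (Fin.cons a v) 1 := by
  simp [cone]

lemma linearMap_ext_single {ι M : Type*} [AddCommGroup M] [Module ℚ M] {f g : (ι →₀ ℚ) →ₗ[ℚ] M}
    (h : ∀ i, f (Finsupp.single i 1) = g (Finsupp.single i 1)) : f = g := by
  ext i
  simpa using h i

lemma bdry_cone_zero (a : K) (c : Tuples K 0) : bdry K 0 (cone a 0 c) = c := by
  have : bdry K 0 ∘ₗ cone a 0 = LinearMap.id := by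
    refine linearMap_ext_single fun v => ?_
    simp only [LinearMap.comp_apply, cone_single, bdry_single]
    rw [Fin.sum_univ_one, LinearMap.id_apply, Fin.val_zero, pow_zero, one_smul]
    congr 1
  exact LinearMap.congr_fun this c

/-- The face opposite the apex is the original tuple. Every other face is the cone over a face of
the tuple, with its index raised by one and hence its sign reversed. -/
lemma bdry_cone {p : ℕ} (a : K) (c : Tuples K (p + 1)) :
    bdry K (p + 1) (cone a (p + 1) c) = c - cone a p (bdry K p c) := by
  have : bdry K (p + 1) ∘ₗ cone a (p + 1) = LinearMap.id - cone a p ∘ₗ bdry K p := by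
    refine linearMap_ext_single fun v => ?_
    simp only [LinearMap.comp_apply, cone_single, bdry_single, LinearMap.sub_apply,
      LinearMap.id_apply, map_sum, map_smul]
    rw [Fin.sum_univ_succ, sub_eq_add_neg, ← Finset.sum_neg_distrib]
    congr 1
    · simp only [Fin.val_zero, pow_zero, one_smul]
      congr 1
    · refine Finset.sum_congr rfl fun i _ => ?_
      rw [Fin.val_succ, pow_succ, mul_neg_one, neg_smul]
      congr 3
      funext j
      refine Fin.cases ?_ (fun j => ?_) j
      · simp
      · simp
  exact LinearMap.congr_fun this c

/-- A nonempty tuple is the cone on its tail from its first point, so the cone formula and induction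
replace the cancellation in a double sum over faces. -/
lemma bdry_bdry (p : ℕ) (c : Tuples K (p + 2)) : bdry K p (bdry K (p + 1) c) = 0 := by
  induction p with
  | zero =>
    have : bdry K 0 ∘ₗ bdry K 1 = 0 := by
      refine linearMap_ext_single fun v => ?_
      have hv : v = Fin.cons (v 0) (Fin.tail v) := (Fin.cons_self_tail v).symm
      rw [LinearMap.comp_apply, hv, ← cone_single, bdry_cone, map_sub, bdry_cone_zero, sub_self]
      rfl
    exact LinearMap.congr_fun this c
  | succ p ih =>
    have : bdry K (p + 1) ∘ₗ bdry K (p + 2) = 0 := by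
      refine linearMap_ext_single fun v => ?_
      have hv : v = Fin.cons (v 0) (Fin.tail v) := (Fin.cons_self_tail v).symm
      rw [LinearMap.comp_apply, hv, ← cone_single, bdry_cone, map_sub, bdry_cone, ih, map_zero,
        sub_zero, sub_self]
      rfl
    exact LinearMap.congr_fun this c

variable (b : ∀ p, (Fin (p + 1) → K) → K) (b' : ∀ p, (Fin (p + 1) → K') → K')

/-- Barycentric subdivision, for the choice `b` of barycentres. -/
def sd : ∀ p, Tuples K p →ₗ[ℚ] Tuples K p
  | 0 => LinearMap.id
  | p + 1 => Finsupp.linearCombination ℚ fun v =>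
      cone (b p v) p (sd p (bdry K p (Finsupp.single v 1)))

/-- The homotopy between the subdivision and the identity. -/
def sdHomotopy : ∀ p, Tuples K p →ₗ[ℚ] Tuples K (p + 1)
  | 0 => 0
  | p + 1 => Finsupp.linearCombination ℚ fun v =>
      cone (b p v) (p + 1) (sd b (p + 1) (Finsupp.single v 1) - Finsupp.single v 1 -
        sdHomotopy p (bdry K p (Finsupp.single v 1)))

lemma sd_single {p : ℕ} (v : Fin (p + 1) → K) : sd b (p + 1) (Finsupp.single v 1) =
    cone (b p v) p (sd b p (bdry K p (Finsupp.single v 1))) := by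
  simp [sd]

lemma sdHomotopy_single {p : ℕ} (v : Fin (p + 1) → K) :
    sdHomotopy b (p + 1) (Finsupp.single v 1) =
    cone (b p v) (p + 1) (sd b (p + 1) (Finsupp.single v 1) - Finsupp.single v 1 -
        sdHomotopy b p (bdry K p (Finsupp.single v 1))) := by
  simp [sdHomotopy]

lemma bdry_sd (p : ℕ) (c : Tuples K (p + 1)) :
    bdry K p (sd b (p + 1) c) = sd b p (bdry K p c) := by
  induction p with
  | zero =>
    have : bdry K 0 ∘ₗ sd b 1 = sd b 0 ∘ₗ bdry K 0 := by
      refine linearMap_ext_single fun v => ?_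
      rw [LinearMap.comp_apply, LinearMap.comp_apply, sd_single, bdry_cone_zero]
    exact LinearMap.congr_fun this c
  | succ p ih =>
    have : bdry K (p + 1) ∘ₗ sd b (p + 2) = sd b (p + 1) ∘ₗ bdry K (p + 1) := by
      refine linearMap_ext_single fun v => ?_
      rw [LinearMap.comp_apply, LinearMap.comp_apply, sd_single, bdry_cone, ih, bdry_bdry,
        map_zero, map_zero, sub_zero]
    exact LinearMap.congr_fun this c

/-- The chain that is coned in the definition of the homotopy is a cycle, by the same formula one
degree lower; hence the boundary of its cone is that chain itself. -/
lemma bdry_sdHomotopy (p : ℕ) (c : Tuples K (p + 1)) :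
    bdry K (p + 1) (sdHomotopy b (p + 1) c) =
      sd b (p + 1) c - c - sdHomotopy b p (bdry K p c) := by
  induction p with
  | zero =>
    have : bdry K 1 ∘ₗ sdHomotopy b 1 = sd b 1 - LinearMap.id - sdHomotopy b 0 ∘ₗ bdry K 0 := by
      refine linearMap_ext_single fun v => ?_
      rw [LinearMap.comp_apply, sdHomotopy_single, bdry_cone, map_sub (bdry K 0),
        map_sub (bdry K 0), bdry_sd]
      simp [sdHomotopy, sd]
    exact LinearMap.congr_fun this c
  | succ p ih =>
    have : bdry K (p + 2) ∘ₗ sdHomotopy b (p + 2) =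
        sd b (p + 2) - LinearMap.id - sdHomotopy b (p + 1) ∘ₗ bdry K (p + 1) := by
      refine linearMap_ext_single fun v => ?_
      rw [LinearMap.comp_apply, sdHomotopy_single, bdry_cone, map_sub (bdry K _),
        map_sub (bdry K _), bdry_sd, ih, bdry_bdry, map_zero, sub_zero, sub_self, map_zero, sub_zero]
      rfl
    exact LinearMap.congr_fun this c

/-- The map on formal chains induced by a map of points. -/
def mapPts (φ : K → K') (p : ℕ) : Tuples K p →ₗ[ℚ] Tuples K' p :=
  Finsupp.lmapDomain ℚ ℚ fun v => φ ∘ v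

lemma mapPts_single (φ : K → K') {p : ℕ} (v : Fin p → K) :
    mapPts φ p (Finsupp.single v 1) = Finsupp.single (φ ∘ v) 1 := by
  simp [mapPts]

lemma mapPts_bdry (φ : K → K') (p : ℕ) (c : Tuples K (p + 1)) :
    mapPts φ p (bdry K p c) = bdry K' p (mapPts φ (p + 1) c) := by
  have : mapPts φ p ∘ₗ bdry K p = bdry K' p ∘ₗ mapPts φ (p + 1) := by
    refine linearMap_ext_single fun v => ?_
    simp only [LinearMap.comp_apply, bdry_single, mapPts_single, map_sum, map_smul]
    rfl
  exact LinearMap.congr_fun this c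

lemma mapPts_cone (φ : K → K') (a : K) (p : ℕ) (c : Tuples K p) :
    mapPts φ (p + 1) (cone a p c) = cone (φ a) p (mapPts φ p c) := by
  have : mapPts φ (p + 1) ∘ₗ cone a p = cone (φ a) p ∘ₗ mapPts φ p := by
    refine linearMap_ext_single fun v => ?_
    simp only [LinearMap.comp_apply, cone_single, mapPts_single]
    congr 1
    funext j
    refine Fin.cases ?_ (fun j => ?_) j <;> simp
  exact LinearMap.congr_fun this c

variable {b b'}

/-- This naturality is what makes it irrelevant whether an affine simplex is subdivided inside the
ambient simplex or in its own parameter simplex. -/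
lemma mapPts_sd {φ : K → K'} (hφ : ∀ p v, φ (b p v) = b' p (φ ∘ v)) (p : ℕ) (c : Tuples K p) :
    mapPts φ p (sd b p c) = sd b' p (mapPts φ p c) := by
  induction p with
  | zero => rfl
  | succ p ih =>
    have : mapPts φ (p + 1) ∘ₗ sd b (p + 1) = sd b' (p + 1) ∘ₗ mapPts φ (p + 1) := by
      refine linearMap_ext_single fun v => ?_
      rw [LinearMap.comp_apply, LinearMap.comp_apply, sd_single, mapPts_cone, ih, mapPts_bdry,
        hφ, mapPts_single, sd_single]
    exact LinearMap.congr_fun this c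

lemma mapPts_sdHomotopy {φ : K → K'} (hφ : ∀ p v, φ (b p v) = b' p (φ ∘ v)) (p : ℕ)
    (c : Tuples K p) :
    mapPts φ (p + 1) (sdHomotopy b p c) = sdHomotopy b' p (mapPts φ p c) := by
  induction p with
  | zero => simp [sdHomotopy]
  | succ p ih =>
    have : mapPts φ (p + 2) ∘ₗ sdHomotopy b (p + 1) =
        sdHomotopy b' (p + 1) ∘ₗ mapPts φ (p + 1) := by
      refine linearMap_ext_single fun v => ?_
      rw [LinearMap.comp_apply, LinearMap.comp_apply, sdHomotopy_single, mapPts_cone,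
        map_sub (mapPts φ _), map_sub (mapPts φ _), ih, mapPts_bdry, hφ, mapPts_single, sdHomotopy_single, mapPts_sd hφ,
        mapPts_single]
    exact LinearMap.congr_fun this c

end AffineChain

end

section

/-! ### Subdivision of singular chains -/

namespace SingularChain

open AffineChain

/-- The standard topological `n`-simplex. -/
abbrev Simp (n : ℕ) : Type := stdSimplex ℝ (Fin (n + 1))

/-- The convex combination of the points `v i` with weights `w i`. -/
def comb {ι κ : Type*} [Fintype ι] [Fintype κ] (w : stdSimplex ℝ ι) (v : ι → stdSimplex ℝ κ) :
    stdSimplex ℝ κ :=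
  ⟨fun k => ∑ i, w i * v i k,
    fun k => Finset.sum_nonneg fun i _ => mul_nonneg (stdSimplex.zero_le _ _)
      (stdSimplex.zero_le _ _), by
    rw [Finset.sum_comm]
    simp only [← Finset.mul_sum, stdSimplex.sum_eq_one, mul_one]⟩

section comb

variable {ι κ μ : Type*} [Fintype ι] [Fintype κ] [Fintype μ]

lemma comb_apply (w : stdSimplex ℝ ι) (v : ι → stdSimplex ℝ κ) (k : κ) :
    comb w v k = ∑ i, w i * v i k := rfl

lemma comb_comb (w : stdSimplex ℝ ι) (v : ι → stdSimplex ℝ κ) (v' : κ → stdSimplex ℝ μ) :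
    comb (comb w v) v' = comb w fun i => comb (v i) v' := by
  ext k
  simp only [comb_apply, Finset.sum_mul, Finset.mul_sum]
  rw [Finset.sum_comm]
  simp only [mul_assoc]

lemma comb_vertex [DecidableEq ι] (i : ι) (v : ι → stdSimplex ℝ κ) :
    comb (stdSimplex.vertex i) v = v i := by
  ext k
  simp [comb_apply, Pi.single_apply]

lemma comb_vertices [DecidableEq ι] (w : stdSimplex ℝ ι) : comb w stdSimplex.vertex = w := by
  ext k
  simp [comb_apply, Pi.single_apply]

lemma map_eq_comb [DecidableEq κ] (f : ι → κ) (w : stdSimplex ℝ ι) :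
    stdSimplex.map f w = comb w fun i => stdSimplex.vertex (f i) := by
  ext k
  simp [comb_apply, Pi.single_apply, FunOnFinite.linearMap_apply_apply, Finset.sum_filter,
    eq_comm]

lemma comb_map (f : ι → κ) (w : stdSimplex ℝ ι) (v : κ → stdSimplex ℝ μ) :
    comb (stdSimplex.map f w) v = comb w (v ∘ f) := by
  classical
  rw [map_eq_comb, comb_comb]
  simp only [comb_vertex]
  rfl

lemma continuous_comb (v : ι → stdSimplex ℝ κ) :
    Continuous fun w : stdSimplex ℝ ι => comb w v := by
  refine Continuous.subtype_mk (continuous_pi fun k => continuous_finsetSum _ fun i _ => ?_) _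
  exact ((continuous_apply i).comp continuous_subtype_val).mul continuous_const

/-- Closed balls are convex: the coordinates of the difference are averages of the coordinates of
the differences `v i - x`. -/
lemma dist_comb_le {w : stdSimplex ℝ ι} {v : ι → stdSimplex ℝ κ} {x : stdSimplex ℝ κ} {r : ℝ}
    (hr : 0 ≤ r) (h : ∀ i, dist (v i) x ≤ r) : dist (comb w v) x ≤ r := by
  rw [Subtype.dist_eq, dist_pi_le_iff hr]
  intro k
  have h1 : (comb w v).1 k - x.1 k = ∑ i, w i * (v i k - x k) := by
    simp only [mul_sub, Finset.sum_sub_distrib, ← Finset.sum_mul, stdSimplex.sum_eq_one, one_mul]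
    rfl
  rw [Real.dist_eq, h1]
  calc |∑ i, w i * (v i k - x k)| ≤ ∑ i, |w i * (v i k - x k)| := Finset.abs_sum_le_sum_abs _ _
    _ ≤ ∑ i, w i * r := by
        refine Finset.sum_le_sum fun i _ => ?_
        rw [abs_mul, abs_of_nonneg (stdSimplex.zero_le w i)]
        refine mul_le_mul_of_nonneg_left ?_ (stdSimplex.zero_le w i)
        have := h i
        rw [Subtype.dist_eq, dist_pi_le_iff hr] at this
        exact this k
    _ = r := by rw [← Finset.sum_mul, stdSimplex.sum_eq_one, one_mul]

end comb

/-- The barycentre of a tuple of points of a simplex. -/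
def bary (n p : ℕ) (v : Fin (p + 1) → Simp n) : Simp n := comb stdSimplex.barycenter v

/-- In the average of the differences `v i - v j` the term `i = j` vanishes, so `p` terms of weight
`1 / (p + 1)` remain. -/
lemma dist_bary_le {n p : ℕ} {v : Fin (p + 1) → Simp n} {δ : ℝ}
    (h : ∀ i j, dist (v i) (v j) ≤ δ) (j : Fin (p + 1)) :
    dist (bary n p v) (v j) ≤ p / (p + 1) * δ := by
  have hδ : 0 ≤ δ := dist_nonneg.trans (h 0 0)
  have hr : 0 ≤ p / (p + 1) * δ := by positivity
  rw [Subtype.dist_eq, dist_pi_le_iff hr]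
  intro k
  have h1 : (bary n p v).1 k - (v j).1 k = ∑ i, ((p : ℝ) + 1)⁻¹ * (v i k - v j k) := by
    rw [← Finset.mul_sum, Finset.sum_sub_distrib, mul_sub, Finset.sum_const, Finset.card_univ,
      Fintype.card_fin, nsmul_eq_mul, ← mul_assoc]
    push_cast
    rw [inv_mul_cancel₀ (by positivity), one_mul]
    congr 1
    change ∑ i, (Fintype.card (Fin (p + 1)) : ℝ)⁻¹ * v i k = _
    rw [Finset.mul_sum]
    simp
  rw [Real.dist_eq, h1]
  calc |∑ i, ((p : ℝ) + 1)⁻¹ * (v i k - v j k)|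
      ≤ ∑ i, |((p : ℝ) + 1)⁻¹ * (v i k - v j k)| := Finset.abs_sum_le_sum_abs _ _
    _ = ∑ i ∈ Finset.univ.erase j, |((p : ℝ) + 1)⁻¹ * (v i k - v j k)| := by
        rw [← Finset.add_sum_erase _ _ (Finset.mem_univ j)]
        simp
    _ ≤ ∑ i ∈ Finset.univ.erase j, ((p : ℝ) + 1)⁻¹ * δ := by
        refine Finset.sum_le_sum fun i _ => ?_
        rw [abs_mul, abs_of_nonneg (by positivity)]
        refine mul_le_mul_of_nonneg_left ?_ (by positivity)
        have := h i j
        rw [Subtype.dist_eq, dist_pi_le_iff hδ] at this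
        exact this k
    _ = p / (p + 1) * δ := by
        rw [Finset.sum_const, Finset.card_erase_of_mem (Finset.mem_univ _), Finset.card_univ,
          Fintype.card_fin, nsmul_eq_mul]
        simp only [Nat.add_sub_cancel]
        ring

lemma map_mem_of_mem_supported {ι M : Type*} [AddCommGroup M] [Module ℚ M]
    {f : (ι →₀ ℚ) →ₗ[ℚ] M} {s : Set ι} {N : Submodule ℚ M}
    (h : ∀ i ∈ s, f (Finsupp.single i 1) ∈ N) {c : ι →₀ ℚ} (hc : c ∈ Finsupp.supported ℚ ℚ s) :
    f c ∈ N := by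
  have : Finsupp.supported ℚ ℚ s ≤ N.comap f := by
    rw [Finsupp.supported_eq_span_single, Submodule.span_le]
    rintro _ ⟨i, hi, rfl⟩
    exact h i hi
  exact this hc

/-- Tuples all of whose points are within distance `δ` of each other. -/
def fine (n p : ℕ) (δ : ℝ) : Set (Fin p → Simp n) := {w | ∀ i j, dist (w i) (w j) ≤ δ}

/-- Two properties must be carried through the induction together. Subdivision stays in every closed
ball containing the original points, which bounds the distance from the new apex; and its mesh is
smaller, which bounds the distances between points inherited from a face. -/
lemma sd_single_mem {n p : ℕ} {v : Fin p → Simp n} {δ : ℝ} (h : v ∈ fine n p δ) :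
    sd (bary n) p (Finsupp.single v 1) ∈ Finsupp.supported ℚ ℚ
      {w : Fin p → Simp n | (∀ x r, 0 ≤ r → (∀ j, dist (v j) x ≤ r) → ∀ i, dist (w i) x ≤ r) ∧
        w ∈ fine n p (p / (p + 1) * δ)} := by
  induction p with
  | zero =>
    exact Finsupp.single_mem_supported _ _ ⟨fun _ _ _ _ i => i.elim0, fun i => i.elim0⟩
  | succ p ih =>
    have hδ : 0 ≤ δ := dist_nonneg.trans (h 0 0)
    -- Both kinds of edges satisfy the bound with `p / (p + 1)`; the factor in the statement is
    -- indexed by the number of points rather than by the dimension, and is larger but still below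
    -- `1`.
    have hκ : (p : ℝ) / (p + 1) * δ ≤ ((p + 1 : ℕ) : ℝ) / ((p + 1 : ℕ) + 1) * δ := by
      refine mul_le_mul_of_nonneg_right ?_ hδ
      push_cast
      rw [div_le_div_iff₀ (by positivity) (by positivity)]
      nlinarith
    rw [sd_single, bdry_single, map_sum, map_sum]
    refine Submodule.sum_mem _ fun i _ => ?_
    rw [map_smul, map_smul]
    refine Submodule.smul_mem _ _ ?_
    have hi := ih (v := v ∘ i.succAbove) (fun a c => h _ _)
    refine map_mem_of_mem_supported (fun w hw => ?_) hi
    rw [cone_single]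
    refine Finsupp.single_mem_supported _ _ ⟨fun x r hr hx j => ?_, fun j k => ?_⟩
    · refine Fin.cases ?_ (fun j => ?_) j
      · exact dist_comb_le hr hx
      · exact hw.1 x r hr (fun _ => hx _) j
    · have key : ∀ j, dist (w j) (bary n p v) ≤ p / (p + 1) * δ := fun j =>
        hw.1 _ _ (by positivity) (fun l => by
          rw [dist_comm]; exact dist_bary_le h _) j
      refine le_trans ?_ hκ
      refine Fin.cases ?_ (fun j => ?_) j <;> refine Fin.cases ?_ (fun k => ?_) k
      · simp only [Fin.cons_zero, dist_self]; positivity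
      · simp only [Fin.cons_zero, Fin.cons_succ]; rw [dist_comm]; exact key k
      · simp only [Fin.cons_zero, Fin.cons_succ]; exact key j
      · simp only [Fin.cons_succ]; exact hw.2 j k

lemma sd_iterate_mem {n p : ℕ} {v : Fin p → Simp n} {δ : ℝ} (h : v ∈ fine n p δ) (k : ℕ) :
    (sd (bary n) p)^[k] (Finsupp.single v 1) ∈
      Finsupp.supported ℚ ℚ (fine n p ((p / (p + 1) : ℝ) ^ k * δ)) := by
  induction k with
  | zero => simpa using Finsupp.single_mem_supported ℚ (1 : ℚ) h
  | succ k ih =>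
    rw [Function.iterate_succ_apply', pow_succ', mul_assoc]
    refine map_mem_of_mem_supported (fun w hw => ?_) ih
    exact Finsupp.supported_mono (fun _ hx => hx.2) (sd_single_mem hw)

section Singular

variable {Y : Type u} [TopologicalSpace Y]

/-- Rational singular chains. -/
abbrev Chain (Y : Type u) [TopologicalSpace Y] (n : ℕ) : Type u := C(Simp n, Y) →₀ ℚ

/-- The inclusion of a face of the standard simplex. -/
def face (n : ℕ) (i : Fin (n + 2)) : C(Simp n, Simp (n + 1)) :=
  ⟨stdSimplex.map i.succAbove, stdSimplex.continuous_map _⟩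

/-- The singular boundary. -/
def bd (Y : Type u) [TopologicalSpace Y] (n : ℕ) : Chain Y (n + 1) →ₗ[ℚ] Chain Y n :=
  Finsupp.linearCombination ℚ fun σ : C(Simp (n + 1), Y) =>
    ∑ i : Fin (n + 2), (-1 : ℚ) ^ (i : ℕ) • Finsupp.single (σ.comp (face n i)) (1 : ℚ)

lemma bd_single {n : ℕ} (σ : C(Simp (n + 1), Y)) :
    bd Y n (Finsupp.single σ 1) =
      ∑ i : Fin (n + 2), (-1 : ℚ) ^ (i : ℕ) • Finsupp.single (σ.comp (face n i)) (1 : ℚ) := by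
  simp [bd]

/-- The affine simplex with the given vertices. -/
def affineSimplex {n p : ℕ} (v : Fin (p + 1) → Simp n) : C(Simp p, Simp n) :=
  ⟨fun w => comb w v, continuous_comb v⟩

lemma affineSimplex_comp_face {n p : ℕ} (v : Fin (p + 2) → Simp n) (i : Fin (p + 2)) :
    (affineSimplex v).comp (face p i) = affineSimplex (v ∘ i.succAbove) := by
  ext1 w
  exact comb_map _ _ _

/-- The vertices of the standard simplex. -/
def vertices (n : ℕ) : Fin (n + 1) → Simp n := fun i => stdSimplex.vertex i

lemma affineSimplex_vertices (n : ℕ) : affineSimplex (vertices n) = ContinuousMap.id _ := by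
  ext1 w
  exact comb_vertices w

/-- The singular chain in `Y` obtained from a formal affine chain in the domain of `σ`. -/
def push {n : ℕ} (σ : C(Simp n, Y)) (p : ℕ) : Tuples (Simp n) (p + 1) →ₗ[ℚ] Chain Y p :=
  Finsupp.lmapDomain ℚ ℚ fun v => σ.comp (affineSimplex v)

lemma push_single {n : ℕ} (σ : C(Simp n, Y)) {p : ℕ} (v : Fin (p + 1) → Simp n) :
    push σ p (Finsupp.single v 1) = Finsupp.single (σ.comp (affineSimplex v)) 1 := by
  simp [push]

/-- Every singular simplex is the push of its own tuple of vertices. All identities for singular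
chains below are reduced in this way to identities between formal affine chains. -/
lemma push_vertices {n : ℕ} (σ : C(Simp n, Y)) :
    push σ n (Finsupp.single (vertices n) 1) = Finsupp.single σ 1 := by
  rw [push_single, affineSimplex_vertices, ContinuousMap.comp_id]

lemma bd_push {n : ℕ} (σ : C(Simp n, Y)) (p : ℕ) (c : Tuples (Simp n) (p + 2)) :
    bd Y p (push σ (p + 1) c) = push σ p (bdry _ (p + 1) c) := by
  have : bd Y p ∘ₗ push σ (p + 1) = push σ p ∘ₗ bdry _ (p + 1) := by
    refine linearMap_ext_single fun v => ?_
    simp only [LinearMap.comp_apply, push_single, bd_single, bdry_single, map_sum, map_smul,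
      ContinuousMap.comp_assoc, affineSimplex_comp_face]
  exact LinearMap.congr_fun this c

lemma bd_bd (n : ℕ) (c : Chain Y (n + 2)) : bd Y n (bd Y (n + 1) c) = 0 := by
  have : bd Y n ∘ₗ bd Y (n + 1) = 0 := by
    refine linearMap_ext_single fun σ => ?_
    rw [LinearMap.comp_apply, ← push_vertices, bd_push, bd_push, bdry_bdry, map_zero]
    rfl
  exact LinearMap.congr_fun this c

/-- Barycentric subdivision of singular chains. -/
def subdiv (Y : Type u) [TopologicalSpace Y] (n : ℕ) : Chain Y n →ₗ[ℚ] Chain Y n :=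
  Finsupp.linearCombination ℚ fun σ : C(Simp n, Y) =>
    push σ n (sd (bary n) (n + 1) (Finsupp.single (vertices n) 1))

/-- The homotopy from the identity to the subdivision of singular chains. -/
def subdivHomotopy (Y : Type u) [TopologicalSpace Y] (n : ℕ) :
    Chain Y n →ₗ[ℚ] Chain Y (n + 1) :=
  Finsupp.linearCombination ℚ fun σ : C(Simp n, Y) =>
    push σ (n + 1) (sdHomotopy (bary n) (n + 1) (Finsupp.single (vertices n) 1))

lemma push_comp_affineSimplex {n p : ℕ} (σ : C(Simp n, Y)) (v : Fin (p + 1) → Simp n) (q : ℕ)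
    (c : Tuples (Simp p) (q + 1)) :
    push (σ.comp (affineSimplex v)) q c = push σ q (mapPts (affineSimplex v) (q + 1) c) := by
  have : push (σ.comp (affineSimplex v)) q = push σ q ∘ₗ mapPts (affineSimplex v) (q + 1) := by
    refine linearMap_ext_single fun w => ?_
    simp only [LinearMap.comp_apply, push_single, mapPts_single, ContinuousMap.comp_assoc]
    congr 2
    ext1 x
    exact comb_comb _ _ _
  exact LinearMap.congr_fun this c

lemma affineSimplex_bary {n p : ℕ} (v : Fin (p + 1) → Simp n) (q : ℕ) (w : Fin (q + 1) → Simp p) :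
    affineSimplex v (bary p q w) = bary n q (affineSimplex v ∘ w) :=
  comb_comb _ _ _

lemma affineSimplex_comp_vertices {n p : ℕ} (v : Fin (p + 1) → Simp n) :
    affineSimplex v ∘ vertices p = v := by
  funext i
  exact comb_vertex i v

lemma subdiv_push {n : ℕ} (σ : C(Simp n, Y)) (p : ℕ) (c : Tuples (Simp n) (p + 1)) :
    subdiv Y p (push σ p c) = push σ p (sd (bary n) (p + 1) c) := by
  have : subdiv Y p ∘ₗ push σ p = push σ p ∘ₗ sd (bary n) (p + 1) := by
    refine linearMap_ext_single fun v => ?_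
    simp only [LinearMap.comp_apply, push_single]
    rw [subdiv, Finsupp.linearCombination_single, one_smul, push_comp_affineSimplex,
      mapPts_sd (b' := bary n) (affineSimplex_bary v), mapPts_single, affineSimplex_comp_vertices]
  exact LinearMap.congr_fun this c

lemma subdivHomotopy_push {n : ℕ} (σ : C(Simp n, Y)) (p : ℕ) (c : Tuples (Simp n) (p + 1)) :
    subdivHomotopy Y p (push σ p c) = push σ (p + 1) (sdHomotopy (bary n) (p + 1) c) := by
  have : subdivHomotopy Y p ∘ₗ push σ p = push σ (p + 1) ∘ₗ sdHomotopy (bary n) (p + 1) := by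
    refine linearMap_ext_single fun v => ?_
    simp only [LinearMap.comp_apply, push_single]
    rw [subdivHomotopy, Finsupp.linearCombination_single, one_smul, push_comp_affineSimplex,
      mapPts_sdHomotopy (b' := bary n) (affineSimplex_bary v), mapPts_single,
      affineSimplex_comp_vertices]
  exact LinearMap.congr_fun this c

lemma bd_subdiv (n : ℕ) (c : Chain Y (n + 1)) :
    bd Y n (subdiv Y (n + 1) c) = subdiv Y n (bd Y n c) := by
  have : bd Y n ∘ₗ subdiv Y (n + 1) = subdiv Y n ∘ₗ bd Y n := by
    refine linearMap_ext_single fun σ => ?_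
    rw [LinearMap.comp_apply, LinearMap.comp_apply, ← push_vertices, subdiv_push, bd_push,
      bd_push, subdiv_push, bdry_sd]
  exact LinearMap.congr_fun this c

lemma bd_subdivHomotopy_zero (c : Chain Y 0) :
    bd Y 0 (subdivHomotopy Y 0 c) = subdiv Y 0 c - c := by
  have : bd Y 0 ∘ₗ subdivHomotopy Y 0 = subdiv Y 0 - LinearMap.id := by
    refine linearMap_ext_single fun σ => ?_
    rw [LinearMap.comp_apply, LinearMap.sub_apply, ← push_vertices, subdivHomotopy_push, bd_push,
      subdiv_push, bdry_sdHomotopy, map_sub, map_sub]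
    simp [sdHomotopy]
  exact LinearMap.congr_fun this c

lemma bd_subdivHomotopy (n : ℕ) (c : Chain Y (n + 1)) :
    bd Y (n + 1) (subdivHomotopy Y (n + 1) c) =
      subdiv Y (n + 1) c - c - subdivHomotopy Y n (bd Y n c) := by
  have : bd Y (n + 1) ∘ₗ subdivHomotopy Y (n + 1) =
      subdiv Y (n + 1) - LinearMap.id - subdivHomotopy Y n ∘ₗ bd Y n := by
    refine linearMap_ext_single fun σ => ?_
    rw [LinearMap.comp_apply, LinearMap.sub_apply, LinearMap.sub_apply, LinearMap.comp_apply,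
      ← push_vertices, subdivHomotopy_push, bd_push, subdiv_push, bd_push, subdivHomotopy_push,
      bdry_sdHomotopy, map_sub, map_sub]
    rfl
  exact LinearMap.congr_fun this c

/-- The chains supported in a subset. -/
def chainsIn (U : Set Y) (n : ℕ) : Submodule ℚ (Chain Y n) :=
  Finsupp.supported ℚ ℚ {σ | ∀ x, σ x ∈ U}

lemma push_mem_chainsIn {U : Set Y} {n : ℕ} {σ : C(Simp n, Y)} (hσ : ∀ x, σ x ∈ U) (p : ℕ)
    (c : Tuples (Simp n) (p + 1)) : push σ p c ∈ chainsIn U p := by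
  refine map_mem_of_mem_supported (s := Set.univ) (fun v _ => ?_) (by simp)
  rw [push_single]
  exact Finsupp.single_mem_supported _ _ fun x => hσ _

lemma bd_mem_chainsIn {U : Set Y} {n : ℕ} {c : Chain Y (n + 1)} (hc : c ∈ chainsIn U (n + 1)) :
    bd Y n c ∈ chainsIn U n := by
  refine map_mem_of_mem_supported (fun σ hσ => ?_) hc
  rw [← push_vertices, bd_push]
  exact push_mem_chainsIn hσ _ _

lemma subdiv_mem_chainsIn {U : Set Y} {n : ℕ} {c : Chain Y n} (hc : c ∈ chainsIn U n) :
    subdiv Y n c ∈ chainsIn U n := by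
  refine map_mem_of_mem_supported (fun σ hσ => ?_) hc
  rw [← push_vertices, subdiv_push]
  exact push_mem_chainsIn hσ _ _

lemma subdivHomotopy_mem_chainsIn {U : Set Y} {n : ℕ} {c : Chain Y n} (hc : c ∈ chainsIn U n) :
    subdivHomotopy Y n c ∈ chainsIn U (n + 1) := by
  refine map_mem_of_mem_supported (fun σ hσ => ?_) hc
  rw [← push_vertices, subdivHomotopy_push]
  exact push_mem_chainsIn hσ _ _

lemma map_mem_sup {R M N : Type*} [Semiring R] [AddCommMonoid M] [AddCommMonoid N] [Module R M]
    [Module R N] {f : M →ₗ[R] N} {p q : Submodule R M} {p' q' : Submodule R N}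
    (hp : ∀ x ∈ p, f x ∈ p') (hq : ∀ x ∈ q, f x ∈ q') {x : M} (hx : x ∈ p ⊔ q) :
    f x ∈ p' ⊔ q' := by
  obtain ⟨a, ha, b, hb, rfl⟩ := Submodule.mem_sup.1 hx
  rw [map_add]
  exact Submodule.add_mem_sup (hp a ha) (hq b hb)

/-- A simplex in the union of two relatively open sets becomes small after subdivision. -/
lemma exists_subdiv_single_mem {P U V : Set Y} (hU : IsOpen U) (hV : IsOpen V) (hP : P ⊆ U ∪ V)
    {n : ℕ} {σ : C(Simp n, Y)} (hσ : ∀ x, σ x ∈ P) :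
    ∃ k, (subdiv Y n)^[k] (Finsupp.single σ 1) ∈ chainsIn (P ∩ U) n ⊔ chainsIn (P ∩ V) n := by
  -- A Lebesgue number of the cover of the domain by the preimages of `U` and `V`; once the mesh is
  -- below it, every piece maps into `U` or into `V`.
  obtain ⟨δ, hδ, hleb⟩ := lebesgue_number_lemma_of_metric (s := (Set.univ : Set (Simp n)))
    (c := fun b : Bool => σ ⁻¹' (bif b then U else V)) isCompact_univ
    (fun b => (by cases b; exacts [hV, hU] : IsOpen (bif b then U else V)).preimage σ.continuous)
    (fun x _ => by
      rcases hP (hσ x) with h | h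
      · exact Set.mem_iUnion.2 ⟨true, h⟩
      · exact Set.mem_iUnion.2 ⟨false, h⟩)
  obtain ⟨D, hD⟩ : ∃ D, vertices n ∈ fine n (n + 1) D :=
    ⟨Metric.diam (Set.univ : Set (Simp n)), fun i j =>
      Metric.dist_le_diam_of_mem isCompact_univ.isBounded (Set.mem_univ _) (Set.mem_univ _)⟩
  have hlim : Filter.Tendsto
      (fun k : ℕ => (((n + 1 : ℕ) : ℝ) / ((n + 1 : ℕ) + 1)) ^ k * D) Filter.atTop (nhds 0) := by
    have := (tendsto_pow_atTop_nhds_zero_of_lt_one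
      (r := ((n + 1 : ℕ) : ℝ) / ((n + 1 : ℕ) + 1)) (by positivity)
      (by rw [div_lt_one (by positivity)]; linarith)).mul_const D
    simpa using this
  obtain ⟨k, hk⟩ := (hlim.eventually (gt_mem_nhds hδ)).exists
  refine ⟨k, ?_⟩
  have hit : ∀ k, (subdiv Y n)^[k] (Finsupp.single σ 1) =
      push σ n ((sd (bary n) (n + 1))^[k] (Finsupp.single (vertices n) 1)) := by
    intro k
    induction k with
    | zero => exact (push_vertices σ).symm
    | succ k ih => rw [Function.iterate_succ_apply', ih, subdiv_push, Function.iterate_succ_apply']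
  rw [hit]
  refine map_mem_of_mem_supported (fun w hw => ?_) (sd_iterate_mem hD k)
  rw [push_single]
  obtain ⟨b, hb⟩ := hleb (w 0) (Set.mem_univ _)
  have hw' : ∀ x, affineSimplex w x ∈ Metric.ball (w 0) δ := fun x =>
    lt_of_le_of_lt (dist_comb_le (dist_nonneg.trans (hw 0 0)) fun i => hw i 0) hk
  cases b
  · exact Submodule.mem_sup_right (Finsupp.single_mem_supported _ _
      fun x => ⟨hσ _, hb (hw' x)⟩)
  · exact Submodule.mem_sup_left (Finsupp.single_mem_supported _ _
      fun x => ⟨hσ _, hb (hw' x)⟩)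

/-- Different simplices need different numbers of subdivisions. Small chains remain small under
further subdivision, so for a sum of two chains the sum of the two exponents works. -/
lemma exists_subdiv_mem {P U V : Set Y} (hU : IsOpen U) (hV : IsOpen V) (hP : P ⊆ U ∪ V)
    {n : ℕ} {c : Chain Y n} (hc : c ∈ chainsIn P n) :
    ∃ k, (subdiv Y n)^[k] c ∈ chainsIn (P ∩ U) n ⊔ chainsIn (P ∩ V) n := by
  have step : ∀ x ∈ chainsIn (P ∩ U) n ⊔ chainsIn (P ∩ V) n, ∀ k,
      (subdiv Y n)^[k] x ∈ chainsIn (P ∩ U) n ⊔ chainsIn (P ∩ V) n := by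
    intro x hx k
    induction k with
    | zero => exact hx
    | succ k ih =>
      rw [Function.iterate_succ_apply']
      exact map_mem_sup (fun _ => subdiv_mem_chainsIn) (fun _ => subdiv_mem_chainsIn) ih
  have hpow : ∀ k x, (subdiv Y n)^[k] x = (subdiv Y n ^ k) x := fun k x => by
    rw [Module.End.pow_apply]
  rw [chainsIn, Finsupp.supported_eq_span_single] at hc
  induction hc using Submodule.span_induction with
  | mem x hx =>
    obtain ⟨σ, hσ, rfl⟩ := hx
    exact exists_subdiv_single_mem hU hV hP hσ
  | zero => exact ⟨0, Submodule.zero_mem _⟩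
  | add x y _ _ hx hy =>
    obtain ⟨k, hk⟩ := hx
    obtain ⟨l, hl⟩ := hy
    refine ⟨k + l, ?_⟩
    rw [hpow, map_add, ← hpow, ← hpow]
    refine Submodule.add_mem _ ?_ ?_
    · rw [add_comm k l, Function.iterate_add_apply]
      exact step _ hk _
    · rw [Function.iterate_add_apply]
      exact step _ hl _
  | smul a x _ hx =>
    obtain ⟨k, hk⟩ := hx
    refine ⟨k, ?_⟩
    rw [hpow, map_smul, ← hpow]
    exact Submodule.smul_mem _ _ hk

/-- Every relative cycle of small chains is homologous to a small chain. -/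
lemma exists_sub_bd_mem {P U V : Set Y} (hU : IsOpen U) (hV : IsOpen V) (hP : P ⊆ U ∪ V) (n : ℕ)
    {c : Chain Y (n + 1)} (hc : c ∈ chainsIn P (n + 1))
    (hd : bd Y n c ∈ chainsIn (P ∩ U) n ⊔ chainsIn (P ∩ V) n) :
    ∃ b ∈ chainsIn P (n + 2),
      c - bd Y (n + 1) b ∈ chainsIn (P ∩ U) (n + 1) ⊔ chainsIn (P ∩ V) (n + 1) := by
  obtain ⟨k, hk⟩ := exists_subdiv_mem hU hV hP hc
  induction k generalizing c with
  | zero => exact ⟨0, Submodule.zero_mem _, by simpa using hk⟩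
  | succ k ih =>
    obtain ⟨b, hb, h⟩ := ih (c := subdiv Y (n + 1) c) (subdiv_mem_chainsIn hc)
      (by rw [bd_subdiv]
          exact map_mem_sup (fun _ => subdiv_mem_chainsIn) (fun _ => subdiv_mem_chainsIn) hd) hk
    -- One subdivision changes `c` by the boundary of its homotopy, up to the homotopy of `bd c`,
    -- and the latter is small because `bd c` is.
    refine ⟨b - subdivHomotopy Y (n + 1) c,
      Submodule.sub_mem _ hb (subdivHomotopy_mem_chainsIn hc), ?_⟩
    have h2 : subdivHomotopy Y n (bd Y n c) ∈
        chainsIn (P ∩ U) (n + 1) ⊔ chainsIn (P ∩ V) (n + 1) :=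
      map_mem_sup (fun _ => subdivHomotopy_mem_chainsIn) (fun _ => subdivHomotopy_mem_chainsIn) hd
    have h3 : c - bd Y (n + 1) (b - subdivHomotopy Y (n + 1) c) =
        (subdiv Y (n + 1) c - bd Y (n + 1) b) - subdivHomotopy Y n (bd Y n c) := by
      rw [map_sub, bd_subdivHomotopy]
      abel
    rw [h3]
    exact Submodule.sub_mem _ h h2

lemma exists_sub_bd_mem_zero {P U V : Set Y} (hU : IsOpen U) (hV : IsOpen V) (hP : P ⊆ U ∪ V)
    {c : Chain Y 0} (hc : c ∈ chainsIn P 0) :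
    ∃ b ∈ chainsIn P 1, c - bd Y 0 b ∈ chainsIn (P ∩ U) 0 ⊔ chainsIn (P ∩ V) 0 := by
  obtain ⟨k, hk⟩ := exists_subdiv_mem hU hV hP hc
  induction k generalizing c with
  | zero => exact ⟨0, Submodule.zero_mem _, by simpa using hk⟩
  | succ k ih =>
    obtain ⟨b, hb, h⟩ := ih (c := subdiv Y 0 c) (subdiv_mem_chainsIn hc) hk
    refine ⟨b - subdivHomotopy Y 0 c,
      Submodule.sub_mem _ hb (subdivHomotopy_mem_chainsIn hc), ?_⟩
    have h3 : c - bd Y 0 (b - subdivHomotopy Y 0 c) = subdiv Y 0 c - bd Y 0 b := by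
      rw [map_sub, bd_subdivHomotopy_zero]
      abel
    rwa [h3]

end Singular

end SingularChain

end

section

/-! ### Subcomplexes and the Mayer–Vietoris sequence -/

open CategoryTheory Limits

section LinearComplex

variable {M N : ℕ → Type u} [∀ n, AddCommGroup (M n)] [∀ n, Module ℚ (M n)]
  [∀ n, AddCommGroup (N n)] [∀ n, Module ℚ (N n)]

/-- The chain complex of a sequence of linear maps. -/
def linCx (d : ∀ n, M (n + 1) →ₗ[ℚ] M n) (hd : ∀ n x, d n (d (n + 1) x) = 0) :
    ChainComplex (ModuleCat.{u} ℚ) ℕ :=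
  ChainComplex.of (fun n => ModuleCat.of ℚ (M n)) (fun n => ModuleCat.ofHom (d n))
    (fun n => by ext x; exact hd n x)

variable {d : ∀ n, M (n + 1) →ₗ[ℚ] M n} (hd : ∀ n x, d n (d (n + 1) x) = 0)
  {d' : ∀ n, N (n + 1) →ₗ[ℚ] N n} (hd' : ∀ n x, d' n (d' (n + 1) x) = 0)

lemma linCx_d (n : ℕ) : (linCx d hd).d (n + 1) n = ModuleCat.ofHom (d n) :=
  ChainComplex.of_d (fun n => ModuleCat.of ℚ (M n)) (fun n => ModuleCat.ofHom (d n)) n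

/-- The chain map given by a compatible family of linear maps. -/
def linCxMap (f : ∀ n, M n →ₗ[ℚ] N n) (hf : ∀ n x, d' n (f (n + 1) x) = f n (d n x)) :
    linCx d hd ⟶ linCx d' hd' :=
  ChainComplex.ofHom (X := linCx d hd) (Y := linCx d' hd') (fun n => ModuleCat.ofHom (f n))
    (fun n => by
      rw [linCx_d, linCx_d]
      ext x
      exact hf n x)

end LinearComplex

/-- A family of submodules stable under the differential. -/
structure DSub {M : ℕ → Type u} [∀ n, AddCommGroup (M n)] [∀ n, Module ℚ (M n)]
    (d : ∀ n, M (n + 1) →ₗ[ℚ] M n) where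
  /-- The submodules. -/
  carrier : ∀ n, Submodule ℚ (M n)
  map_d : ∀ n, ∀ x ∈ carrier (n + 1), d n x ∈ carrier n

namespace DSub

variable {M : ℕ → Type u} [∀ n, AddCommGroup (M n)] [∀ n, Module ℚ (M n)]
  {d : ∀ n, M (n + 1) →ₗ[ℚ] M n} (hd : ∀ n x, d n (d (n + 1) x) = 0)

/-- The chain complex of a stable family of submodules. -/
def cx (p : DSub d) : ChainComplex (ModuleCat.{u} ℚ) ℕ :=
  linCx (M := fun n => p.carrier n) (fun n => (d n).restrict (p.map_d n))
    (fun n x => Subtype.ext (hd n x))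

lemma cx_d (p : DSub d) (n : ℕ) :
    (p.cx hd).d (n + 1) n = ModuleCat.ofHom ((d n).restrict (p.map_d n)) :=
  linCx_d _ n

/-- The inclusion of complexes. -/
def incl (p q : DSub d) (h : ∀ n, p.carrier n ≤ q.carrier n) : p.cx hd ⟶ q.cx hd :=
  linCxMap _ _ (fun n => Submodule.inclusion (h n)) (fun _ _ => rfl)

lemma incl_comp (p q r : DSub d) (h : ∀ n, p.carrier n ≤ q.carrier n)
    (h' : ∀ n, q.carrier n ≤ r.carrier n) :
    incl hd p q h ≫ incl hd q r h' = incl hd p r (fun n => (h n).trans (h' n)) := by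
  ext n x; rfl

/-- The product of the complexes of two stable families. -/
def prodCx (p q : DSub d) : ChainComplex (ModuleCat.{u} ℚ) ℕ :=
  linCx (M := fun n => p.carrier n × q.carrier n)
    (fun n => ((d n).restrict (p.map_d n)).prodMap ((d n).restrict (q.map_d n)))
    (fun n x => Prod.ext (Subtype.ext (hd n x.1)) (Subtype.ext (hd n x.2)))

variable (p q : DSub d)

/-- The first inclusion. -/
def inlCx : p.cx hd ⟶ prodCx hd p q :=
  linCxMap _ _ (fun _ => LinearMap.inl ℚ _ _)
    (fun n _ => Prod.ext rfl (Subtype.ext (map_zero (d n))))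

/-- The second inclusion. -/
def inrCx : q.cx hd ⟶ prodCx hd p q :=
  linCxMap _ _ (fun _ => LinearMap.inr ℚ _ _)
    (fun n _ => Prod.ext (Subtype.ext (map_zero (d n))) rfl)

/-- The first projection. -/
def fstCx : prodCx hd p q ⟶ p.cx hd :=
  linCxMap _ _ (fun _ => LinearMap.fst ℚ _ _) (fun _ _ => rfl)

/-- The second projection. -/
def sndCx : prodCx hd p q ⟶ q.cx hd :=
  linCxMap _ _ (fun _ => LinearMap.snd ℚ _ _) (fun _ _ => rfl)

lemma inl_fst : inlCx hd p q ≫ fstCx hd p q = 𝟙 _ := by ext n x; rfl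
lemma inl_snd : inlCx hd p q ≫ sndCx hd p q = 0 := by ext n x; rfl
lemma inr_snd : inrCx hd p q ≫ sndCx hd p q = 𝟙 _ := by ext n x; rfl
lemma inr_fst : inrCx hd p q ≫ fstCx hd p q = 0 := by ext n x; rfl
lemma fst_inl_add_snd_inr :
    fstCx hd p q ≫ inlCx hd p q + sndCx hd p q ≫ inrCx hd p q = 𝟙 _ := by
  ext n x
  exact Prod.ext (add_zero (show p.carrier n × q.carrier n from x).1)
    (zero_add (show p.carrier n × q.carrier n from x).2)

/-- The intersection. -/
def inf : DSub d := ⟨fun n => p.carrier n ⊓ q.carrier n,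
  fun n x hx => ⟨p.map_d n x hx.1, q.map_d n x hx.2⟩⟩

/-- The sum. -/
def sup : DSub d := ⟨fun n => p.carrier n ⊔ q.carrier n,
  fun n _ hx => SingularChain.map_mem_sup (p.map_d n) (q.map_d n) hx⟩

/-- The anti-diagonal embedding of the intersection. -/
def mvLeft : (inf p q).cx hd ⟶ prodCx hd p q :=
  linCxMap _ _ (fun n => (Submodule.inclusion (inf_le_left : _ ≤ p.carrier n)).prod
    (-Submodule.inclusion (inf_le_right : _ ≤ q.carrier n)))
    (fun n x => Prod.ext rfl (Subtype.ext (map_neg (d n) x.1)))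

/-- The sum map. -/
def mvRight : prodCx hd p q ⟶ (sup p q).cx hd :=
  linCxMap _ _ (fun n => (Submodule.inclusion (le_sup_left : p.carrier n ≤ _)).coprod
    (Submodule.inclusion (le_sup_right : q.carrier n ≤ _)))
    (fun n x => Subtype.ext (map_add (d n) x.1.1 x.2.1))

/-- The Mayer–Vietoris short complex. -/
def mv : ShortComplex (ChainComplex (ModuleCat.{u} ℚ) ℕ) :=
  ShortComplex.mk (mvLeft hd p q) (mvRight hd p q) (by
    ext n x
    exact Subtype.ext (add_neg_cancel (show (inf p q).carrier n from x).1))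

lemma mv_shortExact : (mv hd p q).ShortExact := by
  refine HomologicalComplex.shortExact_of_degreewise_shortExact _ fun n => ?_
  refine ModuleCat.shortComplex_shortExact _ ?_ ?_ ?_
  · rintro ⟨⟨a, ha⟩, ⟨b, hb⟩⟩
    constructor
    · intro h
      have h' : a + b = 0 := congrArg (Subtype.val (p := (· ∈ (sup p q).carrier n))) h
      refine ⟨⟨a, ha, ?_⟩, ?_⟩
      · rw [eq_neg_of_add_eq_zero_left h']
        exact neg_mem hb
      · refine Prod.ext rfl (Subtype.ext ?_)
        exact (eq_neg_of_add_eq_zero_right h').symm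
    · rintro ⟨x, hx⟩
      rw [← hx]
      exact Subtype.ext (add_neg_cancel (show (inf p q).carrier n from x).1)
  · intro x y hxy
    exact Subtype.ext (congrArg (fun z : p.carrier n × q.carrier n => z.1.1) hxy)
  · rintro ⟨x, hx⟩
    obtain ⟨a, ha, b, hb, rfl⟩ := Submodule.mem_sup.1 hx
    exact ⟨((⟨a, ha⟩, ⟨b, hb⟩) : p.carrier n × q.carrier n), rfl⟩

/-- The product of two inclusions. -/
def inclProd {p q p' q' : DSub d} (h : ∀ n, p.carrier n ≤ p'.carrier n)
    (h' : ∀ n, q.carrier n ≤ q'.carrier n) : prodCx hd p q ⟶ prodCx hd p' q' :=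
  linCxMap _ _
    (fun n => (Submodule.inclusion (h n)).prodMap (Submodule.inclusion (h' n))) (fun _ _ => rfl)

/-- Functoriality of the Mayer–Vietoris short complex. -/
def mvMap {p q p' q' : DSub d} (h : ∀ n, p.carrier n ≤ p'.carrier n)
    (h' : ∀ n, q.carrier n ≤ q'.carrier n) : mv hd p q ⟶ mv hd p' q' where
  τ₁ := incl hd _ _ fun n => inf_le_inf (h n) (h' n)
  τ₂ := inclProd hd h h'
  τ₃ := incl hd _ _ fun n => sup_le_sup (h n) (h' n)
  comm₁₂ := by
    ext n x
    rfl
  comm₂₃ := by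
    ext n x
    rfl

/-- The quotient complex. -/
def quotCx : ChainComplex (ModuleCat.{u} ℚ) ℕ :=
  linCx (M := fun n => q.carrier n ⧸ (p.carrier n).comap (q.carrier n).subtype)
    (fun n => Submodule.mapQ _ _ ((d n).restrict (q.map_d n)) fun x hx => p.map_d n x hx)
    (fun n x => by
      obtain ⟨x, rfl⟩ := Submodule.mkQ_surjective _ x
      refine (Submodule.Quotient.mk_eq_zero _).2 ?_
      change d n (d (n + 1) x) ∈ p.carrier n
      rw [hd]
      exact Submodule.zero_mem _)

/-- The quotient map. -/
def quotMap : q.cx hd ⟶ quotCx hd p q :=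
  linCxMap _ _ (fun _ => Submodule.mkQ _) (fun _ _ => rfl)

/-- The short complex of a subcomplex. -/
def quotSeq (h : ∀ n, p.carrier n ≤ q.carrier n) :
    ShortComplex (ChainComplex (ModuleCat.{u} ℚ) ℕ) :=
  ShortComplex.mk (incl hd p q h) (quotMap hd p q) (by
    ext n x
    exact (Submodule.Quotient.mk_eq_zero _).2 x.2)

lemma quotSeq_shortExact (h : ∀ n, p.carrier n ≤ q.carrier n) :
    (quotSeq hd p q h).ShortExact := by
  refine HomologicalComplex.shortExact_of_degreewise_shortExact _ fun n => ?_
  refine ModuleCat.shortComplex_shortExact _ ?_ ?_ ?_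
  · intro x
    constructor
    · intro hx
      have : x.1 ∈ p.carrier n := (Submodule.Quotient.mk_eq_zero
        ((p.carrier n).comap (q.carrier n).subtype)).1 hx
      exact ⟨(⟨x.1, this⟩ : p.carrier n), rfl⟩
    · rintro ⟨y, rfl⟩
      exact (Submodule.Quotient.mk_eq_zero _).2 y.2
  · exact Submodule.inclusion_injective (h n)
  · exact Submodule.mkQ_surjective _

lemma quotCx_d (n : ℕ) : (quotCx hd p q).d (n + 1) n = ModuleCat.ofHom
    (Submodule.mapQ ((p.carrier (n + 1)).comap (q.carrier (n + 1)).subtype)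
      ((p.carrier n).comap (q.carrier n).subtype)
      ((d n).restrict (q.map_d n)) fun x hx => p.map_d n x hx) :=
  linCx_d _ n

/-- The two hypotheses say that every cycle relative to `p` is a relative boundary; degree zero is
separate because there the cycle condition is empty. -/
lemma quotCx_exactAt
    (h0 : ∀ c ∈ q.carrier 0, ∃ b ∈ q.carrier 1, c - d 0 b ∈ p.carrier 0)
    (hs : ∀ n, ∀ c ∈ q.carrier (n + 1), d n c ∈ p.carrier n →
      ∃ b ∈ q.carrier (n + 2), c - d (n + 1) b ∈ p.carrier (n + 1)) (n : ℕ) :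
    (quotCx hd p q).ExactAt n := by
  cases n with
  | zero =>
    rw [HomologicalComplex.exactAt_iff' _ 1 0 0 (by simp) (by simp),
      ShortComplex.moduleCat_exact_iff]
    intro x _
    obtain ⟨c, rfl⟩ := Submodule.mkQ_surjective _ x
    obtain ⟨b, hb, hcb⟩ := h0 c.1 c.2
    refine ⟨Submodule.Quotient.mk (⟨b, hb⟩ : q.carrier 1), ?_⟩
    change (quotCx hd p q).d 1 0 _ = _
    rw [quotCx_d]
    refine ((Submodule.Quotient.eq _).2 ?_).symm
    exact hcb
  | succ n =>
    rw [HomologicalComplex.exactAt_iff' _ (n + 2) (n + 1) n (by simp) (by simp),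
      ShortComplex.moduleCat_exact_iff]
    intro x hx
    obtain ⟨c, rfl⟩ := Submodule.mkQ_surjective _ x
    have hx' : (quotCx hd p q).d (n + 1) n (Submodule.Quotient.mk c) = 0 := hx
    rw [quotCx_d] at hx'
    obtain ⟨b, hb, hcb⟩ := hs n c.1 c.2 ((Submodule.Quotient.mk_eq_zero
      ((p.carrier n).comap (q.carrier n).subtype)).1 hx')
    refine ⟨Submodule.Quotient.mk (⟨b, hb⟩ : q.carrier (n + 2)), ?_⟩
    change (quotCx hd p q).d (n + 2) (n + 1) _ = _
    rw [quotCx_d]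
    refine ((Submodule.Quotient.eq _).2 ?_).symm
    exact hcb

/-- The quotient complex is acyclic, so the long exact sequence places the map between zero groups.
The application is to small chains inside all chains. -/
lemma isIso_homologyMap_incl (h : ∀ n, p.carrier n ≤ q.carrier n)
    (h0 : ∀ c ∈ q.carrier 0, ∃ b ∈ q.carrier 1, c - d 0 b ∈ p.carrier 0)
    (hs : ∀ n, ∀ c ∈ q.carrier (n + 1), d n c ∈ p.carrier n →
      ∃ b ∈ q.carrier (n + 2), c - d (n + 1) b ∈ p.carrier (n + 1)) (n : ℕ) :
    IsIso (HomologicalComplex.homologyMap (incl hd p q h) n) := by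
  have hz := fun n => (quotCx_exactAt hd p q h0 hs n).isZero_homology
  have hS := quotSeq_shortExact hd p q h
  have : Mono (HomologicalComplex.homologyMap (incl hd p q h) n) :=
    (hS.homology_exact₁ (n + 1) n rfl).mono_g ((hz (n + 1)).eq_of_src _ _)
  have : Epi (HomologicalComplex.homologyMap (incl hd p q h) n) :=
    (hS.homology_exact₂ n).epi_f ((hz n).eq_of_tgt _ _)
  exact isIso_of_mono_of_epi _

end DSub

end

section

/-! ### Finite homology and Euler characteristics of chain complexes -/

open CategoryTheory Limits

/-- The total homology is finite dimensional. -/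
def FinHomology (K : ChainComplex (ModuleCat.{u} ℚ) ℕ) : Prop :=
  (∀ n, Module.Finite ℚ (K.homology n)) ∧ ∃ N : ℕ, ∀ n, N < n → Subsingleton (K.homology n)

namespace FinHomology

variable {K L : ChainComplex (ModuleCat.{u} ℚ) ℕ}

lemma of_iso (e : ∀ n, K.homology n ≅ L.homology n) (hK : FinHomology K) : FinHomology L := by
  obtain ⟨h1, N, hN⟩ := hK
  refine ⟨fun n => ?_, N, fun n hn => ?_⟩
  · have := h1 n
    exact Module.Finite.equiv (e n).toLinearEquiv
  · have := hN n hn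
    exact (e n).toLinearEquiv.symm.toEquiv.subsingleton

lemma eulerChar_congr (e : ∀ n, K.homology n ≅ L.homology n) :
    K.homologyEulerChar = L.homologyEulerChar := by
  unfold HomologicalComplex.homologyEulerChar GradedObject.eulerChar
  refine finsum_congr fun n => ?_
  rw [(e n).toLinearEquiv.finrank_eq]

lemma of_retract (i : K ⟶ L) (r : L ⟶ K) (h : i ≫ r = 𝟙 K) (hL : FinHomology L) :
    FinHomology K := by
  have hinj : ∀ n, Function.Injective (HomologicalComplex.homologyMap i n) := fun n x y hxy => by
    have h2 : HomologicalComplex.homologyMap i n ≫ HomologicalComplex.homologyMap r n = 𝟙 _ := by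
      rw [← HomologicalComplex.homologyMap_comp, h, HomologicalComplex.homologyMap_id]
    have h3 : ∀ z, HomologicalComplex.homologyMap r n (HomologicalComplex.homologyMap i n z) = z :=
      fun z => by rw [← ConcreteCategory.comp_apply, h2]; rfl
    rw [← h3 x, hxy, h3]
  obtain ⟨h1, N, hN⟩ := hL
  refine ⟨fun n => ?_, N, fun n hn => ?_⟩
  · have := h1 n
    exact Module.Finite.of_injective (HomologicalComplex.homologyMap i n).hom (hinj n)
  · have := hN n hn
    exact (hinj n).subsingleton

end FinHomology

lemma Module.Finite.of_exact_field {A B C : Type*} [AddCommGroup A] [AddCommGroup B]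
    [AddCommGroup C] [Module ℚ A] [Module ℚ B] [Module ℚ C] [Module.Finite ℚ A]
    [Module.Finite ℚ C] (f : A →ₗ[ℚ] B) (g : B →ₗ[ℚ] C)
    (h : LinearMap.ker g ≤ LinearMap.range f) : Module.Finite ℚ B := by
  have h1 : (LinearMap.ker g).FG := by
    have : Module.Finite ℚ (LinearMap.ker g) :=
      Submodule.finiteDimensional_of_le h
    exact Module.Finite.iff_fg.1 this
  have h2 : ((⊤ : Submodule ℚ B).map g).FG := by
    rw [← Module.Finite.iff_fg]
    infer_instance
  refine ⟨Submodule.fg_of_fg_map_of_fg_inf_ker g h2 ?_⟩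
  rwa [top_inf_eq]

lemma subsingleton_of_exact {A B C : Type*} [AddCommGroup A] [AddCommGroup B]
    [AddCommGroup C] [Module ℚ A] [Module ℚ B] [Module ℚ C] [Subsingleton A]
    [Subsingleton C] (f : A →ₗ[ℚ] B) (g : B →ₗ[ℚ] C)
    (h : LinearMap.ker g ≤ LinearMap.range f) : Subsingleton B := by
  refine subsingleton_of_forall_eq 0 fun b => ?_
  obtain ⟨a, rfl⟩ := h (show g b = 0 from Subsingleton.elim _ _)
  rw [Subsingleton.elim a 0, map_zero]

section ShortExact

variable {S : ShortComplex (ChainComplex (ModuleCat.{u} ℚ) ℕ)} (hS : S.ShortExact)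

include hS

/-- The long exact sequence ends here. This replaces the connecting map in the degree zero cases
below. -/
lemma homologyMap_g_zero_surjective :
    Function.Surjective (HomologicalComplex.homologyMap S.g 0) := by
  have := hS.epi_g
  have h := HomologicalComplex.epi_homologyMap_of_epi_of_not_rel S.g 0 (fun j => by simp)
  exact (ModuleCat.epi_iff_surjective _).1 h

lemma finHomology_X₂ (h₁ : FinHomology S.X₁) (h₃ : FinHomology S.X₃) : FinHomology S.X₂ := by
  obtain ⟨h1, N, hN⟩ := h₁
  obtain ⟨h3, N', hN'⟩ := h₃
  refine ⟨fun n => ?_, max N N', fun n hn => ?_⟩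
  · have := h1 n
    have := h3 n
    exact Module.Finite.of_exact_field _ _ (hS.homology_exact₂ n).moduleCat_range_eq_ker.ge
  · have := hN n (lt_of_le_of_lt (le_max_left _ _) hn)
    have := hN' n (lt_of_le_of_lt (le_max_right _ _) hn)
    exact subsingleton_of_exact _ _ (hS.homology_exact₂ n).moduleCat_range_eq_ker.ge

lemma finHomology_X₃ (h₁ : FinHomology S.X₁) (h₂ : FinHomology S.X₂) : FinHomology S.X₃ := by
  obtain ⟨h1, N, hN⟩ := h₁
  obtain ⟨h2, N', hN'⟩ := h₂
  refine ⟨fun n => ?_, max (N + 1) N', fun n hn => ?_⟩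
  · have := h2 n
    cases n with
    | zero => exact Module.Finite.of_surjective _ (homologyMap_g_zero_surjective hS)
    | succ n =>
      have := h1 n
      exact Module.Finite.of_exact_field _ _
        (hS.homology_exact₃ (n + 1) n rfl).moduleCat_range_eq_ker.ge
  · have := hN' n (lt_of_le_of_lt (le_max_right _ _) hn)
    have hn1 := lt_of_le_of_lt (le_max_left _ _) hn
    obtain ⟨m, rfl⟩ : ∃ m, n = m + 1 := ⟨n - 1, by omega⟩
    have := hN m (by omega)
    exact subsingleton_of_exact _ _ (hS.homology_exact₃ (m + 1) m rfl).moduleCat_range_eq_ker.ge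

omit hS in
lemma homologyEulerChar_eq_sum {K : ChainComplex (ModuleCat.{u} ℚ) ℕ} {N : ℕ}
    (h : ∀ n, N < n → Subsingleton (K.homology n)) :
    K.homologyEulerChar =
      ∑ n ∈ Finset.range (N + 1), (-1 : ℤ) ^ n * Module.finrank ℚ (K.homology n) := by
  rw [HomologicalComplex.homologyEulerChar_eq_sum_finSet_of_finrankSupport_subset K
    (Finset.range (N + 1))]
  · refine Finset.sum_congr rfl fun n _ => ?_
    simp
  · intro n hn
    by_contra hn'
    have := h n (by simpa using hn')
    exact hn (by simp [Module.finrank_zero_of_subsingleton])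

/-- Each dimension in the long exact sequence is the sum of the ranks of the incoming and outgoing
maps, so the alternating sum telescopes. -/
lemma homologyEulerChar_X₂ (h₁ : FinHomology S.X₁) (h₃ : FinHomology S.X₃) :
    S.X₂.homologyEulerChar = S.X₁.homologyEulerChar + S.X₃.homologyEulerChar := by
  have h₂ := finHomology_X₂ hS h₁ h₃
  obtain ⟨h1, N₁, hN₁⟩ := h₁
  obtain ⟨h2, N₂, hN₂⟩ := h₂
  obtain ⟨h3, N₃, hN₃⟩ := h₃
  set N := N₁ + N₂ + N₃ with hN
  rw [homologyEulerChar_eq_sum (N := N) fun n hn => hN₁ n (by omega),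
    homologyEulerChar_eq_sum (N := N) fun n hn => hN₂ n (by omega),
    homologyEulerChar_eq_sum (N := N) fun n hn => hN₃ n (by omega)]
  let r : ℕ → ℤ := fun n => Module.finrank ℚ (LinearMap.range (hS.δ (n + 1) n rfl).hom)
  have hf : ∀ n, (Module.finrank ℚ (S.X₁.homology n) : ℤ) = r n +
      Module.finrank ℚ (LinearMap.range (HomologicalComplex.homologyMap S.f n).hom) := by
    intro n
    have := h1 n
    have e := (hS.homology_exact₁ (n + 1) n rfl).moduleCat_range_eq_ker
    have := LinearMap.finrank_range_add_finrank_ker (HomologicalComplex.homologyMap S.f n).hom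
    dsimp only at e
    rw [← e] at this
    simp only [r]
    rw [← this]
    push_cast
    ring
  have hg : ∀ n, (Module.finrank ℚ (S.X₂.homology n) : ℤ) =
      Module.finrank ℚ (LinearMap.range (HomologicalComplex.homologyMap S.f n).hom) +
      Module.finrank ℚ (LinearMap.range (HomologicalComplex.homologyMap S.g n).hom) := by
    intro n
    have := h2 n
    have e := (hS.homology_exact₂ n).moduleCat_range_eq_ker
    have := LinearMap.finrank_range_add_finrank_ker (HomologicalComplex.homologyMap S.g n).hom
    dsimp only at e
    rw [← e] at this
    rw [← this]
    push_cast
    ring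
  have h0 : (Module.finrank ℚ (S.X₃.homology 0) : ℤ) =
      Module.finrank ℚ (LinearMap.range (HomologicalComplex.homologyMap S.g 0).hom) := by
    rw [LinearMap.range_eq_top.2 (homologyMap_g_zero_surjective hS), finrank_top]
  have hδ : ∀ n, (Module.finrank ℚ (S.X₃.homology (n + 1)) : ℤ) = r n +
      Module.finrank ℚ (LinearMap.range (HomologicalComplex.homologyMap S.g (n + 1)).hom) := by
    intro n
    have := h3 (n + 1)
    have e := (hS.homology_exact₃ (n + 1) n rfl).moduleCat_range_eq_ker
    have := LinearMap.finrank_range_add_finrank_ker (hS.δ (n + 1) n rfl).hom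
    dsimp only at e
    rw [← e] at this
    simp only [r]
    rw [← this]
    push_cast
    ring
  -- Truncating at degree `m` leaves one uncancelled rank, that of the connecting map from degree `m
  -- + 1` to degree `m`; it vanishes at `m = N`.
  have key : ∀ m, ∑ n ∈ Finset.range (m + 1), (-1 : ℤ) ^ n * Module.finrank ℚ (S.X₁.homology n) +
      ∑ n ∈ Finset.range (m + 1), (-1 : ℤ) ^ n * Module.finrank ℚ (S.X₃.homology n) =
      ∑ n ∈ Finset.range (m + 1), (-1 : ℤ) ^ n * Module.finrank ℚ (S.X₂.homology n) +
        (-1) ^ m * r m := by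
    intro m
    induction m with
    | zero =>
      simp only [zero_add, Finset.range_one, Finset.sum_singleton, pow_zero, one_mul]
      rw [hf, hg, h0]
      ring
    | succ m ih =>
      rw [Finset.sum_range_succ, Finset.sum_range_succ _ (m + 1), Finset.sum_range_succ _ (m + 1)]
      rw [hf (m + 1), hg (m + 1), hδ m]
      rw [pow_succ]
      linear_combination ih
  have hr : r N = 0 := by
    have := hN₃ (N + 1) (by omega)
    have : LinearMap.range (hS.δ (N + 1) N rfl).hom = ⊥ := by
      rw [LinearMap.range_eq_bot]
      ext x
      rw [Subsingleton.elim x 0, map_zero, map_zero]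
    change (Module.finrank ℚ (LinearMap.range (hS.δ (N + 1) N rfl).hom) : ℤ) = 0
    rw [this, finrank_bot, Nat.cast_zero]
  rw [key N, hr]
  ring

end ShortExact

namespace DSub

variable {M : ℕ → Type u} [∀ n, AddCommGroup (M n)] [∀ n, Module ℚ (M n)]
  {d : ∀ n, M (n + 1) →ₗ[ℚ] M n} (hd : ∀ n x, d n (d (n + 1) x) = 0) (p q : DSub d)

/-- The homology of a product complex. -/
def homologyProdEquiv (n : ℕ) :
    (prodCx hd p q).homology n ≃ₗ[ℚ] (p.cx hd).homology n × (q.cx hd).homology n :=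
  LinearEquiv.ofLinearMap
    ((HomologicalComplex.homologyMap (fstCx hd p q) n).hom.prod
      (HomologicalComplex.homologyMap (sndCx hd p q) n).hom)
    ((HomologicalComplex.homologyMap (inlCx hd p q) n).hom.coprod
      (HomologicalComplex.homologyMap (inrCx hd p q) n).hom)
    (by
      have h1 := congrArg (HomologicalComplex.homologyMap · n) (inl_fst hd p q)
      have h2 := congrArg (HomologicalComplex.homologyMap · n) (inl_snd hd p q)
      have h3 := congrArg (HomologicalComplex.homologyMap · n) (inr_fst hd p q)
      have h4 := congrArg (HomologicalComplex.homologyMap · n) (inr_snd hd p q)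
      simp only [HomologicalComplex.homologyMap_comp, HomologicalComplex.homologyMap_id,
        HomologicalComplex.homologyMap_zero] at h1 h2 h3 h4
      ext x
      · simpa using ConcreteCategory.congr_hom h1 x
      · simpa using ConcreteCategory.congr_hom h2 x
      · simpa using ConcreteCategory.congr_hom h3 x
      · simpa using ConcreteCategory.congr_hom h4 x)
    (by
      have h1 := congrArg (HomologicalComplex.homologyMap · n) (fst_inl_add_snd_inr hd p q)
      simp only [HomologicalComplex.homologyMap_comp, HomologicalComplex.homologyMap_id,
        HomologicalComplex.homologyMap_add] at h1
      ext x
      exact ConcreteCategory.congr_hom h1 x)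

lemma finHomology_prodCx (hp : FinHomology (p.cx hd)) (hq : FinHomology (q.cx hd)) :
    FinHomology (prodCx hd p q) := by
  obtain ⟨h1, N, hN⟩ := hp
  obtain ⟨h2, N', hN'⟩ := hq
  refine ⟨fun n => ?_, max N N', fun n hn => ?_⟩
  · have := h1 n
    have := h2 n
    exact Module.Finite.equiv (homologyProdEquiv hd p q n).symm
  · have := hN n (lt_of_le_of_lt (le_max_left _ _) hn)
    have := hN' n (lt_of_le_of_lt (le_max_right _ _) hn)
    exact (homologyProdEquiv hd p q n).toEquiv.subsingleton

lemma finHomology_right (h : FinHomology (prodCx hd p q)) : FinHomology (q.cx hd) :=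
  FinHomology.of_retract _ _ (inr_snd hd p q) h

lemma homologyEulerChar_prodCx (hp : FinHomology (p.cx hd)) (hq : FinHomology (q.cx hd)) :
    (prodCx hd p q).homologyEulerChar =
      (p.cx hd).homologyEulerChar + (q.cx hd).homologyEulerChar := by
  obtain ⟨h3, N₃, hN₃⟩ := finHomology_prodCx hd p q hp hq
  obtain ⟨h1, N₁, hN₁⟩ := hp
  obtain ⟨h2, N₂, hN₂⟩ := hq
  set N := N₁ + N₂ + N₃ with hN
  rw [homologyEulerChar_eq_sum (N := N) fun n hn => hN₁ n (by omega),
    homologyEulerChar_eq_sum (N := N) fun n hn => hN₂ n (by omega),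
    homologyEulerChar_eq_sum (N := N) fun n hn => hN₃ n (by omega), ← Finset.sum_add_distrib]
  refine Finset.sum_congr rfl fun n _ => ?_
  have := h1 n
  have := h2 n
  rw [(homologyProdEquiv hd p q n).finrank_eq, Module.finrank_prod]
  push_cast
  ring

end DSub

end

section

/-! ### Comparison with the singular chain complex -/

open CategoryTheory Limits

namespace SingularChain

open AffineChain

section Comparison

open scoped Simplicial

variable (Y : Type u) [TopologicalSpace Y]

/-- The coefficients. -/
abbrev coeff : ModuleCat.{u} ℚ := ModuleCat.of ℚ (ULift.{u} ℚ)

/-- The singular simplicial set. -/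
abbrev sing : SSet.{u} := TopCat.toSSet.obj (TopCat.of Y)

/-- Singular simplices as continuous maps. -/
def simplexEquiv (n : ℕ) : (sing Y) _⦋n⦌ ≃ C(Simp n, Y) :=
  TopCat.toSSetObjEquiv (TopCat.of Y) (Opposite.op ⦋n⦌)

lemma simplexEquiv_δ (n : ℕ) (i : Fin (n + 2)) (x : (sing Y) _⦋n + 1⦌) :
    simplexEquiv Y n ((sing Y).δ i x) = (simplexEquiv Y (n + 1) x).comp (face n i) := by
  rfl

/-- From the coproduct to finitely supported functions. -/
def toChain (n : ℕ) : ((sing Y).chainComplex coeff.{u}).X n ⟶ ModuleCat.of ℚ (Chain Y n) :=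
  ((sing Y).isColimitChainComplexXCofan coeff n).desc (Cofan.mk _ fun x =>
    ModuleCat.ofHom ((Finsupp.lsingle (simplexEquiv Y n x)) ∘ₗ ULift.moduleEquiv.toLinearMap))

lemma ι_toChain (n : ℕ) (x : (sing Y) _⦋n⦌) :
    (sing Y).ιChainComplex x ≫ toChain Y n =
      ModuleCat.ofHom ((Finsupp.lsingle (simplexEquiv Y n x)) ∘ₗ ULift.moduleEquiv.toLinearMap) :=
  ((sing Y).isColimitChainComplexXCofan coeff n).fac _ ⟨x⟩

/-- From finitely supported functions to the coproduct. -/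
def ofChain (n : ℕ) : ModuleCat.of ℚ (Chain Y n) ⟶ ((sing Y).chainComplex coeff.{u}).X n :=
  ModuleCat.ofHom (Finsupp.linearCombination ℚ fun σ =>
    (sing Y).ιChainComplex (R := coeff) ((simplexEquiv Y n).symm σ) (ULift.up 1))

/-- The comparison isomorphism in each degree. -/
def chainIso (n : ℕ) : ((sing Y).chainComplex coeff.{u}).X n ≅ ModuleCat.of ℚ (Chain Y n) where
  hom := toChain Y n
  inv := ofChain Y n
  hom_inv_id := by
    refine SSet.chainComplex_hom_ext fun x => ?_
    rw [← Category.assoc, ι_toChain, Category.comp_id]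
    ext r
    obtain ⟨r⟩ := r
    change (Finsupp.linearCombination ℚ _) (Finsupp.single (simplexEquiv Y n x) r) = _
    refine (Finsupp.linearCombination_single ℚ _ _).trans ?_
    rw [Equiv.symm_apply_apply]
    refine (map_smul ((sing Y).ιChainComplex (R := coeff) x).hom r (ULift.up 1)).symm.trans ?_
    congr 1
    exact ULift.ext _ _ (mul_one r)
  inv_hom_id := by
    refine ModuleCat.hom_ext (linearMap_ext_single fun σ => ?_)
    change toChain Y n (Finsupp.linearCombination ℚ _ (Finsupp.single σ 1)) = _
    rw [Finsupp.linearCombination_single, one_smul]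
    have := ConcreteCategory.congr_hom (ι_toChain Y n ((simplexEquiv Y n).symm σ)) (ULift.up 1)
    refine this.trans ?_
    change Finsupp.single _ (1 : ℚ) = _
    rw [Equiv.apply_symm_apply]
    rfl

lemma toChain_comm (n : ℕ) : toChain Y (n + 1) ≫ ModuleCat.ofHom (bd Y n) =
    ((sing Y).chainComplex coeff.{u}).d (n + 1) n ≫ toChain Y n := by
  refine SSet.chainComplex_hom_ext fun x => ?_
  rw [← Category.assoc, ι_toChain, ← Category.assoc, SSet.ιChainComplex_d, Preadditive.sum_comp]
  simp only [Preadditive.zsmul_comp, ι_toChain, simplexEquiv_δ]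
  refine ModuleCat.hom_ext (LinearMap.ext fun r => ?_)
  obtain ⟨r⟩ := r
  have h1 : Finsupp.single (simplexEquiv Y (n + 1) x) r =
      r • Finsupp.single (simplexEquiv Y (n + 1) x) (1 : ℚ) := by simp
  change bd Y n (Finsupp.single (simplexEquiv Y (n + 1) x) r) = _
  rw [h1, map_smul, bd_single, Finset.smul_sum, ModuleCat.hom_sum, LinearMap.sum_apply]
  refine Finset.sum_congr rfl fun i _ => ?_
  rw [ModuleCat.hom_zsmul, LinearMap.smul_apply]
  change _ = (-1 : ℤ) ^ (i : ℕ) • Finsupp.single _ r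
  rw [← Int.cast_smul_eq_zsmul ℚ]
  simp [mul_comm]

/-- The singular chain complex, concretely. -/
def singularIso : SurfaceFibration.singularChains Y ≅ linCx (bd Y) bd_bd :=
  HomologicalComplex.Hom.isoOfComponents (chainIso Y) (by
    rintro i j hij
    obtain rfl : j + 1 = i := hij
    rw [linCx_d]
    exact toChain_comm Y j)

end Comparison

variable {Y : Type u} [TopologicalSpace Y]

/-- The subcomplex of chains in a subset. -/
def inSub (U : Set Y) : DSub (bd Y) := ⟨chainsIn U, fun _ _ h => bd_mem_chainsIn h⟩

/-- Simplices in a subset. -/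
def simplexInEquiv (U : Set Y) (n : ℕ) : C(Simp n, U) ≃ {σ : C(Simp n, Y) | ∀ x, σ x ∈ U} where
  toFun σ := ⟨⟨fun x => σ x, continuous_subtype_val.comp σ.continuous⟩, fun x => (σ x).2⟩
  invFun σ := ⟨fun x => ⟨σ.1 x, σ.2 x⟩, σ.1.continuous.subtype_mk _⟩
  left_inv _ := rfl
  right_inv _ := rfl

/-- Chains on a subspace are chains in the subset. -/
def chainInEquiv (U : Set Y) (n : ℕ) : Chain U n ≃ₗ[ℚ] chainsIn U n :=
  (Finsupp.domLCongr (simplexInEquiv U n)).trans (Finsupp.supportedEquivFinsupp _).symm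

lemma chainInEquiv_single (U : Set Y) (n : ℕ) (σ : C(Simp n, U)) :
    (chainInEquiv U n (Finsupp.single σ 1) : Chain Y n) =
      Finsupp.single (simplexInEquiv U n σ).1 1 := by
  change (((Finsupp.supportedEquivFinsupp {σ : C(Simp n, Y) | ∀ x, σ x ∈ U}).symm
    (Finsupp.domLCongr (simplexInEquiv U n) (Finsupp.single σ (1 : ℚ))) :
      Finsupp.supported ℚ ℚ {σ : C(Simp n, Y) | ∀ x, σ x ∈ U}) : Chain Y n) = _
  rw [Finsupp.domLCongr_single]
  exact Finsupp.supportedEquivFinsupp_symm_single _ _ _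

lemma bd_chainInEquiv (U : Set Y) (n : ℕ) (c : Chain U (n + 1)) :
    bd Y n (chainInEquiv U (n + 1) c) = chainInEquiv U n (bd U n c) := by
  have : bd Y n ∘ₗ (chainsIn U (n + 1)).subtype ∘ₗ (chainInEquiv U (n + 1)).toLinearMap =
      (chainsIn U n).subtype ∘ₗ (chainInEquiv U n).toLinearMap ∘ₗ bd U n := by
    refine linearMap_ext_single fun σ => ?_
    simp only [LinearMap.comp_apply, LinearEquiv.coe_coe, Submodule.subtype_apply,
      chainInEquiv_single, bd_single, map_sum, map_smul]
    rfl
  exact LinearMap.congr_fun this c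

/-- The singular chain complex of a subspace is the complex of chains in the subset. -/
def subspaceIso (U : Set Y) : linCx (bd U) bd_bd ≅ (inSub U).cx bd_bd :=
  HomologicalComplex.Hom.isoOfComponents (fun n => (chainInEquiv U n).toModuleIso) (by
    rintro i j hij
    obtain rfl : j + 1 = i := hij
    rw [linCx_d, DSub.cx_d]
    ext x
    exact Subtype.ext (bd_chainInEquiv U j x))

/-- The homology of a subspace. -/
def homologyIso (U : Set Y) (n : ℕ) :
    (SurfaceFibration.singularChains U).homology n ≅ ((inSub U).cx bd_bd).homology n :=
  (HomologicalComplex.homologyFunctor _ _ n).mapIso (singularIso U ≪≫ subspaceIso U)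

end SingularChain

end

section

/-! ### Topological properties of the Euler number -/

open CategoryTheory Limits SurfaceFibration AlgebraicTopology

namespace SurfaceFibration

variable {Y Z : Type u} [TopologicalSpace Y] [TopologicalSpace Z]

/-- The map on singular chains. -/
def chainsMap (f : C(Y, Z)) : singularChains Y ⟶ singularChains Z :=
  ((singularChainComplexFunctor (ModuleCat.{u} ℚ)).obj (ModuleCat.of ℚ (ULift.{u} ℚ))).map
    (TopCat.ofHom f)

lemma homologyMap_chainsMap_comp {W : Type u} [TopologicalSpace W] (g : C(Z, W)) (f : C(Y, Z))
    (n : ℕ) : HomologicalComplex.homologyMap (chainsMap (g.comp f)) n =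
      HomologicalComplex.homologyMap (chainsMap f) n ≫
        HomologicalComplex.homologyMap (chainsMap g) n := by
  rw [← HomologicalComplex.homologyMap_comp]
  congr 1
  exact Functor.map_comp _ _ _

lemma homologyMap_chainsMap_id (n : ℕ) :
    HomologicalComplex.homologyMap (chainsMap (ContinuousMap.id Y)) n = 𝟙 _ := by
  rw [← HomologicalComplex.homologyMap_id]
  congr 1
  exact CategoryTheory.Functor.map_id _ _

lemma homologyMap_chainsMap_congr {f g : C(Y, Z)} (h : f.Homotopic g) (n : ℕ) :
    HomologicalComplex.homologyMap (chainsMap f) n =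
      HomologicalComplex.homologyMap (chainsMap g) n :=
  TopCat.Homotopy.congr_homologyMap_singularChainComplexFunctor
    (f := TopCat.ofHom f) (g := TopCat.ofHom g) h.some _ n

/-- Homotopy equivalent spaces have isomorphic homology. -/
def homologyIsoOfHomotopyEquiv (e : ContinuousMap.HomotopyEquiv Y Z) (n : ℕ) :
    (singularChains Y).homology n ≅ (singularChains Z).homology n where
  hom := HomologicalComplex.homologyMap (chainsMap e.toFun) n
  inv := HomologicalComplex.homologyMap (chainsMap e.invFun) n
  hom_inv_id := by
    rw [← homologyMap_chainsMap_comp, homologyMap_chainsMap_congr e.left_inv,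
      homologyMap_chainsMap_id]
  inv_hom_id := by
    rw [← homologyMap_chainsMap_comp, homologyMap_chainsMap_congr e.right_inv,
      homologyMap_chainsMap_id]

lemma HasFiniteHomology.of_homotopyEquiv (e : ContinuousMap.HomotopyEquiv Y Z)
    (h : HasFiniteHomology Y) : HasFiniteHomology Z :=
  FinHomology.of_iso (homologyIsoOfHomotopyEquiv e) h

lemma HasFiniteHomology.of_homeomorph (e : Y ≃ₜ Z) (h : HasFiniteHomology Y) :
    HasFiniteHomology Z :=
  h.of_homotopyEquiv e.toHomotopyEquiv

lemma eulerNumber_congr (e : ContinuousMap.HomotopyEquiv Y Z) : eulerNumber Y = eulerNumber Z :=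
  FinHomology.eulerChar_congr (homologyIsoOfHomotopyEquiv e)

lemma eulerNumber_congr_homeomorph (e : Y ≃ₜ Z) : eulerNumber Y = eulerNumber Z :=
  eulerNumber_congr e.toHomotopyEquiv

lemma subsingleton_homology_punit (n : ℕ) (hn : n ≠ 0) :
    Subsingleton ((singularChains PUnit.{u + 1}).homology n) :=
  ModuleCat.subsingleton_of_isZero (isZero_singularHomologyFunctor_of_totallyDisconnectedSpace
    (ModuleCat.{u} ℚ) n (ModuleCat.of ℚ (ULift.{u} ℚ)) (TopCat.of PUnit.{u + 1}) hn)

/-- The zeroth homology of a point. -/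
def homologyZeroPUnit : (singularChains PUnit.{u + 1}).homology 0 ≃ₗ[ℚ] ULift.{u} ℚ :=
  (asIso ((TopCat.of PUnit.{u + 1}).singularHomology₀ε (ModuleCat.of ℚ (ULift.{u} ℚ)))).toLinearEquiv

lemma hasFiniteHomology_punit : HasFiniteHomology PUnit.{u + 1} := by
  refine ⟨fun n => ?_, 0, fun n hn => subsingleton_homology_punit n hn.ne'⟩
  by_cases hn : n = 0
  · subst hn
    exact Module.Finite.equiv homologyZeroPUnit.symm
  · have := subsingleton_homology_punit n hn
    change Module.Finite ℚ ((singularChains PUnit.{u + 1}).homology n)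
    infer_instance

lemma eulerNumber_punit : eulerNumber PUnit.{u + 1} = 1 := by
  rw [eulerNumber, homologyEulerChar_eq_sum (N := 0) fun n hn =>
    subsingleton_homology_punit n hn.ne']
  simp [homologyZeroPUnit.finrank_eq]

lemma hasFiniteHomology_of_contractible (Y : Type u) [TopologicalSpace Y] [ContractibleSpace Y] :
    HasFiniteHomology Y :=
  hasFiniteHomology_punit.of_homotopyEquiv (ContractibleSpace.hequiv PUnit.{u + 1} Y).some

lemma eulerNumber_of_contractible (Y : Type u) [TopologicalSpace Y] [ContractibleSpace Y] :
    eulerNumber Y = 1 :=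
  (eulerNumber_congr (ContractibleSpace.hequiv PUnit.{u + 1} Y).some).symm.trans eulerNumber_punit

lemma subsingleton_homology_of_isEmpty (Y : Type u) [TopologicalSpace Y] [IsEmpty Y] (n : ℕ) :
    Subsingleton ((singularChains Y).homology n) := by
  have : Subsingleton ((linCx (SingularChain.bd Y) SingularChain.bd_bd).homology n) := by
    have hC : Subsingleton (SingularChain.Chain Y n) := by
      have : IsEmpty C(SingularChain.Simp n, Y) :=
        ⟨fun σ => isEmptyElim (σ (Classical.arbitrary _))⟩
      infer_instance
    refine ModuleCat.subsingleton_of_isZero (HomologicalComplex.ExactAt.isZero_homology ?_)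
    rw [HomologicalComplex.exactAt_iff, ShortComplex.moduleCat_exact_iff]
    intro x _
    exact ⟨0, hC.elim _ _⟩
  have e : (singularChains Y).homology n ≅ _ := (HomologicalComplex.homologyFunctor _ _ n).mapIso
    (SingularChain.singularIso Y)
  exact @Equiv.subsingleton _ _ e.toLinearEquiv.toEquiv this

lemma hasFiniteHomology_of_isEmpty (Y : Type u) [TopologicalSpace Y] [IsEmpty Y] :
    HasFiniteHomology Y := by
  have h := subsingleton_homology_of_isEmpty Y
  exact ⟨fun n => by
    have := h n
    change Module.Finite ℚ ((singularChains Y).homology n)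
    infer_instance, 0, fun n _ => h n⟩

lemma eulerNumber_of_isEmpty (Y : Type u) [TopologicalSpace Y] [IsEmpty Y] :
    eulerNumber Y = 0 := by
  have h := subsingleton_homology_of_isEmpty Y
  rw [eulerNumber, homologyEulerChar_eq_sum (N := 0) fun n _ => h n]
  simp [Module.finrank_zero_of_subsingleton]

open SingularChain

lemma hasFiniteHomology_iff (U : Set Y) :
    HasFiniteHomology U ↔ FinHomology ((inSub U).cx bd_bd) :=
  ⟨FinHomology.of_iso (homologyIso U), FinHomology.of_iso fun n => (homologyIso U n).symm⟩

lemma eulerNumber_eq (U : Set Y) :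
    eulerNumber U = ((inSub U).cx bd_bd).homologyEulerChar :=
  FinHomology.eulerChar_congr (homologyIso U)

lemma inf_inSub (U V : Set Y) : (inSub U).inf (inSub V) = inSub (U ∩ V) := by
  unfold DSub.inf inSub
  congr 1
  funext n
  change chainsIn U n ⊓ chainsIn V n = chainsIn (U ∩ V) n
  rw [chainsIn, chainsIn, chainsIn, ← Finsupp.supported_inter]
  congr 1
  ext σ
  exact forall_and.symm

lemma inSub_mono {U V : Set Y} (h : U ⊆ V) (n : ℕ) : (inSub U).carrier n ≤ (inSub V).carrier n :=
  Finsupp.supported_mono fun _ hσ x => h (hσ x)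

section MayerVietoris

variable {P U V : Set Y} (hU : IsOpen U) (hV : IsOpen V) (hP : P ⊆ U ∪ V)

include hU hV hP

/-- Small chains compute the homology. -/
lemma isIso_homologyMap_small (n : ℕ) :
    IsIso (HomologicalComplex.homologyMap
      (DSub.incl bd_bd ((inSub (P ∩ U)).sup (inSub (P ∩ V))) (inSub P)
        (fun n => sup_le (inSub_mono Set.inter_subset_left n)
          (inSub_mono Set.inter_subset_left n))) n) :=
  DSub.isIso_homologyMap_incl _ _ _ _
    (fun _ hc => exists_sub_bd_mem_zero hU hV hP hc)
    (fun n _ hc hd => exists_sub_bd_mem hU hV hP n hc hd) n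

/-- Small chains compute the homology. -/
def smallIso (n : ℕ) : (((inSub (P ∩ U)).sup (inSub (P ∩ V))).cx bd_bd).homology n ≅
    ((inSub P).cx bd_bd).homology n :=
  have := isIso_homologyMap_small hU hV hP n
  asIso (HomologicalComplex.homologyMap
      (DSub.incl bd_bd ((inSub (P ∩ U)).sup (inSub (P ∩ V))) (inSub P)
        (fun n => sup_le (inSub_mono Set.inter_subset_left n)
          (inSub_mono Set.inter_subset_left n))) n)

/-- The sums of chains in the two pieces form the quotient term of a short exact sequence and
compute the homology of `P`. Only `U` and `V` have to be open, so `P` may be a fibre. -/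
theorem mayerVietoris_union (h1 : HasFiniteHomology ↥(P ∩ U)) (h2 : HasFiniteHomology ↥(P ∩ V))
    (h3 : HasFiniteHomology ↥((P ∩ U) ∩ (P ∩ V))) :
    HasFiniteHomology P ∧
      eulerNumber P + eulerNumber ↥((P ∩ U) ∩ (P ∩ V)) =
        eulerNumber ↥(P ∩ U) + eulerNumber ↥(P ∩ V) := by
  rw [hasFiniteHomology_iff] at *
  simp only [eulerNumber_eq]
  rw [← inf_inSub] at h3 ⊢
  have hS := DSub.mv_shortExact bd_bd (inSub (P ∩ U)) (inSub (P ∩ V))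
  have h12 := DSub.finHomology_prodCx bd_bd _ _ h1 h2
  have hs := finHomology_X₃ hS h3 h12
  refine ⟨hs.of_iso (smallIso hU hV hP), ?_⟩
  rw [← FinHomology.eulerChar_congr (smallIso hU hV hP),
    ← DSub.homologyEulerChar_prodCx bd_bd _ _ h1 h2]
  exact ((homologyEulerChar_X₂ hS h3 hs).trans (add_comm _ _)).symm

/-- Here the middle term of the sequence is bounded by its neighbours, and `P ∩ V` is a direct
summand of it. This gives finiteness for a piece that is not understood directly. -/
theorem mayerVietoris_right (h : HasFiniteHomology P)
    (h3 : HasFiniteHomology ↥((P ∩ U) ∩ (P ∩ V))) : HasFiniteHomology ↥(P ∩ V) := by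
  rw [hasFiniteHomology_iff] at *
  rw [← inf_inSub] at h3
  have hS := DSub.mv_shortExact bd_bd (inSub (P ∩ U)) (inSub (P ∩ V))
  exact DSub.finHomology_right bd_bd _ _
    (finHomology_X₂ hS h3 (h.of_iso fun n => (smallIso hU hV hP n).symm))

end MayerVietoris

end SurfaceFibration

end

section

/-! ### Finiteness of the homology of compact surfaces -/

open CategoryTheory Limits SurfaceFibration SingularChain

/-- Modulo `W` the map `g` factors through the quotient by the kernel of `b`, which is isomorphic to
the finite dimensional range of `b`. -/
lemma finite_range_of_finite_on_ker {M N P : Type*} [AddCommGroup M] [AddCommGroup N]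
    [AddCommGroup P] [Module ℚ M] [Module ℚ N] [Module ℚ P] (g : M →ₗ[ℚ] N) (b : M →ₗ[ℚ] P)
    (hb : Module.Finite ℚ (LinearMap.range b)) (W : Submodule ℚ N) (hW : Module.Finite ℚ W)
    (h : ∀ x, b x = 0 → g x ∈ W) : Module.Finite ℚ (LinearMap.range g) := by
  have h1 : Module.Finite ℚ (M ⧸ LinearMap.ker b) :=
    Module.Finite.equiv b.quotKerEquivRange.symm
  let g' : (M ⧸ LinearMap.ker b) →ₗ[ℚ] N ⧸ W := (LinearMap.ker b).liftQ (W.mkQ ∘ₗ g) (by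
    intro x hx
    simpa using h x hx)
  have h2 : (LinearMap.range g).map W.mkQ = LinearMap.range g' := by
    rw [← LinearMap.range_comp, Submodule.range_liftQ]
  rw [Module.Finite.iff_fg]
  refine Submodule.fg_of_fg_map_of_fg_inf_ker W.mkQ ?_ ?_
  · rw [h2, ← Module.Finite.iff_fg]
    infer_instance
  · rw [Submodule.ker_mkQ, ← Module.Finite.iff_fg]
    exact Submodule.finiteDimensional_of_le (inf_le_right : _ ≤ W)

namespace SurfaceFibration

variable {Y : Type u} [TopologicalSpace Y]

/-- The map induced on homology by an inclusion of subsets. -/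
def inclHomology {V U : Set Y} (h : V ⊆ U) (n : ℕ) :
    ((inSub V).cx bd_bd).homology n ⟶ ((inSub U).cx bd_bd).homology n :=
  HomologicalComplex.homologyMap (DSub.incl bd_bd _ _ (inSub_mono h)) n

lemma inclHomology_comp {W V U : Set Y} (h : W ⊆ V) (h' : V ⊆ U) (n : ℕ) :
    inclHomology h n ≫ inclHomology h' n = inclHomology (h.trans h') n := by
  rw [inclHomology, inclHomology, ← HomologicalComplex.homologyMap_comp, DSub.incl_comp]
  rfl

/-- The inclusion of `V` in `U` has finite rank on total homology. -/
def FiniteRank (V U : Set Y) : Prop :=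
  ∃ h : V ⊆ U, (∀ n, Module.Finite ℚ (LinearMap.range (inclHomology h n).hom)) ∧
    ∃ N : ℕ, ∀ n, N < n → inclHomology h n = 0

lemma FiniteRank.of_finite {V U : Set Y} (h : V ⊆ U) (hV : HasFiniteHomology V) :
    FiniteRank V U := by
  rw [hasFiniteHomology_iff] at hV
  obtain ⟨h1, N, hN⟩ := hV
  refine ⟨h, fun n => ?_, N, fun n hn => ?_⟩
  · have := h1 n
    infer_instance
  · have := hN n hn
    ext x
    rw [Subsingleton.elim x 0, map_zero, map_zero]

lemma FiniteRank.hasFiniteHomology {V : Set Y} (h : FiniteRank V V) : HasFiniteHomology V := by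
  rw [hasFiniteHomology_iff]
  obtain ⟨h, h1, N, hN⟩ := h
  have hid : ∀ n, inclHomology h n = 𝟙 _ := fun n =>
    HomologicalComplex.homologyMap_id ((inSub V).cx bd_bd) n
  refine ⟨fun n => ?_, N, fun n hn => ?_⟩
  · have h2 := h1 n
    rw [hid] at h2
    exact Module.Finite.of_surjective (LinearMap.range (𝟙 (((inSub V).cx bd_bd).homology n) :
      ((inSub V).cx bd_bd).homology n ⟶ _).hom).subtype fun x => ⟨⟨x, x, rfl⟩, rfl⟩
  · have := hN n hn
    rw [hid] at this
    exact ModuleCat.subsingleton_of_isZero ((IsZero.iff_id_eq_zero _).2 this)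

/-- Ladder of Mayer–Vietoris sequences: the connecting map followed by the inclusion into `A₂ ∩ B₂`
has finite rank. A class killed by it becomes, after enlarging to the sum of chains in `A₂` and in
`B₂`, a sum of a class from `A₂` and one from `B₂`, and these have images in `U` of finite rank. -/
lemma FiniteRank.union {A₁ A₂ B₁ B₂ U : Set Y} (hA₁ : IsOpen A₁) (hB₁ : IsOpen B₁)
    (hA : A₁ ⊆ A₂) (hB : B₁ ⊆ B₂) (hAU : FiniteRank A₂ U) (hBU : FiniteRank B₂ U)
    (hAB : FiniteRank (A₁ ∩ B₁) (A₂ ∩ B₂)) : FiniteRank (A₁ ∪ B₁) U := by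
  obtain ⟨hAU', hAf, NA, hNA⟩ := hAU
  obtain ⟨hBU', hBf, NB, hNB⟩ := hBU
  obtain ⟨hAB', hABf, NAB, hNAB⟩ := hAB
  have hPU : A₁ ∪ B₁ ⊆ U := Set.union_subset (hA.trans hAU') (hB.trans hBU')
  let S₁ := (inSub A₁).sup (inSub B₁)
  let S₂ := (inSub A₂).sup (inSub B₂)
  have h1P : ∀ n, S₁.carrier n ≤ (inSub (A₁ ∪ B₁)).carrier n := fun n =>
    sup_le (inSub_mono Set.subset_union_left n) (inSub_mono Set.subset_union_right n)
  have h12 : ∀ n, S₁.carrier n ≤ S₂.carrier n := fun n =>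
    sup_le_sup (inSub_mono hA n) (inSub_mono hB n)
  have h2U : ∀ n, S₂.carrier n ≤ (inSub U).carrier n := fun n =>
    sup_le (inSub_mono hAU' n) (inSub_mono hBU' n)
  have hsurj : ∀ n, Function.Surjective
      (HomologicalComplex.homologyMap (DSub.incl bd_bd S₁ (inSub (A₁ ∪ B₁)) h1P) n) := by
    intro n
    -- The theorem on small chains speaks of `(A₁ ∪ B₁) ∩ A₁` and `(A₁ ∪ B₁) ∩ B₁`; this general
    -- form allows substituting the equal sets `A₁` and `B₁` although the complexes depend on them.
    have key : ∀ A' B' : Set Y, A' = A₁ → B' = B₁ →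
        ∀ h' : (∀ n, ((inSub A').sup (inSub B')).carrier n ≤ (inSub (A₁ ∪ B₁)).carrier n),
        IsIso (HomologicalComplex.homologyMap
          (DSub.incl bd_bd ((inSub A').sup (inSub B')) (inSub (A₁ ∪ B₁)) h') n) →
        IsIso (HomologicalComplex.homologyMap (DSub.incl bd_bd S₁ (inSub (A₁ ∪ B₁)) h1P) n) := by
      rintro _ _ rfl rfl _ h
      exact h
    have := key _ _ (Set.inter_eq_self_of_subset_right Set.subset_union_left)
      (Set.inter_eq_self_of_subset_right Set.subset_union_right) _
      (isIso_homologyMap_small (P := A₁ ∪ B₁) hA₁ hB₁ subset_rfl n)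
    exact (ModuleCat.epi_iff_surjective _).1 inferInstance
  -- the map from small chains to `U`
  let g : ∀ n, (S₁.cx bd_bd).homology n ⟶ ((inSub U).cx bd_bd).homology n := fun n =>
    HomologicalComplex.homologyMap
      (DSub.incl bd_bd S₁ (inSub U) fun n => (h12 n).trans (h2U n)) n
  have hg : ∀ n x, inclHomology hPU n
      (HomologicalComplex.homologyMap (DSub.incl bd_bd S₁ (inSub (A₁ ∪ B₁)) h1P) n x) = g n x := by
    intro n x
    rw [← ConcreteCategory.comp_apply, inclHomology, ← HomologicalComplex.homologyMap_comp,
      DSub.incl_comp]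
  have hrange : ∀ n, LinearMap.range (inclHomology hPU n).hom = LinearMap.range (g n).hom := by
    intro n
    apply le_antisymm
    · rintro _ ⟨y, rfl⟩
      obtain ⟨x, rfl⟩ := hsurj n y
      exact ⟨x, (hg n x).symm⟩
    · rintro _ ⟨x, rfl⟩
      exact ⟨_, hg n x⟩
  have hS₁ := DSub.mv_shortExact bd_bd (inSub A₁) (inSub B₁)
  have hS₂ := DSub.mv_shortExact bd_bd (inSub A₂) (inSub B₂)
  let φ := DSub.mvMap bd_bd (inSub_mono hA) (inSub_mono hB)
  -- an element of the middle term
  have hmid : ∀ n (y : (DSub.prodCx bd_bd (inSub A₂) (inSub B₂)).homology n),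
      HomologicalComplex.homologyMap (DSub.incl bd_bd S₂ (inSub U) h2U) n
        (HomologicalComplex.homologyMap (DSub.mvRight bd_bd (inSub A₂) (inSub B₂)) n y) =
      inclHomology hAU' n (HomologicalComplex.homologyMap (DSub.fstCx bd_bd _ _) n y) +
      inclHomology hBU' n (HomologicalComplex.homologyMap (DSub.sndCx bd_bd _ _) n y) := by
    intro n y
    have e : DSub.mvRight bd_bd (inSub A₂) (inSub B₂) ≫ DSub.incl bd_bd S₂ (inSub U) h2U =
        DSub.fstCx bd_bd _ _ ≫ DSub.incl bd_bd _ _ (inSub_mono hAU') +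
        DSub.sndCx bd_bd _ _ ≫ DSub.incl bd_bd _ _ (inSub_mono hBU') := by
      ext n x; rfl
    have e' := congrArg (HomologicalComplex.homologyMap · n) e
    simp only [HomologicalComplex.homologyMap_comp, HomologicalComplex.homologyMap_add] at e'
    exact ConcreteCategory.congr_hom e' y
  have hgτ : ∀ n x, g n x = HomologicalComplex.homologyMap (DSub.incl bd_bd S₂ (inSub U) h2U) n
      (HomologicalComplex.homologyMap φ.τ₃ n x) := by
    intro n x
    have e : g n = HomologicalComplex.homologyMap (DSub.incl bd_bd S₁ S₂ h12) n ≫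
        HomologicalComplex.homologyMap (DSub.incl bd_bd S₂ (inSub U) h2U) n := by
      rw [← HomologicalComplex.homologyMap_comp, DSub.incl_comp]
    exact ConcreteCategory.congr_hom e x
  -- the connecting map to the intersection
  have hinfle : ∀ n, ((inSub A₁).inf (inSub B₁)).carrier n ≤
      ((inSub A₂).inf (inSub B₂)).carrier n := fun n => inf_le_inf (inSub_mono hA n) (inSub_mono hB n)
  have hinf : ∀ n, Module.Finite ℚ (LinearMap.range
      (HomologicalComplex.homologyMap (DSub.incl bd_bd _ _ hinfle) n).hom) ∧
      (NAB < n → HomologicalComplex.homologyMap (DSub.incl bd_bd _ _ hinfle) n = 0) := by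
    revert hinfle
    rw [inf_inSub, inf_inSub]
    exact fun _ n => ⟨hABf n, hNAB n⟩
  let b : ∀ n, (S₁.cx bd_bd).homology (n + 1) ⟶
      (((inSub A₂).inf (inSub B₂)).cx bd_bd).homology n := fun n =>
    hS₁.δ (n + 1) n rfl ≫ HomologicalComplex.homologyMap (DSub.incl bd_bd _ _ hinfle) n
  have hker : ∀ n x, b n x = 0 → ∃ y, g (n + 1) x =
      inclHomology hAU' (n + 1) (HomologicalComplex.homologyMap (DSub.fstCx bd_bd _ _) (n + 1) y) +
      inclHomology hBU' (n + 1)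
        (HomologicalComplex.homologyMap (DSub.sndCx bd_bd _ _) (n + 1) y) := by
    intro n x hx
    have hnat := HomologicalComplex.HomologySequence.δ_naturality φ hS₁ hS₂ (n + 1) n rfl
    have hx' : hS₂.δ (n + 1) n rfl (HomologicalComplex.homologyMap φ.τ₃ (n + 1) x) = 0 := by
      refine Eq.trans ?_ hx
      exact (ConcreteCategory.congr_hom hnat x).symm
    obtain ⟨y, hy⟩ := (ShortComplex.moduleCat_exact_iff _).1
      (hS₂.homology_exact₃ (n + 1) n rfl) _ hx'
    refine ⟨y, ?_⟩
    exact ((hgτ _ _).trans (congrArg _ hy.symm)).trans (hmid (n + 1) y)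
  have hbf : ∀ n, Module.Finite ℚ (LinearMap.range (b n).hom) := fun n => by
    have := (hinf n).1
    refine Submodule.finiteDimensional_of_le (S₂ := LinearMap.range
      (HomologicalComplex.homologyMap (DSub.incl bd_bd _ _ hinfle) n).hom) ?_
    rintro _ ⟨x, rfl⟩
    exact ⟨_, rfl⟩
  -- The connecting map lowers the degree, hence the shift by one in the bound coming from the
  -- intersection.
  refine ⟨hPU, fun n => ?_, max (max NA NB) (NAB + 1), fun n hn => ?_⟩
  · rw [hrange]
    have := hAf n
    have := hBf n
    have hW : Module.Finite ℚ ↥(LinearMap.range (inclHomology hAU' n).hom ⊔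
      LinearMap.range (inclHomology hBU' n).hom) := inferInstance
    have hmem : ∀ y, inclHomology hAU' n (HomologicalComplex.homologyMap
        (DSub.fstCx bd_bd (inSub A₂) (inSub B₂)) n y) +
        inclHomology hBU' n (HomologicalComplex.homologyMap (DSub.sndCx bd_bd _ _) n y) ∈
        LinearMap.range (inclHomology hAU' n).hom ⊔ LinearMap.range (inclHomology hBU' n).hom :=
      fun y => Submodule.add_mem_sup ⟨_, rfl⟩ ⟨_, rfl⟩
    cases n with
    | zero =>
      refine Submodule.finiteDimensional_of_le (S₂ := LinearMap.range (inclHomology hAU' 0).hom ⊔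
        LinearMap.range (inclHomology hBU' 0).hom) ?_
      rintro _ ⟨x, rfl⟩
      change g 0 x ∈ _
      obtain ⟨y, hy⟩ := homologyMap_g_zero_surjective hS₂ (HomologicalComplex.homologyMap φ.τ₃ 0 x)
      have e : g 0 x = _ := ((hgτ _ _).trans (congrArg _ hy.symm)).trans (hmid 0 y)
      rw [e]
      exact hmem y
    | succ n =>
      refine finite_range_of_finite_on_ker _ (b n).hom (hbf n) _ hW fun x hx => ?_
      obtain ⟨y, hy⟩ := hker n x hx
      change g (n + 1) x ∈ _
      rw [hy]
      exact hmem y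
  · have hn1 := lt_of_le_of_lt (le_max_right _ _) hn
    have hn2 := lt_of_le_of_lt ((le_max_left _ _).trans (le_max_left _ _)) hn
    have hn3 := lt_of_le_of_lt ((le_max_right NA NB).trans (le_max_left _ _)) hn
    obtain ⟨m, rfl⟩ : ∃ m, n = m + 1 := ⟨n - 1, by omega⟩
    have hz : LinearMap.range (inclHomology hPU (m + 1)).hom = ⊥ := by
      rw [hrange, LinearMap.range_eq_bot]
      refine LinearMap.ext fun x => ?_
      obtain ⟨y, hy⟩ := hker m x (by
        change HomologicalComplex.homologyMap (DSub.incl bd_bd _ _ hinfle) m _ = 0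
        rw [(hinf m).2 (by omega)]
        rfl)
      refine hy.trans ?_
      rw [hNA _ hn2, hNB _ hn3]
      exact add_zero _
    exact ModuleCat.hom_ext (LinearMap.range_eq_bot.1 hz)

/-- Homological finiteness of the germ of neighbourhoods of a subset. -/
def Tame (A : Set Y) : Prop :=
  ∀ U, IsOpen U → A ⊆ U → ∃ V, IsOpen V ∧ A ⊆ V ∧ FiniteRank V U

/-- Given the neighbourhood `V` of `A ∩ B`, the compact sets `A \ V` and `B \ V` are disjoint and
have disjoint neighbourhoods `G` and `H`. Restricting the neighbourhoods of `A` and `B` to `V ∪ G`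
and `V ∪ H` forces their intersection into `V`, where the rank is finite. -/
lemma Tame.union [T2Space Y] {A B : Set Y} (hA : IsCompact A) (hB : IsCompact B) (tA : Tame A)
    (tB : Tame B) (tAB : Tame (A ∩ B)) : Tame (A ∪ B) := by
  intro U hU hABU
  obtain ⟨A₂, hA₂, hAA₂, rA⟩ := tA U hU (Set.subset_union_left.trans hABU)
  obtain ⟨B₂, hB₂, hBB₂, rB⟩ := tB U hU (Set.subset_union_right.trans hABU)
  obtain ⟨V, hV, hABV, rV⟩ := tAB (A₂ ∩ B₂) (hA₂.inter hB₂) (Set.inter_subset_inter hAA₂ hBB₂)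
  obtain ⟨G, H, hG, hH, hAG, hBH, hGH⟩ := SeparatedNhds.of_isCompact_isCompact
    (hA.diff hV) (hB.diff hV) (by
      rw [Set.disjoint_left]
      rintro x ⟨hxA, hxV⟩ ⟨hxB, -⟩
      exact hxV (hABV ⟨hxA, hxB⟩))
  refine ⟨A₂ ∩ (V ∪ G) ∪ B₂ ∩ (V ∪ H), (hA₂.inter (hV.union hG)).union (hB₂.inter (hV.union hH)),
    Set.union_subset_union (fun x hx => ⟨hAA₂ hx, ?_⟩) (fun x hx => ⟨hBB₂ hx, ?_⟩),
    FiniteRank.union (hA₂.inter (hV.union hG)) (hB₂.inter (hV.union hH)) Set.inter_subset_left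
      Set.inter_subset_left rA rB ?_⟩
  · by_cases h : x ∈ V
    exacts [Or.inl h, Or.inr (hAG ⟨hx, h⟩)]
  · by_cases h : x ∈ V
    exacts [Or.inl h, Or.inr (hBH ⟨hx, h⟩)]
  · obtain ⟨hVAB, h1, N, h2⟩ := rV
    have hle : A₂ ∩ (V ∪ G) ∩ (B₂ ∩ (V ∪ H)) ⊆ V := by
      rintro x ⟨⟨-, hx1⟩, -, hx2⟩
      rcases hx1 with h | h
      · exact h
      · rcases hx2 with h' | h'
        · exact h'
        · exact (Set.disjoint_left.1 hGH h h').elim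
    refine ⟨hle.trans hVAB, fun n => ?_, N, fun n hn => ?_⟩
    · rw [← inclHomology_comp hle hVAB]
      have := h1 n
      refine Submodule.finiteDimensional_of_le
        (S₂ := LinearMap.range (inclHomology hVAB n).hom) ?_
      rintro _ ⟨x, rfl⟩
      exact ⟨_, rfl⟩
    · rw [← inclHomology_comp hle hVAB, h2 n hn, comp_zero]

/-- The part of the domain of a chart lying over a subset of its target. -/
def chartSetHomeomorph {Y Z : Type*} [TopologicalSpace Y] [TopologicalSpace Z]
    (e : OpenPartialHomeomorph Y Z) {S : Set Z} (hS : S ⊆ e.target) :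
    ↥(e.source ∩ e ⁻¹' S) ≃ₜ S :=
  e.homeomorphOfImageSubsetSource Set.inter_subset_left (by
    rw [e.image_source_inter_eq']
    ext z
    constructor
    · rintro ⟨hz, hz'⟩
      simpa [e.right_inv hz] using hz'
    · intro hz
      exact ⟨hS hz, by simpa [e.right_inv (hS hz)] using hz⟩)

lemma hasFiniteHomology_chart_convex (e : OpenPartialHomeomorph Y ℂ) {D : Set ℂ}
    (hD : Convex ℝ D) (hDe : D ⊆ e.target) :
    HasFiniteHomology ↥(e.source ∩ e ⁻¹' D) := by
  rcases D.eq_empty_or_nonempty with rfl | hne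
  · have : IsEmpty ↥(e.source ∩ e ⁻¹' (∅ : Set ℂ)) := by simp
    exact hasFiniteHomology_of_isEmpty _
  · have : ContractibleSpace D := hD.contractibleSpace hne
    have := (chartSetHomeomorph e hDe).contractibleSpace
    exact hasFiniteHomology_of_contractible _

/-- Mayer–Vietoris and induction on the number of sets. The intersection of one set with the union
of the others is again a union of fewer convex sets, which is why `D` varies in the induction. -/
lemma hasFiniteHomology_chart_iUnion (e : OpenPartialHomeomorph Y ℂ) {ι : Type*} (t : Finset ι)
    (D : ι → Set ℂ) (hD : ∀ i, Convex ℝ (D i)) (hO : ∀ i, IsOpen (D i))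
    (hDe : ∀ i, D i ⊆ e.target) :
    HasFiniteHomology ↥(⋃ i ∈ t, e.source ∩ e ⁻¹' D i) := by
  classical
  induction t using Finset.induction_on generalizing D with
  | empty =>
    have : IsEmpty ↥(⋃ i ∈ (∅ : Finset ι), e.source ∩ e ⁻¹' D i) := by simp
    exact hasFiniteHomology_of_isEmpty _
  | insert a t ha ih =>
    have hop : ∀ i, IsOpen (e.source ∩ e ⁻¹' D i) := fun i => e.isOpen_inter_preimage (hO i)
    rw [Finset.set_biUnion_insert]
    refine (mayerVietoris_union (hop a) (isOpen_biUnion fun i _ => hop i) subset_rfl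
      ?_ ?_ ?_).1
    · rw [Set.inter_eq_self_of_subset_right Set.subset_union_left]
      exact hasFiniteHomology_chart_convex e (hD a) (hDe a)
    · rw [Set.inter_eq_self_of_subset_right Set.subset_union_right]
      exact ih D hD hO hDe
    · rw [Set.inter_eq_self_of_subset_right Set.subset_union_left,
        Set.inter_eq_self_of_subset_right Set.subset_union_right]
      have := ih (fun i => D a ∩ D i) (fun i => (hD a).inter (hD i))
        (fun i => (hO a).inter (hO i)) (fun i => Set.inter_subset_left.trans (hDe a))
      have hset : (e.source ∩ e ⁻¹' D a) ∩ ⋃ i ∈ t, e.source ∩ e ⁻¹' D i =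
          ⋃ i ∈ t, e.source ∩ e ⁻¹' (D a ∩ D i) := by
        rw [Set.inter_iUnion₂]
        refine Set.iUnion₂_congr fun i _ => ?_
        ext x
        simp only [Set.mem_inter_iff, Set.mem_preimage]
        tauto
      rw [← hset] at this
      exact this

/-- Finitely many coordinate discs inside `U` cover `A`, and their union already has finite
homology. -/
lemma tame_of_subset_chart (e : OpenPartialHomeomorph Y ℂ) {A : Set Y} (hA : IsCompact A)
    (hAe : A ⊆ e.source) : Tame A := by
  intro U hU hAU
  have hO : IsOpen (e.target ∩ e.symm ⁻¹' U) := e.isOpen_inter_preimage_symm hU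
  have hmem : ∀ x ∈ A, ∃ r > 0, Metric.ball (e x) r ⊆ e.target ∩ e.symm ⁻¹' U := fun x hx =>
    Metric.isOpen_iff.1 hO (e x) ⟨e.map_source (hAe hx), by
      simpa [e.left_inv (hAe hx)] using hAU hx⟩
  choose! r hr hball using hmem
  obtain ⟨t, htA⟩ := hA.elim_nhds_subcover'
    (fun x hx => e.source ∩ e ⁻¹' Metric.ball (e x) (r x))
    (fun x hx => (e.isOpen_inter_preimage Metric.isOpen_ball).mem_nhds
      ⟨hAe hx, Metric.mem_ball_self (hr x hx)⟩)
  refine ⟨⋃ x ∈ t, e.source ∩ e ⁻¹' Metric.ball (e x) (r x), ?_, ?_, FiniteRank.of_finite ?_ ?_⟩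
  · exact isOpen_biUnion fun i _ => e.isOpen_inter_preimage Metric.isOpen_ball
  · exact htA
  · refine Set.iUnion₂_subset fun x _ y hy => ?_
    have := (hball x x.2 hy.2).2
    simpa [e.left_inv hy.1] using this
  · exact hasFiniteHomology_chart_iUnion e t (fun x => Metric.ball (e x) (r x))
      (fun i => convex_ball _ _) (fun i => Metric.isOpen_ball)
      (fun i => (hball i i.2).trans Set.inter_subset_left)

/-- Compact topological surfaces have finite dimensional homology. -/
theorem hasFiniteHomology_of_charts [T2Space Y] [CompactSpace Y]
    (h : ∀ y : Y, ∃ e : OpenPartialHomeomorph Y ℂ, y ∈ e.source) : HasFiniteHomology Y := by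
  classical
  choose e he using h
  have hK : ∀ y, ∃ K, IsCompact K ∧ y ∈ interior K ∧ K ⊆ (e y).source := fun y =>
    exists_compact_subset (e y).open_source (he y)
  choose K hKc hyK hKe using hK
  obtain ⟨t, ht⟩ := isCompact_univ.elim_nhds_subcover (fun y : Y => interior (K y))
    (fun y _ => isOpen_interior.mem_nhds (hyK y))
  have key : ∀ t : Finset Y, Tame (⋃ y ∈ t, K y) := by
    intro t
    induction t using Finset.induction_on with
    | empty =>
      intro U _ _
      refine ⟨∅, isOpen_empty, by simp, FiniteRank.of_finite (Set.empty_subset _) ?_⟩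
      exact hasFiniteHomology_of_isEmpty _
    | insert a t ha ih =>
      rw [Finset.set_biUnion_insert]
      have hc : IsCompact (⋃ y ∈ t, K y) := t.isCompact_biUnion fun y _ => hKc y
      -- The intersection of the new compact set with the previous union lies in a single chart, so
      -- it is tame without any induction.
      exact Tame.union (hKc a) hc (tame_of_subset_chart (e a) (hKc a) (hKe a)) ih
        (tame_of_subset_chart (e a) ((hKc a).inter hc) (Set.inter_subset_left.trans (hKe a)))
  have huniv : (⋃ y ∈ t, K y) = Set.univ := by
    refine Set.eq_univ_of_univ_subset (ht.2.trans ?_)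
    exact Set.iUnion₂_mono fun y _ => interior_subset
  have := key t
  rw [huniv] at this
  -- The only neighbourhood of the whole space is the space itself, so tameness says that the
  -- identity has finite rank.
  obtain ⟨V, -, hV, hr⟩ := this Set.univ isOpen_univ subset_rfl
  rw [Set.univ_subset_iff.1 hV] at hr
  exact hr.hasFiniteHomology.of_homeomorph (Homeomorph.Set.univ Y)

end SurfaceFibration

end

section

/-! ### Annuli and the local contribution of a double point -/

namespace SurfaceFibration

variable {Y : Type u} [TopologicalSpace Y]

lemma euler_disjoint_union {P U V : Set Y} (hU : IsOpen U) (hV : IsOpen V) (hP : P ⊆ U ∪ V)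
    (hUV : ∀ x ∈ P, x ∈ U → x ∉ V) (h1 : HasFiniteHomology ↥(P ∩ U)) (h2 : HasFiniteHomology ↥(P ∩ V)) :
    HasFiniteHomology P ∧ eulerNumber P = eulerNumber ↥(P ∩ U) + eulerNumber ↥(P ∩ V) := by
  have hE : IsEmpty ↥((P ∩ U) ∩ (P ∩ V)) := by
    rw [Set.isEmpty_coe_sort, Set.eq_empty_iff_forall_notMem]
    rintro x ⟨⟨h, hx⟩, -, hx'⟩
    exact hUV x h hx hx'
  obtain ⟨h, h'⟩ := mayerVietoris_union hU hV hP h1 h2 (hasFiniteHomology_of_isEmpty _)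
  rw [eulerNumber_of_isEmpty ↥((P ∩ U) ∩ (P ∩ V)), add_zero] at h'
  exact ⟨h, h'⟩

/-- An open annulus in the plane. -/
def annulus (r R : ℝ) : Set ℂ := {z | r < ‖z‖ ∧ ‖z‖ < R}

/-- The open rectangle which the logarithm maps a sector of an annulus to. -/
def logRectangle (r R a b : ℝ) : Set ℂ :=
  {w | Real.log r < w.re ∧ w.re < Real.log R ∧ a < w.im ∧ w.im < b}

lemma contractibleSpace_logRectangle {r R a b : ℝ} (hr : 0 < r) (hR : r < R) (hab : a < b) :
    ContractibleSpace (logRectangle r R a b) := by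
  have hlog := Real.log_lt_log hr hR
  have hc : Convex ℝ (logRectangle r R a b) := by
    have : logRectangle r R a b = {w : ℂ | Real.log r < w.re} ∩ {w | w.re < Real.log R} ∩
        ({w | a < w.im} ∩ {w | w.im < b}) := by
      ext w
      simp [logRectangle, and_assoc]
    rw [this]
    exact ((convex_halfSpace_re_gt _).inter (convex_halfSpace_re_lt _)).inter
      ((convex_halfSpace_im_gt _).inter (convex_halfSpace_im_lt _))
  refine hc.contractibleSpace ⟨⟨(Real.log r + Real.log R) / 2, (a + b) / 2⟩, ?_⟩
  refine ⟨?_, ?_, ?_, ?_⟩ <;> simp only <;> linarith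

lemma log_mem_logRectangle {r R a b : ℝ} (hr : 0 < r) (hR : r < R) {z : ℂ} (hz : z ≠ 0) :
    Complex.log z ∈ logRectangle r R a b ↔ z ∈ annulus r R ∧ a < z.arg ∧ z.arg < b := by
  have hz' : 0 < ‖z‖ := norm_pos_iff.2 hz
  simp only [logRectangle, annulus, Set.mem_ofPred_eq, Complex.log_re, Complex.log_im]
  rw [Real.log_lt_log_iff hr hz', Real.log_lt_log_iff hz' (hr.trans hR)]
  tauto

/-- A copy of the plane in an arbitrary universe, with a branch of the logarithm as a chart. -/
def logChart : OpenPartialHomeomorph (ULift.{u} ℂ) ℂ :=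
  Homeomorph.ulift.toOpenPartialHomeomorph.trans Complex.expOpenPartialHomeomorph.symm

/-- The branch of the logarithm of the opposite number. -/
def logNegChart : OpenPartialHomeomorph (ULift.{u} ℂ) ℂ :=
  (Homeomorph.ulift.trans (Homeomorph.neg ℂ)).toOpenPartialHomeomorph.trans
    Complex.expOpenPartialHomeomorph.symm

lemma mem_logChart_source {z : ULift.{u} ℂ} :
    z ∈ logChart.source ↔ z.down ∈ Complex.slitPlane := by
  simp [logChart, Complex.expOpenPartialHomeomorph]
  rfl

lemma mem_logNegChart_source {z : ULift.{u} ℂ} :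
    z ∈ logNegChart.source ↔ -z.down ∈ Complex.slitPlane := by
  simp [logNegChart, Complex.expOpenPartialHomeomorph]
  rfl

lemma logRectangle_subset_target {r R a b : ℝ} (ha : -Real.pi ≤ a) (hb : b ≤ Real.pi) :
    logRectangle r R a b ⊆ logChart.{u}.target := by
  rintro w ⟨-, -, h1, h2⟩
  simp only [logChart, Complex.expOpenPartialHomeomorph, OpenPartialHomeomorph.trans_target,
    OpenPartialHomeomorph.symm_target,
    Homeomorph.toOpenPartialHomeomorph_target, Set.preimage_univ, Set.inter_univ]
  exact ⟨ha.trans_lt h1, h2.trans_le hb⟩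

lemma logRectangle_subset_target_neg {r R a b : ℝ} (ha : -Real.pi ≤ a) (hb : b ≤ Real.pi) :
    logRectangle r R a b ⊆ logNegChart.{u}.target := by
  rintro w ⟨-, -, h1, h2⟩
  simp only [logNegChart, Complex.expOpenPartialHomeomorph, OpenPartialHomeomorph.trans_target,
    OpenPartialHomeomorph.symm_target,
    Homeomorph.toOpenPartialHomeomorph_target, Set.preimage_univ, Set.inter_univ]
  exact ⟨ha.trans_lt h1, h2.trans_le hb⟩

lemma arg_lt_pi_of_mem {z : ℂ} (hz : z ∈ Complex.slitPlane) :
    z ≠ 0 ∧ -Real.pi < z.arg ∧ z.arg < Real.pi := by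
  have h := Complex.mem_slitPlane_iff_arg.1 hz
  exact ⟨h.2, Complex.neg_pi_lt_arg z, lt_of_le_of_ne (Complex.arg_le_pi z) h.1⟩

lemma arg_pos_iff_of_mem {z : ℂ} (hz : z ∈ Complex.slitPlane) : 0 < z.arg ↔ 0 < z.im := by
  constructor
  · intro h
    rcases (Complex.arg_nonneg_iff.1 h.le).lt_or_eq with h' | h'
    · exact h'
    · rcases Complex.mem_slitPlane_iff.1 hz with h2 | h2
      · exact absurd (Complex.arg_eq_zero_iff.2 ⟨h2.le, h'.symm⟩) h.ne'
      · exact absurd h'.symm h2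
  · intro h
    refine lt_of_le_of_ne (Complex.arg_nonneg_iff.2 h.le) fun h' => ?_
    exact h.ne' (Complex.arg_eq_zero_iff.1 h'.symm).2

/-- Cutting along the negative or along the positive real axis leaves a region that a logarithm maps
to a rectangle. The two regions cover the annulus, and their overlap consists of the upper and the
lower half, two more rectangles: `1 + 1 - 2 = 0`. -/
lemma euler_annulus_ulift {r R : ℝ} (hr : 0 < r) (hR : r < R) :
    HasFiniteHomology ↥{z : ULift.{u} ℂ | z.down ∈ annulus r R} ∧
      eulerNumber ↥{z : ULift.{u} ℂ | z.down ∈ annulus r R} = 0 := by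
  set P := {z : ULift.{u} ℂ | z.down ∈ annulus r R} with hP
  have hpi := Real.pi_pos
  have hPU : P ∩ logChart.source = logChart.source ∩
      logChart ⁻¹' logRectangle r R (-Real.pi) Real.pi := by
    ext z
    rw [Set.inter_comm]
    refine and_congr_right fun hz => ?_
    have hz' := arg_lt_pi_of_mem (mem_logChart_source.1 hz)
    exact ⟨fun h => (log_mem_logRectangle hr hR hz'.1).2 ⟨h, hz'.2⟩,
      fun h => ((log_mem_logRectangle hr hR hz'.1).1 h).1⟩
  have hPV : P ∩ logNegChart.source = logNegChart.source ∩
      logNegChart ⁻¹' logRectangle r R (-Real.pi) Real.pi := by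
    ext z
    rw [Set.inter_comm]
    refine and_congr_right fun hz => ?_
    have hz' := arg_lt_pi_of_mem (mem_logNegChart_source.1 hz)
    have hn : z ∈ P ↔ -z.down ∈ annulus r R := by simp [hP, annulus]
    rw [hn]
    exact ⟨fun h => (log_mem_logRectangle hr hR hz'.1).2 ⟨h, hz'.2⟩,
      fun h => ((log_mem_logRectangle hr hR hz'.1).1 h).1⟩
  have hcov : P ⊆ logChart.source ∪ logNegChart.source := by
    intro z hz
    have hz0 : z.down ≠ 0 := by
      intro h
      have := hz.1
      rw [h, norm_zero] at this
      linarith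
    rw [Set.mem_union, mem_logChart_source, mem_logNegChart_source, Complex.mem_slitPlane_iff,
      Complex.mem_slitPlane_iff]
    by_contra! h
    simp only [Complex.neg_re, Complex.neg_im] at h
    exact hz0 (Complex.ext (by simp; linarith [h.1.1, h.2.1]) h.1.2)
  let Q := (P ∩ logChart.source) ∩ (P ∩ logNegChart.source)
  have him : Continuous fun z : ULift.{u} ℂ => z.down.im :=
    Complex.continuous_im.comp continuous_uliftDown
  have hup : IsOpen {z : ULift.{u} ℂ | 0 < z.down.im} := isOpen_lt continuous_const him
  have hlo : IsOpen {z : ULift.{u} ℂ | z.down.im < 0} := isOpen_lt him continuous_const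
  have hQ1 : Q ∩ {z | 0 < z.down.im} = logChart.source ∩
      logChart ⁻¹' logRectangle r R 0 Real.pi := by
    ext z
    constructor
    · rintro ⟨⟨⟨h1, h2⟩, -, h3⟩, h4⟩
      have h2' := mem_logChart_source.1 h2
      have hz' := arg_lt_pi_of_mem h2'
      exact ⟨h2, (log_mem_logRectangle hr hR hz'.1).2
        ⟨h1, (arg_pos_iff_of_mem h2').2 h4, hz'.2.2⟩⟩
    · rintro ⟨h2, h3⟩
      have h2' := mem_logChart_source.1 h2
      have hz' := arg_lt_pi_of_mem h2'
      have h := (log_mem_logRectangle hr hR hz'.1).1 h3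
      have h4 : 0 < z.down.im := (arg_pos_iff_of_mem h2').1 h.2.1
      refine ⟨⟨⟨h.1, h2⟩, h.1, mem_logNegChart_source.2 (Complex.mem_slitPlane_iff.2 (Or.inr ?_))⟩,
        h4⟩
      simpa using h4.ne'
  have hQ2 : Q ∩ {z | z.down.im < 0} = logChart.source ∩
      logChart ⁻¹' logRectangle r R (-Real.pi) 0 := by
    ext z
    constructor
    · rintro ⟨⟨⟨h1, h2⟩, -, h3⟩, h4⟩
      have h2' := mem_logChart_source.1 h2
      have hz' := arg_lt_pi_of_mem h2'
      exact ⟨h2, (log_mem_logRectangle hr hR hz'.1).2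
        ⟨h1, hz'.2.1, Complex.arg_neg_iff.2 h4⟩⟩
    · rintro ⟨h2, h3⟩
      have h2' := mem_logChart_source.1 h2
      have hz' := arg_lt_pi_of_mem h2'
      have h := (log_mem_logRectangle hr hR hz'.1).1 h3
      have h4 : z.down.im < 0 := Complex.arg_neg_iff.1 h.2.2
      refine ⟨⟨⟨h.1, h2⟩, h.1, mem_logNegChart_source.2 (Complex.mem_slitPlane_iff.2 (Or.inr ?_))⟩,
        h4⟩
      simpa using h4.ne
  have c1 : ContractibleSpace ↥(P ∩ logChart.source) := by
    rw [hPU]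
    have := contractibleSpace_logRectangle hr hR (neg_lt_self hpi)
    exact (chartSetHomeomorph _ (logRectangle_subset_target le_rfl le_rfl)).contractibleSpace
  have c2 : ContractibleSpace ↥(P ∩ logNegChart.source) := by
    rw [hPV]
    have := contractibleSpace_logRectangle hr hR (neg_lt_self hpi)
    exact (chartSetHomeomorph _ (logRectangle_subset_target_neg le_rfl le_rfl)).contractibleSpace
  have c3 : ContractibleSpace ↥(Q ∩ {z | 0 < z.down.im}) := by
    rw [hQ1]
    have := contractibleSpace_logRectangle hr hR hpi
    exact (chartSetHomeomorph _ (logRectangle_subset_target (by linarith) le_rfl)).contractibleSpace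
  have c4 : ContractibleSpace ↥(Q ∩ {z | z.down.im < 0}) := by
    rw [hQ2]
    have := contractibleSpace_logRectangle hr hR (neg_lt_zero.2 hpi)
    exact (chartSetHomeomorph _ (logRectangle_subset_target le_rfl hpi.le)).contractibleSpace
  obtain ⟨hQf, hQe⟩ := euler_disjoint_union (P := Q) hup hlo (by
      rintro z ⟨⟨-, h1⟩, -, h2⟩
      rw [mem_logChart_source, Complex.mem_slitPlane_iff] at h1
      rw [mem_logNegChart_source, Complex.mem_slitPlane_iff] at h2
      simp only [Complex.neg_re, Complex.neg_im, Left.neg_pos_iff, ne_eq, neg_eq_zero] at h2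
      have h0 : z.down.im ≠ 0 := by
        rcases h1 with h1 | h1
        · rcases h2 with h2 | h2
          · linarith
          · exact h2
        · exact h1
      exact (lt_or_gt_of_ne h0).symm)
    (fun z _ h1 h2 => lt_asymm (α := ℝ) h1 h2)
    (hasFiniteHomology_of_contractible _) (hasFiniteHomology_of_contractible _)
  obtain ⟨h, h'⟩ := mayerVietoris_union logChart.open_source logNegChart.open_source hcov
    (hasFiniteHomology_of_contractible _) (hasFiniteHomology_of_contractible _) hQf
  refine ⟨h, ?_⟩
  rw [eulerNumber_of_contractible ↥(P ∩ logChart.source),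
    eulerNumber_of_contractible ↥(P ∩ logNegChart.source)] at h'
  rw [eulerNumber_of_contractible ↥(Q ∩ {z | 0 < z.down.im}),
    eulerNumber_of_contractible ↥(Q ∩ {z | z.down.im < 0})] at hQe
  change eulerNumber P + eulerNumber Q = _ at h'
  linarith

/-- The Euler number of an annulus vanishes. -/
lemma euler_annulus {r R : ℝ} (k : Y ≃ₜ annulus r R) (hr : 0 < r) (hR : r < R) :
    HasFiniteHomology Y ∧ eulerNumber Y = 0 := by
  have e : Y ≃ₜ ↥{z : ULift.{u} ℂ | z.down ∈ annulus r R} :=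
    k.trans (Homeomorph.subtype Homeomorph.ulift fun _ => Iff.rfl).symm
  obtain ⟨h1, h2⟩ := euler_annulus_ulift.{u} hr hR
  exact ⟨h1.of_homeomorph e.symm, (eulerNumber_congr_homeomorph e).trans h2⟩

/-- The part of a conic `x * y = c` over an annulus. -/
def conicPart (c : ℂ) (r R : ℝ) : Set (ℂ × ℂ) := {v | v.1 * v.2 = c ∧ r < ‖v.1‖ ∧ ‖v.1‖ < R}

/-- A conic is parametrised by its first coordinate. -/
def conicHomeomorph {c : ℂ} {r R : ℝ} (hr : 0 < r) : conicPart c r R ≃ₜ annulus r R where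
  toFun v := ⟨v.1.1, v.2.2⟩
  invFun z := ⟨(z, c / z), by
    have hz : (z : ℂ) ≠ 0 := norm_pos_iff.1 (hr.trans z.2.1)
    exact ⟨mul_div_cancel₀ _ hz, z.2⟩⟩
  left_inv v := by
    obtain ⟨⟨x, y⟩, h1, h2⟩ := v
    have hx : x ≠ 0 := norm_pos_iff.1 (hr.trans h2.1)
    refine Subtype.ext (Prod.ext rfl ?_)
    change c / x = y
    rw [← h1, mul_div_cancel_left₀ _ hx]
  right_inv z := rfl
  continuous_toFun := by fun_prop
  continuous_invFun := by
    refine Continuous.subtype_mk (continuous_subtype_val.prodMk ?_) _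
    exact continuous_const.div continuous_subtype_val fun z =>
      norm_pos_iff.1 (hr.trans z.2.1)

lemma euler_conicPart (φ : OpenPartialHomeomorph Y (ℂ × ℂ)) {c : ℂ} {r R : ℝ} (hr : 0 < r)
    (hR : r < R) (hT : conicPart c r R ⊆ φ.target) :
    HasFiniteHomology ↥(φ.source ∩ φ ⁻¹' conicPart c r R) ∧
      eulerNumber ↥(φ.source ∩ φ ⁻¹' conicPart c r R) = 0 :=
  euler_annulus ((chartSetHomeomorph φ hT).trans (conicHomeomorph hr)) hr hR

end SurfaceFibration

end

/-! ### Smoothing a single double point -/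

section

namespace SurfaceFibration

variable {Y : Type u} [TopologicalSpace Y]

/-- Replacing a contractible piece by a piece of Euler number zero, along an overlap of Euler
number zero. -/
lemma euler_replace {P Q N N' : Set Y} (hN : IsOpen N) (hN' : IsClosed N') (hsub : N' ⊆ N)
    (hPQ : P ∩ N'ᶜ = Q ∩ N'ᶜ) (hPN : ContractibleSpace ↥(P ∩ N))
    (hQN : HasFiniteHomology ↥(Q ∩ N) ∧ eulerNumber ↥(Q ∩ N) = 0)
    (hov : HasFiniteHomology ↥((Q ∩ N) ∩ (Q ∩ N'ᶜ)) ∧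
      eulerNumber ↥((Q ∩ N) ∩ (Q ∩ N'ᶜ)) = 0)
    (hQ : HasFiniteHomology Q) :
    HasFiniteHomology P ∧ eulerNumber P = eulerNumber Q + 1 := by
  have hcov : ∀ R : Set Y, R ⊆ N ∪ N'ᶜ := fun R x _ => by
    by_cases h : x ∈ N'
    exacts [Or.inl (hsub h), Or.inr h]
  have hovP : (P ∩ N) ∩ (P ∩ N'ᶜ) = (Q ∩ N) ∩ (Q ∩ N'ᶜ) := by
    have key : ∀ R : Set Y, (R ∩ N) ∩ (R ∩ N'ᶜ) = N ∩ (R ∩ N'ᶜ) := fun R => by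
      ext x
      simp only [Set.mem_inter_iff]
      tauto
    rw [key, key, hPQ]
  -- The common part outside `N'` is only known through `Q`, so its finiteness and Euler number are
  -- extracted from those of `Q` and then used for `P`.
  have hr := mayerVietoris_right hN hN'.isOpen_compl (hcov Q) hQ hov.1
  have eQ := (mayerVietoris_union hN hN'.isOpen_compl (hcov Q) hQN.1 hr hov.1).2
  rw [← hovP, ← hPQ] at eQ
  rw [← hPQ] at hr
  rw [← hovP] at hov
  obtain ⟨h, eP⟩ := mayerVietoris_union hN hN'.isOpen_compl (hcov P)
    (hasFiniteHomology_of_contractible _) hr hov.1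
  rw [eulerNumber_of_contractible ↥(P ∩ N), hov.2] at eP
  rw [hQN.2, hov.2] at eQ
  exact ⟨h, by linarith⟩

/-- A piecewise linear cutoff function, equal to `1` up to `1 / 3` and to `0` from `2 / 3` on. -/
def cutoff (t : ℝ) : ℝ := max 0 (min 1 (2 - 3 * t))

lemma cutoff_nonneg (t : ℝ) : 0 ≤ cutoff t := le_max_left _ _

lemma cutoff_le_one (t : ℝ) : cutoff t ≤ 1 := max_le zero_le_one (min_le_left _ _)

lemma cutoff_eq_one {t : ℝ} (h : t ≤ 1 / 3) : cutoff t = 1 := by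
  rw [cutoff, min_eq_left (by linarith), max_eq_right zero_le_one]

lemma cutoff_eq_zero {t : ℝ} (h : 2 / 3 ≤ t) : cutoff t = 0 := by
  rw [cutoff, max_eq_left]
  exact (min_le_right _ _).trans (by linarith)

lemma continuous_cutoff : Continuous cutoff := by unfold cutoff; fun_prop

lemma lipschitzWith_cutoff : LipschitzWith 3 cutoff := by
  refine LipschitzWith.const_max (LipschitzWith.const_min ?_ 1) 0
  refine LipschitzWith.of_dist_le_mul fun x y => ?_
  rw [Real.dist_eq, Real.dist_eq, show (2 - 3 * x) - (2 - 3 * y) = -3 * (x - y) by ring, abs_mul]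
  norm_num

/-- The partially smoothed double point: `x * y = c` outside, and `x * y = 0` near the origin. -/
def nodeModel (c : ℂ) (ε : ℝ) : Set (ℂ × ℂ) :=
  {v | ‖v‖ < ε ∧ v.1 * v.2 = c * (1 - cutoff (‖v‖ / ε) : ℝ)}

section

variable {c : ℂ} {ε : ℝ}

/-- The graph parametrising each of the branches of `nodeModel`. -/
def nodeBranch (c : ℂ) (ε : ℝ) (x : ℂ) : ℂ := c * (1 - cutoff (‖x‖ / ε) : ℝ) / x

lemma nodeBranch_eq_zero (hε : 0 < ε) {x : ℂ} (hx : ‖x‖ ≤ ε / 3) : nodeBranch c ε x = 0 := by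
  rw [nodeBranch, cutoff_eq_one (by rw [div_le_iff₀ hε]; linarith)]
  simp

/-- The division by `x` is harmless because the numerator vanishes identically on a disc around the
origin. -/
lemma continuous_nodeBranch (hε : 0 < ε) : Continuous (nodeBranch c ε) := by
  rw [continuous_iff_continuousAt]
  intro x
  by_cases hx : x = 0
  · subst hx
    refine ContinuousAt.congr (f := fun _ => (0 : ℂ)) continuousAt_const ?_
    filter_upwards [Metric.ball_mem_nhds (0 : ℂ) (by positivity : 0 < ε / 3)] with y hy
    exact (nodeBranch_eq_zero hε (mem_ball_zero_iff.1 hy).le).symm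
  · refine ContinuousAt.div ?_ continuousAt_id hx
    refine continuousAt_const.mul (Complex.continuous_ofReal.continuousAt.comp ?_)
    exact (continuous_const.sub (continuous_cutoff.comp
      (continuous_norm.div_const ε))).continuousAt

lemma mul_nodeBranch (x : ℂ) :
    x * nodeBranch c ε x = c * (1 - cutoff (‖x‖ / ε) : ℝ) := by
  by_cases hx : x = 0
  · subst hx
    rw [cutoff_eq_one (by simp)]
    simp
  · rw [nodeBranch, mul_div_cancel₀ _ hx]

lemma norm_mul_cutoff_le (c : ℂ) (t : ℝ) : ‖c * (1 - cutoff t : ℝ)‖ ≤ ‖c‖ := by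
  rw [norm_mul, Complex.norm_real]
  refine mul_le_of_le_one_right (norm_nonneg _) ?_
  rw [Real.norm_eq_abs, abs_le]
  constructor <;> linarith [cutoff_nonneg t, cutoff_le_one t]

/-- For `‖x‖ > ε / 3` the numerator has norm below `(ε / 3) ^ 2`, and for smaller `x` it is zero.
Hence the maximum norm on the graph is `‖x‖`, the argument that the cutoff in `nodeModel` needs. -/
lemma norm_nodeBranch_le (hε : 0 < ε) (hc : ‖c‖ < (ε / 3) ^ 2) (x : ℂ) :
    ‖nodeBranch c ε x‖ ≤ ‖x‖ := by
  rcases le_or_gt ‖x‖ (ε / 3) with h | h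
  · rw [nodeBranch_eq_zero hε h]
    simp
  · have hx : 0 < ‖x‖ := by linarith [div_pos hε three_pos]
    rw [nodeBranch, norm_div, div_le_iff₀ hx]
    refine (norm_mul_cutoff_le c _).trans (hc.le.trans ?_)
    rw [sq]
    gcongr

/-- Where the first coordinate dominates it determines the maximum norm, hence the cutoff, and the
equation can be solved for the second coordinate. -/
lemma eq_nodeBranch {v : ℂ × ℂ} (hv : v ∈ nodeModel c ε) (h : ‖v.2‖ ≤ ‖v.1‖) :
    v.2 = nodeBranch c ε v.1 := by
  have hn : ‖v‖ = ‖v.1‖ := by rw [Prod.norm_def, max_eq_left h]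
  by_cases h0 : v.1 = 0
  · rw [h0, norm_zero] at h
    rw [h0, norm_le_zero_iff.1 h, nodeBranch, div_zero]
  · have := hv.2
    rw [hn] at this
    rw [nodeBranch, ← this, mul_div_cancel_left₀ _ h0]

lemma swap_mem_nodeModel {v : ℂ × ℂ} (hv : v ∈ nodeModel c ε) : v.swap ∈ nodeModel c ε := by
  obtain ⟨h1, h2⟩ := hv
  have hn : ‖v.swap‖ = ‖v‖ := by
    rw [Prod.norm_def, Prod.norm_def, max_comm]
    rfl
  refine ⟨hn ▸ h1, ?_⟩
  rw [hn, ← h2, mul_comm]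
  rfl

/-- The two branches meet only at the origin: for norms up to `ε / 3` the equation forces a zero
coordinate, and beyond that the product of two equal norms is too large. -/
lemma eq_zero_of_norm_eq (hε : 0 < ε) (hc : ‖c‖ < (ε / 3) ^ 2) {v : ℂ × ℂ}
    (hv : v ∈ nodeModel c ε) (h : ‖v.2‖ = ‖v.1‖) : v = 0 := by
  have h2 := eq_nodeBranch hv h.le
  have h1 : v.1 = 0 := by
    rcases le_or_gt ‖v.1‖ (ε / 3) with h' | h'
    · rw [nodeBranch_eq_zero hε h'] at h2
      rw [h2, norm_zero] at h
      exact norm_eq_zero.1 h.symm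
    · exfalso
      have h3 := congrArg norm hv.2
      rw [norm_mul, h] at h3
      have h4 := norm_mul_cutoff_le c (‖v‖ / ε)
      have : (ε / 3) ^ 2 < ‖v.1‖ * ‖v.1‖ := by
        rw [sq]
        exact mul_lt_mul'' h' h' (by positivity) (by positivity)
      linarith
  refine Prod.ext h1 ?_
  rw [h1, norm_zero] at h
  exact norm_eq_zero.1 h

lemma nodeBranch_mem (hε : 0 < ε) (hc : ‖c‖ < (ε / 3) ^ 2) {x : ℂ} (hx : ‖x‖ < ε) :
    (x, nodeBranch c ε x) ∈ nodeModel c ε := by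
  have hn : ‖(x, nodeBranch c ε x)‖ = ‖x‖ := by
    rw [Prod.norm_def, max_eq_left (norm_nodeBranch_le hε hc x)]
  refine ⟨hn ▸ hx, ?_⟩
  rw [hn]
  exact mul_nodeBranch x

/-- The contraction of `nodeModel`. -/
def nodeContraction (c : ℂ) (ε : ℝ) (t : ℝ) (v : ℂ × ℂ) : ℂ × ℂ :=
  -- On the model at most one of `a` and `b` is nonzero, since equal norms occur only at the origin.
  -- The formula shrinks the point along its own branch and is continuous where the two cases meet.
  let a : ℂ := if ‖v.2‖ ≤ ‖v.1‖ then v.1 else 0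
  let b : ℂ := if ‖v.1‖ ≤ ‖v.2‖ then v.2 else 0
  (t * a + nodeBranch c ε (t * b), nodeBranch c ε (t * a) + t * b)

lemma nodeContraction_of_le (hε : 0 < ε) (hc : ‖c‖ < (ε / 3) ^ 2) {v : ℂ × ℂ}
    (hv : v ∈ nodeModel c ε) (h : ‖v.2‖ ≤ ‖v.1‖) (t : ℝ) :
    nodeContraction c ε t v = (t * v.1, nodeBranch c ε (t * v.1)) := by
  have h0 : nodeBranch c ε 0 = 0 := nodeBranch_eq_zero hε (by simp; positivity)
  rcases h.lt_or_eq with h' | h'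
  · simp [nodeContraction, h, h'.not_ge, h0]
  · rw [eq_zero_of_norm_eq hε hc hv h']
    simp [nodeContraction, h0]

lemma nodeContraction_swap (t : ℝ) (v : ℂ × ℂ) :
    nodeContraction c ε t v.swap = (nodeContraction c ε t v).swap := by
  simp only [nodeContraction, Prod.fst_swap, Prod.snd_swap, Prod.swap_prod_mk]
  exact Prod.ext (add_comm _ _) (add_comm _ _)

lemma nodeContraction_mem (hε : 0 < ε) (hc : ‖c‖ < (ε / 3) ^ 2) {v : ℂ × ℂ}
    (hv : v ∈ nodeModel c ε) {t : ℝ} (ht : t ∈ Set.Icc (0 : ℝ) 1) :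
    nodeContraction c ε t v ∈ nodeModel c ε := by
  have key : ∀ w ∈ nodeModel c ε, ‖w.2‖ ≤ ‖w.1‖ → nodeContraction c ε t w ∈ nodeModel c ε := by
    intro w hw h
    rw [nodeContraction_of_le hε hc hw h]
    refine nodeBranch_mem hε hc ?_
    rw [norm_mul, Complex.norm_real, Real.norm_of_nonneg ht.1]
    exact (mul_le_of_le_one_left (norm_nonneg _) ht.2).trans_lt
      ((norm_fst_le w).trans_lt hw.1)
  rcases le_total ‖v.2‖ ‖v.1‖ with h | h
  · exact key v hv h
  · have := swap_mem_nodeModel (key v.swap (swap_mem_nodeModel hv) h)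
    rwa [nodeContraction_swap, Prod.swap_swap] at this

lemma nodeContraction_one (hε : 0 < ε) (hc : ‖c‖ < (ε / 3) ^ 2) {v : ℂ × ℂ}
    (hv : v ∈ nodeModel c ε) : nodeContraction c ε 1 v = v := by
  have key : ∀ w ∈ nodeModel c ε, ‖w.2‖ ≤ ‖w.1‖ → nodeContraction c ε 1 w = w := by
    intro w hw h
    rw [nodeContraction_of_le hε hc hw h]
    simp [← eq_nodeBranch hw h]
  rcases le_total ‖v.2‖ ‖v.1‖ with h | h
  · exact key v hv h
  · have := key v.swap (swap_mem_nodeModel hv) h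
    rw [nodeContraction_swap] at this
    exact Prod.swap_injective this

lemma nodeContraction_zero (hε : 0 < ε) (v : ℂ × ℂ) : nodeContraction c ε 0 v = 0 := by
  have h0 : nodeBranch c ε 0 = 0 := nodeBranch_eq_zero hε (by simp; positivity)
  simp [nodeContraction, h0]

lemma continuous_nodeContraction (hε : 0 < ε) (hc : ‖c‖ < (ε / 3) ^ 2) :
    Continuous fun p : ℝ × nodeModel c ε => nodeContraction c ε p.1 p.2 := by
  have h1 : Continuous fun p : ℝ × nodeModel c ε => ‖(p.2 : ℂ × ℂ).1‖ := by fun_prop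
  have h2 : Continuous fun p : ℝ × nodeModel c ε => ‖(p.2 : ℂ × ℂ).2‖ := by fun_prop
  have ha : Continuous fun p : ℝ × nodeModel c ε =>
      if ‖(p.2 : ℂ × ℂ).2‖ ≤ ‖(p.2 : ℂ × ℂ).1‖ then (p.2 : ℂ × ℂ).1 else 0 :=
    Continuous.if_le (by fun_prop) continuous_const h2 h1 fun p hp => by
      rw [eq_zero_of_norm_eq hε hc p.2.2 hp]
      rfl
  have hb : Continuous fun p : ℝ × nodeModel c ε =>
      if ‖(p.2 : ℂ × ℂ).1‖ ≤ ‖(p.2 : ℂ × ℂ).2‖ then (p.2 : ℂ × ℂ).2 else 0 :=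
    Continuous.if_le (by fun_prop) continuous_const h1 h2 fun p hp => by
      rw [eq_zero_of_norm_eq hε hc p.2.2 hp.symm]
      rfl
  have ht : Continuous fun p : ℝ × nodeModel c ε => (p.1 : ℂ) := by fun_prop
  exact ((ht.mul ha).add ((continuous_nodeBranch hε).comp (ht.mul hb))).prodMk
    (((continuous_nodeBranch hε).comp (ht.mul ha)).add (ht.mul hb))

lemma contractibleSpace_nodeModel (hε : 0 < ε) (hc : ‖c‖ < (ε / 3) ^ 2) :
    ContractibleSpace (nodeModel c ε) := by
  rw [contractible_iff_id_nullhomotopic]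
  have h0 : (0 : ℂ × ℂ) ∈ nodeModel c ε := by
    have := nodeBranch_mem hε hc (x := 0) (by simpa using hε)
    rwa [nodeBranch_eq_zero hε (by simp; positivity)] at this
  refine ⟨⟨0, h0⟩, ⟨⟨⟨fun p => ⟨nodeContraction c ε (1 - p.1) p.2,
    nodeContraction_mem hε hc p.2.2 ⟨by linarith [p.1.2.2], by linarith [p.1.2.1]⟩⟩, ?_⟩, ?_, ?_⟩⟩⟩
  · exact Continuous.subtype_mk ((continuous_nodeContraction hε hc).comp
      ((continuous_const.sub (continuous_subtype_val.comp continuous_fst)).prodMk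
        continuous_snd)) _
  · intro v
    refine Subtype.ext ?_
    simp [nodeContraction_one hε hc v.2]
  · intro v
    refine Subtype.ext ?_
    simp [nodeContraction_zero hε]

end

lemma isClosed_chart_preimage [T2Space Y] {Z : Type*} [TopologicalSpace Z]
    (e : OpenPartialHomeomorph Y Z) {K : Set Z} (hK : IsCompact K) (hKe : K ⊆ e.target) :
    IsClosed (e.source ∩ e ⁻¹' K) := by
  rw [← e.symm_image_eq_source_inter_preimage hKe]
  exact (hK.image_of_continuousOn (e.continuousOn_symm.mono hKe)).isClosed

/-- Smoothing a double point lowers the Euler number by one. -/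
lemma euler_node [T2Space Y] (φ : OpenPartialHomeomorph Y (ℂ × ℂ)) {c : ℂ} {ε : ℝ} (hε : 0 < ε)
    (hc0 : c ≠ 0) (hc : ‖c‖ < (ε / 3) ^ 2) (hT : Metric.ball 0 ε ⊆ φ.target) {P Q : Set Y}
    (hP : ∀ q ∈ φ.source, φ q ∈ Metric.ball 0 ε →
      (q ∈ P ↔ (φ q).1 * (φ q).2 = c * (1 - cutoff (‖φ q‖ / ε) : ℝ)))
    (hQ : ∀ q ∈ φ.source, φ q ∈ Metric.ball 0 ε → (q ∈ Q ↔ (φ q).1 * (φ q).2 = c))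
    (hPQ : ∀ q, ¬ (q ∈ φ.source ∧ φ q ∈ Metric.closedBall 0 (2 * ε / 3)) → (q ∈ P ↔ q ∈ Q))
    (hQf : HasFiniteHomology Q) :
    HasFiniteHomology P ∧ eulerNumber P = eulerNumber Q + 1 := by
  have hcpos : 0 < ‖c‖ := norm_pos_iff.2 hc0
  have hcε : ‖c‖ < ε * ε := by nlinarith
  have hcε' : ‖c‖ < ε * (2 * ε / 3) := by nlinarith
  have hcε'' : ‖c‖ < (2 * ε / 3) * (2 * ε / 3) := by nlinarith
  -- On `x * y = c` the condition `‖c‖ / ε < ‖x‖` amounts to `‖y‖ < ε`, so these parts of the conic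
  -- stay in the bidisc.
  have hT' : ∀ r R, R ≤ ε → ‖c‖ / ε ≤ r → conicPart c r R ⊆ Metric.ball 0 ε := by
    rintro r R hR hr ⟨x, y⟩ ⟨h1, h2, h3⟩
    dsimp only at h1 h2 h3
    have hx : 0 < ‖x‖ := by
      have : 0 < ‖c‖ / ε := by positivity
      linarith
    have : ‖x‖ * ‖y‖ = ‖c‖ := by rw [← norm_mul, h1]
    rw [mem_ball_zero_iff, Prod.norm_def, max_lt_iff]
    refine ⟨h3.trans_le hR, ?_⟩
    have h4 : ‖c‖ < ‖x‖ * ε := by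
      rw [← div_lt_iff₀ hε]
      exact hr.trans_lt h2
    rw [← this] at h4
    exact lt_of_mul_lt_mul_left h4 hx.le
  have hmemN : ∀ x y : ℂ, x * y = c → ‖x‖ < ε → ‖y‖ < ε → ‖c‖ / ε < ‖x‖ := by
    intro x y h1 h2 h3
    have : ‖x‖ * ‖y‖ = ‖c‖ := by rw [← norm_mul, h1]
    rw [div_lt_iff₀ hε, ← this]
    have hx : 0 < ‖x‖ := by
      rcases (norm_nonneg x).lt_or_eq with h | h
      · exact h
      · rw [← h, zero_mul] at this
        linarith
    exact mul_lt_mul_of_pos_left h3 hx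
  refine euler_replace (N := φ.source ∩ φ ⁻¹' Metric.ball 0 ε)
    (N' := φ.source ∩ φ ⁻¹' Metric.closedBall 0 (2 * ε / 3))
    (φ.isOpen_inter_preimage Metric.isOpen_ball)
    (isClosed_chart_preimage φ (isCompact_closedBall _ _)
      ((Metric.closedBall_subset_ball (by linarith)).trans hT))
    (Set.inter_subset_inter_right _ (Set.preimage_mono
      (Metric.closedBall_subset_ball (by linarith)))) ?_ ?_ ?_ ?_ hQf
  · ext q
    constructor
    · rintro ⟨h1, h2⟩
      exact ⟨(hPQ q h2).1 h1, h2⟩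
    · rintro ⟨h1, h2⟩
      exact ⟨(hPQ q h2).2 h1, h2⟩
  · have e : P ∩ (φ.source ∩ φ ⁻¹' Metric.ball 0 ε) = φ.source ∩ φ ⁻¹' nodeModel c ε := by
      ext q
      constructor
      · rintro ⟨h1, h2, h3⟩
        exact ⟨h2, mem_ball_zero_iff.1 h3, (hP q h2 h3).1 h1⟩
      · rintro ⟨h2, h3, h4⟩
        have h3' := mem_ball_zero_iff.2 h3
        exact ⟨(hP q h2 h3').2 h4, h2, h3'⟩
    rw [e]
    have := contractibleSpace_nodeModel hε hc
    exact (chartSetHomeomorph φ (S := nodeModel c ε) fun v hv =>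
      hT (mem_ball_zero_iff.2 hv.1)).contractibleSpace
  · have e : Q ∩ (φ.source ∩ φ ⁻¹' Metric.ball 0 ε) =
        φ.source ∩ φ ⁻¹' conicPart c (‖c‖ / ε) ε := by
      ext q
      constructor
      · rintro ⟨h1, h2, h3⟩
        have h4 := (hQ q h2 h3).1 h1
        have h5 := mem_ball_zero_iff.1 h3
        exact ⟨h2, h4, hmemN _ _ h4 ((norm_fst_le _).trans_lt h5) ((norm_snd_le _).trans_lt h5),
          (norm_fst_le _).trans_lt h5⟩
      · rintro ⟨h2, h3⟩
        have h4 := hT' _ _ le_rfl le_rfl h3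
        exact ⟨(hQ q h2 h4).2 h3.1, h2, h4⟩
    rw [e]
    exact euler_conicPart φ (by positivity) (by rwa [div_lt_iff₀ hε])
      ((hT' _ _ le_rfl le_rfl).trans hT)
  -- The overlap splits into two annuli according to which coordinate has norm above `2 * ε / 3`.
  -- Both cannot, because `‖c‖ < (2 * ε / 3) ^ 2`.
  · set O := (Q ∩ (φ.source ∩ φ ⁻¹' Metric.ball 0 ε)) ∩
      (Q ∩ (φ.source ∩ φ ⁻¹' Metric.closedBall 0 (2 * ε / 3))ᶜ) with hO
    have hmemO : ∀ q, q ∈ O ↔ q ∈ φ.source ∧ (φ q).1 * (φ q).2 = c ∧ ‖φ q‖ < ε ∧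
        2 * ε / 3 < ‖φ q‖ := by
      intro q
      constructor
      · rintro ⟨⟨h1, h2, h3⟩, -, h4⟩
        refine ⟨h2, (hQ q h2 h3).1 h1, mem_ball_zero_iff.1 h3, ?_⟩
        by_contra! h5
        exact h4 ⟨h2, mem_closedBall_zero_iff.2 h5⟩
      · rintro ⟨h1, h2, h3, h4⟩
        have h3' := mem_ball_zero_iff.2 h3
        have h5 := (hQ q h1 h3').2 h2
        exact ⟨⟨h5, h1, h3'⟩, h5, fun h => h4.not_ge (mem_closedBall_zero_iff.1 h.2)⟩
    have hU : IsOpen (φ.source ∩ φ ⁻¹' {v | 2 * ε / 3 < ‖v.1‖}) :=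
      φ.isOpen_inter_preimage (isOpen_lt continuous_const (by fun_prop))
    have hV : IsOpen (φ.source ∩ φ ⁻¹' {v | 2 * ε / 3 < ‖v.2‖}) :=
      φ.isOpen_inter_preimage (isOpen_lt continuous_const (by fun_prop))
    have hOU : O ∩ (φ.source ∩ φ ⁻¹' {v | 2 * ε / 3 < ‖v.1‖}) =
        φ.source ∩ φ ⁻¹' conicPart c (2 * ε / 3) ε := by
      ext q
      constructor
      · rintro ⟨h1, h2, h3⟩
        obtain ⟨-, h4, h5, -⟩ := (hmemO q).1 h1
        exact ⟨h2, h4, h3, (norm_fst_le _).trans_lt h5⟩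
      · rintro ⟨h1, h2⟩
        have h4 := mem_ball_zero_iff.1 (hT' _ _ le_rfl
          (by rw [div_le_iff₀ hε, mul_comm]; exact hcε'.le) h2)
        exact ⟨(hmemO q).2 ⟨h1, h2.1, h4, h2.2.1.trans_le (norm_fst_le _)⟩, h1, h2.2.1⟩
    have hlt : ‖c‖ / (2 * ε / 3) < 2 * ε / 3 := by rwa [div_lt_iff₀ (by positivity)]
    have hOV : O ∩ (φ.source ∩ φ ⁻¹' {v | 2 * ε / 3 < ‖v.2‖}) =
        φ.source ∩ φ ⁻¹' conicPart c (‖c‖ / ε) (‖c‖ / (2 * ε / 3)) := by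
      ext q
      constructor
      · rintro ⟨h1, h2, h3⟩
        obtain ⟨-, h4, h5, -⟩ := (hmemO q).1 h1
        have h6 := hmemN _ _ h4 ((norm_fst_le _).trans_lt h5) ((norm_snd_le _).trans_lt h5)
        refine ⟨h2, h4, h6, ?_⟩
        rw [lt_div_iff₀ (by positivity), ← h4, norm_mul]
        exact mul_lt_mul_of_pos_left h3 (lt_trans (by positivity) h6)
      · rintro ⟨h1, h2⟩
        have h4 := mem_ball_zero_iff.1 (hT' _ _ (by linarith) le_rfl h2)
        have h5 : 2 * ε / 3 < ‖(φ q).2‖ := by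
          have h6 := h2.2.2
          rw [lt_div_iff₀ (by positivity), ← h2.1, norm_mul] at h6
          exact lt_of_mul_lt_mul_left h6 (norm_nonneg _)
        exact ⟨(hmemO q).2 ⟨h1, h2.1, h4, h5.trans_le (norm_snd_le _)⟩, h1, h5⟩
    have eU := euler_conicPart φ (c := c) (r := 2 * ε / 3) (R := ε) (by positivity) (by linarith)
      ((hT' _ _ le_rfl (by rw [div_le_iff₀ hε, mul_comm]; exact hcε'.le)).trans hT)
    have eV := euler_conicPart φ (c := c) (r := ‖c‖ / ε) (R := ‖c‖ / (2 * ε / 3)) (by positivity)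
      (div_lt_div_of_pos_left hcpos (by positivity) (by linarith))
      ((hT' _ _ (by linarith) le_rfl).trans hT)
    rw [← hOU] at eU
    rw [← hOV] at eV
    obtain ⟨h1, h2⟩ := euler_disjoint_union (P := O) hU hV (by
        intro q hq
        obtain ⟨h4, -, -, h5⟩ := (hmemO q).1 hq
        rw [Prod.norm_def, lt_max_iff] at h5
        exact h5.imp (fun h => ⟨h4, h⟩) (fun h => ⟨h4, h⟩)) (by
        intro q hq h1 h2
        obtain ⟨-, h4, -⟩ := (hmemO q).1 hq
        have h5 : ‖(φ q).1‖ * ‖(φ q).2‖ = ‖c‖ := by rw [← norm_mul, h4]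
        have h6 : 2 * ε / 3 * (2 * ε / 3) < ‖(φ q).1‖ * ‖(φ q).2‖ :=
          mul_lt_mul'' h1.2 h2.2 (by positivity) (by positivity)
        linarith) eU.1 eV.1
    exact ⟨h1, by rw [h2, eU.2, eV.2, add_zero]⟩

end SurfaceFibration

end

section

/-! ### Moving a fibre through a tube -/

open Filter Topology

/-- The map `g` is Lipschitz on a neighbourhood of `x`. -/
def LipschitzNear {E F : Type*} [PseudoEMetricSpace E] [PseudoEMetricSpace F] (g : E → F) (x : E) :
    Prop :=
  ∃ K, ∃ t ∈ 𝓝 x, LipschitzOnWith K g t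

namespace LipschitzNear

variable {E F G : Type*} [PseudoEMetricSpace E] [PseudoEMetricSpace F] [PseudoEMetricSpace G]

lemma continuousAt {f : E → F} {x : E} (hf : LipschitzNear f x) : ContinuousAt f x := by
  obtain ⟨K, t, ht, h⟩ := hf
  exact h.continuousOn.continuousAt ht

lemma comp {g : F → G} {f : E → F} {x : E} (hg : LipschitzNear g (f x)) (hf : LipschitzNear f x) :
    LipschitzNear (g ∘ f) x := by
  have hc := hf.continuousAt
  obtain ⟨K, t, ht, h⟩ := hf
  obtain ⟨K', t', ht', h'⟩ := hg
  exact ⟨K' * K, t ∩ f ⁻¹' t', inter_mem ht (hc ht'),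
    h'.comp (h.mono Set.inter_subset_left) fun y hy => hy.2⟩

lemma congr {f g : E → F} {x : E} (hf : LipschitzNear f x) (h : f =ᶠ[𝓝 x] g) :
    LipschitzNear g x := by
  obtain ⟨K, t, ht, hK⟩ := hf
  refine ⟨K, t ∩ {y | f y = g y}, inter_mem ht h, ?_⟩
  intro a ha b hb
  rw [← show f a = g a from ha.2, ← show f b = g b from hb.2]
  exact hK ha.1 hb.1

lemma _root_.LipschitzWith.lipschitzNear {f : E → F} {K} (hf : LipschitzWith K f) (x : E) :
    LipschitzNear f x :=
  ⟨K, Set.univ, univ_mem, hf.lipschitzOnWith⟩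

lemma add {f g : E → ℝ} {x : E} (hf : LipschitzNear f x) (hg : LipschitzNear g x) :
    LipschitzNear (fun y => f y + g y) x := by
  obtain ⟨K, t, ht, h⟩ := hf
  obtain ⟨K', t', ht', h'⟩ := hg
  exact ⟨K + K', t ∩ t', inter_mem ht ht',
    (h.mono Set.inter_subset_left).add (h'.mono Set.inter_subset_right)⟩

lemma min {f g : E → ℝ} {x : E} (hf : LipschitzNear f x) (hg : LipschitzNear g x) :
    LipschitzNear (fun y => Min.min (f y) (g y)) x := by
  obtain ⟨K, t, ht, h⟩ := hf
  obtain ⟨K', t', ht', h'⟩ := hg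
  refine ⟨Max.max 1 1 * Max.max K K', t ∩ t', inter_mem ht ht', ?_⟩
  have h3 : LipschitzOnWith (Max.max K K') (fun y => (f y, g y)) (t ∩ t') :=
    (h.mono Set.inter_subset_left).prodMk (h'.mono Set.inter_subset_right)
  have h4 : LipschitzWith (Max.max 1 1) (fun p : ℝ × ℝ => Min.min p.1 p.2) :=
    LipschitzWith.prod_fst.min LipschitzWith.prod_snd
  exact h4.comp_lipschitzOnWith h3

end LipschitzNear

namespace SurfaceFibration

variable {X : Type u} [TopologicalSpace X]

/-- All transition maps of a family of charts are locally Lipschitz. -/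
def LipschitzCompatible (𝒞 : Set (OpenPartialHomeomorph X (ℂ × ℂ))) : Prop :=
  ∀ ψ ∈ 𝒞, ∀ ψ' ∈ 𝒞, ∀ q ∈ ψ.source, q ∈ ψ'.source → LipschitzNear (ψ' ∘ ψ.symm) (ψ q)

/-- The function `σ` is locally Lipschitz in a family of charts. -/
def ChartLipschitz (𝒞 : Set (OpenPartialHomeomorph X (ℂ × ℂ))) (σ : X → ℝ) : Prop :=
  ∀ ψ ∈ 𝒞, ∀ q ∈ ψ.source, LipschitzNear (σ ∘ ψ.symm) (ψ q)

namespace ChartLipschitz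

variable {𝒞 : Set (OpenPartialHomeomorph X (ℂ × ℂ))} {σ τ : X → ℝ}

lemma const (a : ℝ) : ChartLipschitz 𝒞 fun _ => a :=
  fun _ _ _ _ => (LipschitzWith.const a).lipschitzNear _

lemma add (hσ : ChartLipschitz 𝒞 σ) (hτ : ChartLipschitz 𝒞 τ) :
    ChartLipschitz 𝒞 fun q => σ q + τ q :=
  fun ψ hψ q hq => (hσ ψ hψ q hq).add (hτ ψ hψ q hq)

lemma min (hσ : ChartLipschitz 𝒞 σ) (hτ : ChartLipschitz 𝒞 τ) :
    ChartLipschitz 𝒞 fun q => Min.min (σ q) (τ q) :=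
  fun ψ hψ q hq => (hσ ψ hψ q hq).min (hτ ψ hψ q hq)

lemma comp {g : ℝ → ℝ} {K} (hg : LipschitzWith K g) (hσ : ChartLipschitz 𝒞 σ) :
    ChartLipschitz 𝒞 fun q => g (σ q) :=
  fun ψ hψ q hq => (hg.lipschitzNear _).comp (hσ ψ hψ q hq)

lemma sum {ι : Type*} (t : Finset ι) {f : ι → X → ℝ} (hf : ∀ i ∈ t, ChartLipschitz 𝒞 (f i)) :
    ChartLipschitz 𝒞 fun q => ∑ i ∈ t, f i q := by
  classical
  induction t using Finset.induction_on with
  | empty => simpa using const 0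
  | insert a t ha ih =>
    simp only [Finset.sum_insert ha]
    exact (hf a (Finset.mem_insert_self a t)).add
      (ih fun i hi => hf i (Finset.mem_insert_of_mem hi))

end ChartLipschitz

open Classical in
/-- A bump function around the point with coordinates `a` in a chart. -/
def bump (ψ : OpenPartialHomeomorph X (ℂ × ℂ)) (a : ℂ × ℂ) (r : ℝ) (q : X) : ℝ :=
  if q ∈ ψ.source then cutoff (‖ψ q - a‖ / r) else 0

section

variable {ψ : OpenPartialHomeomorph X (ℂ × ℂ)} {a : ℂ × ℂ} {r : ℝ}

lemma bump_of_mem {q : X} (hq : q ∈ ψ.source) : bump ψ a r q = cutoff (‖ψ q - a‖ / r) :=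
  if_pos hq

lemma bump_nonneg (q : X) : 0 ≤ bump ψ a r q := by
  unfold bump
  split_ifs
  exacts [cutoff_nonneg _, le_rfl]

/-- The closed support of a bump function. -/
def bumpSupport (ψ : OpenPartialHomeomorph X (ℂ × ℂ)) (a : ℂ × ℂ) (r : ℝ) : Set X :=
  ψ.source ∩ ψ ⁻¹' Metric.closedBall a (2 * r / 3)

lemma bump_eq_zero (hr : 0 < r) {q : X} (hq : q ∉ bumpSupport ψ a r) : bump ψ a r q = 0 := by
  unfold bump
  split_ifs with h
  · refine cutoff_eq_zero ?_
    have : ¬ ‖ψ q - a‖ ≤ 2 * r / 3 := fun h' => hq ⟨h, mem_closedBall_iff_norm.2 h'⟩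
    rw [le_div_iff₀ hr]
    linarith
  · rfl

lemma bump_eq_one (hr : 0 < r) {q : X} (hq : q ∈ ψ.source)
    (h : ψ q ∈ Metric.closedBall a (r / 3)) : bump ψ a r q = 1 := by
  rw [bump_of_mem hq, cutoff_eq_one]
  rw [mem_closedBall_iff_norm] at h
  rw [div_le_iff₀ hr]
  linarith

lemma isClosed_bumpSupport [T2Space X] (hr : 0 < r) (hT : Metric.ball a r ⊆ ψ.target) :
    IsClosed (bumpSupport ψ a r) :=
  isClosed_chart_preimage ψ (isCompact_closedBall _ _)
    ((Metric.closedBall_subset_ball (by linarith)).trans hT)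

lemma lipschitzWith_bump_model (a : ℂ × ℂ) (r : ℝ) :
    ∃ K, LipschitzWith K fun v : ℂ × ℂ => cutoff (‖v - a‖ / r) := by
  refine ⟨3 * (‖r⁻¹‖₊ * (1 * (1 + 0))), lipschitzWith_cutoff.comp ?_⟩
  have h1 : LipschitzWith (1 * (1 + 0)) fun v : ℂ × ℂ => ‖v - a‖ :=
    lipschitzWith_one_norm.comp (LipschitzWith.id.sub (LipschitzWith.const a))
  have h2 : LipschitzWith ‖r⁻¹‖₊ fun x : ℝ => x / r := by
    simpa [div_eq_mul_inv, mul_comm] using lipschitzWith_smul (β := ℝ) r⁻¹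
  exact h2.comp h1

lemma continuous_bump [T2Space X] (hr : 0 < r) (hT : Metric.ball a r ⊆ ψ.target) :
    Continuous (bump ψ a r) := by
  rw [continuous_iff_continuousAt]
  intro q
  by_cases hq : q ∈ bumpSupport ψ a r
  · obtain ⟨K, hK⟩ := lipschitzWith_bump_model a r
    refine ContinuousAt.congr (hK.continuous.continuousAt.comp (ψ.continuousAt hq.1)) ?_
    filter_upwards [ψ.open_source.mem_nhds hq.1] with p hp
    exact (bump_of_mem hp).symm
  · refine ContinuousAt.congr (f := fun _ => (0 : ℝ)) continuousAt_const ?_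
    filter_upwards [(isClosed_bumpSupport hr hT).isOpen_compl.mem_nhds hq] with p hp
    exact (bump_eq_zero hr hp).symm

lemma chartLipschitz_bump [T2Space X] {𝒞 : Set (OpenPartialHomeomorph X (ℂ × ℂ))}
    (h𝒞 : LipschitzCompatible 𝒞) (hψ : ψ ∈ 𝒞) (hr : 0 < r) (hT : Metric.ball a r ⊆ ψ.target) :
    ChartLipschitz 𝒞 (bump ψ a r) := by
  intro φ hφ q hq
  have hφc : Tendsto φ.symm (𝓝 (φ q)) (𝓝 q) := by
    have := φ.symm.continuousAt (φ.map_source hq)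
    rwa [ContinuousAt, φ.left_inv hq] at this
  by_cases hqs : q ∈ bumpSupport ψ a r
  · obtain ⟨K, hK⟩ := lipschitzWith_bump_model a r
    refine ((hK.lipschitzNear _).comp (h𝒞 φ hφ ψ hψ q hq hqs.1)).congr ?_
    filter_upwards [hφc (ψ.open_source.mem_nhds hqs.1)] with v hv
    exact (bump_of_mem hv).symm
  · refine LipschitzNear.congr (f := fun _ => (0 : ℝ))
      ((LipschitzWith.const (0 : ℝ)).lipschitzNear _) ?_
    filter_upwards [hφc ((isClosed_bumpSupport hr hT).isOpen_compl.mem_nhds hqs)] with v hv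
    exact (bump_eq_zero hr hv).symm

end

/-- Fixed points of a family of contractions of the unit interval. -/
lemma exists_continuous_fixedPoint {Z : Type*} [TopologicalSpace Z] {Ω : Set Z} (g : ℝ → Z → ℝ)
    (h01 : ∀ u ∈ Set.Icc (0 : ℝ) 1, ∀ z ∈ Ω, g u z ∈ Set.Icc (0 : ℝ) 1)
    (hc : ∀ u ∈ Set.Icc (0 : ℝ) 1, ContinuousOn (g u) Ω)
    (hl : ∀ z ∈ Ω, ∀ u ∈ Set.Icc (0 : ℝ) 1, ∀ v ∈ Set.Icc (0 : ℝ) 1,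
      |g u z - g v z| ≤ |u - v| / 2) :
    ∃ U : Z → ℝ, ContinuousOn U Ω ∧ ∀ z ∈ Ω, U z ∈ Set.Icc (0 : ℝ) 1 ∧ g (U z) z = U z ∧
      ∀ u ∈ Set.Icc (0 : ℝ) 1, g u z = u → u = U z := by
  have huniq : ∀ z ∈ Ω, ∀ u ∈ Set.Icc (0 : ℝ) 1, ∀ v ∈ Set.Icc (0 : ℝ) 1,
      g u z = u → g v z = v → u = v := by
    intro z hz u hu v hv h1 h2
    have h := hl z hz u hu v hv
    rw [h1, h2] at h
    have : |u - v| = 0 := le_antisymm (by linarith) (abs_nonneg _)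
    linarith [abs_eq_zero.1 this]
  have hex : ∀ z ∈ Ω, ∃ u ∈ Set.Icc (0 : ℝ) 1, g u z = u := by
    intro z hz
    have hcu : ContinuousOn (fun u => u - g u z) (Set.Icc 0 1) := by
      refine continuousOn_id.sub ?_
      have : LipschitzOnWith 1 (fun u => g u z) (Set.Icc 0 1) :=
        LipschitzOnWith.of_dist_le_mul fun u hu v hv => by
          rw [Real.dist_eq, Real.dist_eq, NNReal.coe_one, one_mul]
          exact (hl z hz u hu v hv).trans (by linarith [abs_nonneg (u - v)])
      exact this.continuousOn
    have h0 := h01 0 ⟨le_rfl, zero_le_one⟩ z hz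
    have h1 := h01 1 ⟨zero_le_one, le_rfl⟩ z hz
    obtain ⟨u, hu, h⟩ := intermediate_value_Icc (zero_le_one (α := ℝ)) hcu
      (show (0 : ℝ) ∈ Set.Icc _ _ from ⟨by linarith [h0.1], by linarith [h1.2]⟩)
    exact ⟨u, hu, by simp only at h; linarith⟩
  choose! U hU hgU using hex
  refine ⟨U, fun z hz => ?_, fun z hz => ⟨hU z hz, hgU z hz, fun u hu h =>
    huniq z hz u hu _ (hU z hz) h (hgU z hz)⟩⟩
  have hcz := hc (U z) (hU z hz) z hz
  rw [ContinuousWithinAt, tendsto_iff_dist_tendsto_zero] at hcz ⊢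
  refine squeeze_zero' (Eventually.of_forall fun _ => dist_nonneg)
    (g := fun w => 2 * dist (g (U z) w) (g (U z) z)) ?_ (by simpa using hcz.const_mul 2)
  filter_upwards [self_mem_nhdsWithin] with w hw
  -- The contraction absorbs half of the distance between the fixed points, so that distance is at
  -- most twice the variation of `g (U z)`, which is continuous.
  have h1 := hl w hw (U w) (hU w hw) (U z) (hU z hz)
  have h2 := abs_sub_le (g (U w) w) (g (U z) w) (g (U z) z)
  rw [hgU w hw, hgU z hz] at h2
  rw [hgU w hw] at h1
  rw [Real.dist_eq, Real.dist_eq, hgU z hz]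
  linarith

/-- The locus `F = c σ`. -/
def hybrid (W : Set X) (F : X → ℂ) (c : ℂ) (σ : X → ℝ) : Set X := {q | q ∈ W ∧ F q = c * σ q}

section Slide

variable {W : Set X} {F : X → ℂ} {c : ℂ} {ψ : OpenPartialHomeomorph X (ℂ × ℂ)} {Ω : Set ℂ}

open Classical in
/-- Replace the first coordinate by a prescribed multiple of `c`, over the part of the chart whose
second coordinate lies in `Ω`. -/
def slide (c : ℂ) (ψ : OpenPartialHomeomorph X (ℂ × ℂ)) (Ω : Set ℂ) (U : ℂ → ℝ) (q : X) : X :=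
  if q ∈ ψ.source ∧ (ψ q).2 ∈ Ω then ψ.symm (c * U (ψ q).2, (ψ q).2) else q

/-- The function `σ` determines `U` on `Ω` by the equation `U z = σ (c U z, z)`. -/
def IsSlideFor (c : ℂ) (ψ : OpenPartialHomeomorph X (ℂ × ℂ)) (Ω : Set ℂ) (σ : X → ℝ) (U : ℂ → ℝ) :
    Prop :=
  ContinuousOn U Ω ∧ ∀ z ∈ Ω, U z ∈ Set.Icc (0 : ℝ) 1 ∧ σ (ψ.symm (c * U z, z)) = U z ∧
    ∀ u ∈ Set.Icc (0 : ℝ) 1, σ (ψ.symm (c * u, z)) = u → u = U z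

variable (hW : ψ.source ⊆ W) (hF : ∀ q ∈ ψ.source, (ψ q).1 = F q)
  (hT : ∀ u ∈ Set.Icc (0 : ℝ) 1, ∀ z ∈ Ω, (c * u, z) ∈ ψ.target)
  {A : Set X} (hAΩ : ∀ q ∈ A, q ∈ ψ.source ∧ (ψ q).2 ∈ Ω)
  {σ σ' : X → ℝ} {U U' : ℂ → ℝ} (h01 : ∀ q, σ q ∈ Set.Icc (0 : ℝ) 1)
  (hσσ' : ∀ q ∉ A, σ q = σ' q)

include hT in
lemma exists_isSlideFor (h01 : ∀ q, σ q ∈ Set.Icc (0 : ℝ) 1) (hσ : Continuous σ)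
    (hl : ∀ z ∈ Ω, ∀ u ∈ Set.Icc (0 : ℝ) 1, ∀ v ∈ Set.Icc (0 : ℝ) 1,
      |σ (ψ.symm (c * u, z)) - σ (ψ.symm (c * v, z))| ≤ |u - v| / 2) :
    ∃ U, IsSlideFor c ψ Ω σ U := by
  refine exists_continuous_fixedPoint (fun u z => σ (ψ.symm (c * u, z)))
    (fun u _ z _ => h01 _) (fun u hu => ?_) hl
  refine hσ.comp_continuousOn (ψ.continuousOn_symm.comp (by fun_prop) fun z hz => hT u hu z hz)

include hF in
/-- On the locus `F = c σ` the first coordinate is determined by the second. -/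
lemma eq_of_mem_hybrid (h01 : ∀ q, σ q ∈ Set.Icc (0 : ℝ) 1) (hU : IsSlideFor c ψ Ω σ U) {q : X}
    (hq : F q = c * σ q) (hqψ : q ∈ ψ.source) (hqΩ : (ψ q).2 ∈ Ω) :
    ψ.symm (c * U (ψ q).2, (ψ q).2) = q := by
  have h1 : ((c * σ q, (ψ q).2) : ℂ × ℂ) = ψ q := Prod.ext (by rw [hF q hqψ, hq]) rfl
  have h2 : ψ.symm (c * σ q, (ψ q).2) = q := by rw [h1, ψ.left_inv hqψ]
  rw [← (hU.2 _ hqΩ).2.2 (σ q) (h01 q) (by rw [h2]), h2]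

include hW hF hT hAΩ hσσ' in
lemma slide_mem (hU' : IsSlideFor c ψ Ω σ' U') {q : X} (hq : q ∈ hybrid W F c σ) :
    slide c ψ Ω U' q ∈ hybrid W F c σ' := by
  unfold slide
  split_ifs with h
  · have hz := hU'.2 _ h.2
    have ht := hT _ hz.1 _ h.2
    refine ⟨hW (ψ.map_target ht), ?_⟩
    rw [← hF _ (ψ.map_target ht), ψ.right_inv ht, hz.2.1]
  · refine ⟨hq.1, ?_⟩
    rw [hq.2, hσσ' q fun hA => h (hAΩ q hA)]

include hF hT h01 in
-- Sliding keeps the second coordinate, and on the locus `F = c σ` the second coordinate determines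
-- the first; so sliding back recovers the point.
lemma slide_slide (hU : IsSlideFor c ψ Ω σ U) (hU' : IsSlideFor c ψ Ω σ' U') {q : X}
    (hq : q ∈ hybrid W F c σ) : slide c ψ Ω U (slide c ψ Ω U' q) = q := by
  by_cases h : q ∈ ψ.source ∧ (ψ q).2 ∈ Ω
  · have ht := hT _ (hU'.2 _ h.2).1 _ h.2
    have h1 : slide c ψ Ω U' q = ψ.symm (c * U' (ψ q).2, (ψ q).2) := if_pos h
    have h2 : ψ (slide c ψ Ω U' q) = (c * U' (ψ q).2, (ψ q).2) := by rw [h1, ψ.right_inv ht]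
    have h3 : slide c ψ Ω U' q ∈ ψ.source := h1 ▸ ψ.map_target ht
    rw [slide, if_pos ⟨h3, by rw [h2]; exact h.2⟩, h2]
    exact eq_of_mem_hybrid hF h01 hU hq.2 h.1 h.2
  · rw [slide, slide, if_neg h, if_neg h]

include hF hT hAΩ hσσ' in
-- Near a point of `A` the slide is given by the chart formula. On the part of the locus off the
-- closed set `A` it is the identity, because `σ = σ'` there and fixed points are unique. These two
-- open conditions cover the locus, so the boundary of the chart region causes no trouble.
lemma continuousOn_slide (hA : IsClosed A) (hΩ : IsOpen Ω) (h01' : ∀ q, σ' q ∈ Set.Icc (0 : ℝ) 1)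
    (hU' : IsSlideFor c ψ Ω σ' U') : ContinuousOn (slide c ψ Ω U') (hybrid W F c σ) := by
  intro q hq
  by_cases hqA : q ∈ A
  · obtain ⟨h1, h2⟩ := hAΩ q hqA
    have hO : ψ.source ∩ ψ ⁻¹' {v | v.2 ∈ Ω} ∈ 𝓝 q :=
      (ψ.isOpen_inter_preimage (hΩ.preimage continuous_snd)).mem_nhds ⟨h1, h2⟩
    have hz : ContinuousAt (fun q => (ψ q).2) q := continuousAt_snd.comp (ψ.continuousAt h1)
    have hcU : ContinuousAt (fun q => U' (ψ q).2) q :=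
      ContinuousAt.comp (f := fun q => (ψ q).2) (hU'.1.continuousAt (hΩ.mem_nhds h2)) hz
    have hp : ContinuousAt (fun q => (((c * U' (ψ q).2 : ℂ), (ψ q).2) : ℂ × ℂ)) q :=
      (continuousAt_const.mul (Complex.continuous_ofReal.continuousAt.comp hcU)).prodMk hz
    have ht := hT _ (hU'.2 _ h2).1 _ h2
    have : ContinuousAt (fun q => ψ.symm (c * U' (ψ q).2, (ψ q).2)) q :=
      ContinuousAt.comp (f := fun q => (((c * U' (ψ q).2 : ℂ), (ψ q).2) : ℂ × ℂ))
        (ψ.symm.continuousAt ht) hp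
    refine (this.congr ?_).continuousWithinAt
    filter_upwards [hO] with p hp
    exact (if_pos hp).symm
  · have hid : ∀ p ∈ hybrid W F c σ, p ∉ A → slide c ψ Ω U' p = p := by
      intro p hp hpA
      unfold slide
      split_ifs with h
      · exact eq_of_mem_hybrid hF h01' hU' (by rw [hp.2, hσσ' p hpA]) h.1 h.2
      · rfl
    refine ContinuousWithinAt.congr_of_eventuallyEq continuousWithinAt_id ?_ (hid q hq hqA)
    filter_upwards [self_mem_nhdsWithin, mem_nhdsWithin_of_mem_nhds
      (hA.isOpen_compl.mem_nhds hqA)] with p hp hpA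
    exact hid p hp hpA

include hW hF hT hAΩ h01 hσσ' in
/-- Changing `σ` within a chart does not change the homeomorphism type of `F = c σ`. -/
lemma nonempty_homeomorph_hybrid (hA : IsClosed A) (hΩ : IsOpen Ω)
    (h01' : ∀ q, σ' q ∈ Set.Icc (0 : ℝ) 1) (hσ : Continuous σ) (hσ' : Continuous σ')
    (hl : ∀ z ∈ Ω, ∀ u ∈ Set.Icc (0 : ℝ) 1, ∀ v ∈ Set.Icc (0 : ℝ) 1,
      |σ (ψ.symm (c * u, z)) - σ (ψ.symm (c * v, z))| ≤ |u - v| / 2)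
    (hl' : ∀ z ∈ Ω, ∀ u ∈ Set.Icc (0 : ℝ) 1, ∀ v ∈ Set.Icc (0 : ℝ) 1,
      |σ' (ψ.symm (c * u, z)) - σ' (ψ.symm (c * v, z))| ≤ |u - v| / 2) :
    Nonempty (hybrid W F c σ ≃ₜ hybrid W F c σ') := by
  obtain ⟨U, hU⟩ := exists_isSlideFor hT h01 hσ hl
  obtain ⟨U', hU'⟩ := exists_isSlideFor hT h01' hσ' hl'
  have hσ'σ : ∀ q ∉ A, σ' q = σ q := fun q hq => (hσσ' q hq).symm
  exact ⟨{
    toFun q := ⟨slide c ψ Ω U' q, slide_mem hW hF hT hAΩ hσσ' hU' q.2⟩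
    invFun q := ⟨slide c ψ Ω U q, slide_mem hW hF hT hAΩ hσ'σ hU q.2⟩
    left_inv q := Subtype.ext (slide_slide hF hT h01 hU hU' q.2)
    right_inv q := Subtype.ext (slide_slide hF hT h01' hU' hU q.2)
    continuous_toFun := Continuous.subtype_mk
      (continuousOn_slide hF hT hAΩ hσσ' hA hΩ h01' hU').domRestrict _
    continuous_invFun := Continuous.subtype_mk
      (continuousOn_slide hF hT hAΩ hσ'σ hA hΩ h01 hU).domRestrict _ }⟩

end Slide

/-- For small `c` a locally Lipschitz function is a contraction along the `c` direction. -/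
lemma eventually_contraction {𝒞 : Set (OpenPartialHomeomorph X (ℂ × ℂ))} {σ : X → ℝ}
    (hσ : ChartLipschitz 𝒞 σ) {ψ : OpenPartialHomeomorph X (ℂ × ℂ)} (hψ : ψ ∈ 𝒞) {K : Set ℂ}
    (hK : IsCompact K) (hKT : ∀ z ∈ K, ((0 : ℂ), z) ∈ ψ.target) :
    ∀ᶠ c : ℂ in 𝓝 0, ∀ z ∈ K, ∀ u ∈ Set.Icc (0 : ℝ) 1, ∀ v ∈ Set.Icc (0 : ℝ) 1,
      |σ (ψ.symm (c * u, z)) - σ (ψ.symm (c * v, z))| ≤ |u - v| / 2 := by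
  refine hK.eventually_forall_of_forall_eventually fun z hz => ?_
  have h := hσ ψ hψ _ (ψ.map_target (hKT z hz))
  rw [ψ.right_inv (hKT z hz)] at h
  obtain ⟨L, t, ht, hL⟩ := h
  obtain ⟨δ, hδ, hball⟩ := Metric.mem_nhds_iff.1 ht
  have h1 : ∀ᶠ p : ℂ × ℂ in 𝓝 ((0 : ℂ), z), p ∈ Metric.ball ((0 : ℂ), z) δ :=
    Metric.ball_mem_nhds _ hδ
  -- The points `(c u, z)` and `(c v, z)` are at distance `‖c‖ |u - v|`, so the Lipschitz constant
  -- in `u` is `L ‖c‖`, small for small `c`.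
  have h2 : ∀ᶠ p : ℂ × ℂ in 𝓝 ((0 : ℂ), z), L * ‖p.1‖ < 1 / 2 := by
    have : ContinuousAt (fun p : ℂ × ℂ => (L : ℝ) * ‖p.1‖) ((0 : ℂ), z) := by fun_prop
    exact this.eventually_lt continuousAt_const (by simp)
  filter_upwards [h1, h2] with p hp1 hp2 u hu v hv
  have hmem : ∀ w ∈ Set.Icc (0 : ℝ) 1, ((p.1 * w, p.2) : ℂ × ℂ) ∈ t := by
    intro w hw
    apply hball
    rw [← ball_prod_same] at hp1 ⊢
    refine ⟨?_, hp1.2⟩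
    have := mem_ball_zero_iff.1 hp1.1
    refine mem_ball_zero_iff.2 (lt_of_le_of_lt ?_ this)
    rw [norm_mul, Complex.norm_real, Real.norm_of_nonneg hw.1]
    exact mul_le_of_le_one_right (norm_nonneg _) hw.2
  have h3 := hL.dist_le_mul _ (hmem u hu) _ (hmem v hv)
  rw [Real.dist_eq] at h3
  refine h3.trans ?_
  have h4 : dist ((p.1 * u, p.2) : ℂ × ℂ) (p.1 * v, p.2) = ‖p.1‖ * |u - v| := by
    rw [Prod.dist_eq, dist_self, max_eq_left dist_nonneg, dist_eq_norm, ← mul_sub, norm_mul,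
      ← Complex.ofReal_sub, Complex.norm_real, Real.norm_eq_abs]
  rw [h4, ← mul_assoc]
  nlinarith [abs_nonneg (u - v)]

end SurfaceFibration

end

/-! ### The Euler number of a fibre with finitely many double points -/

section

namespace SurfaceFibration

open Filter Topology

/-- The function `1 - ∑ χ`, cut off below at zero. -/
def complementSum {X ι : Type*} (T : Finset ι) (χ : ι → X → ℝ) (q : X) : ℝ :=
  max 0 (1 - ∑ p ∈ T, χ p q)

lemma complementSum_mem {X ι : Type*} {T : Finset ι} {χ : ι → X → ℝ} (hχ : ∀ p q, 0 ≤ χ p q) (q : X) :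
    complementSum T χ q ∈ Set.Icc (0 : ℝ) 1 :=
  ⟨le_max_left _ _, max_le zero_le_one (by linarith [Finset.sum_nonneg fun p (_ : p ∈ T) => hχ p q])⟩

variable {X : Type u} [TopologicalSpace X]

section

variable {ι : Type*} {T : Finset ι} {χ : ι → X → ℝ}

lemma continuous_complementSum (hχ : ∀ p, Continuous (χ p)) : Continuous (complementSum T χ) := by
  unfold complementSum
  fun_prop

lemma chartLipschitz_complementSum {𝒞 : Set (OpenPartialHomeomorph X (ℂ × ℂ))}
    (hχ : ∀ p, ChartLipschitz 𝒞 (χ p)) : ChartLipschitz 𝒞 (complementSum T χ) := by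
  have h : LipschitzWith 1 fun x : ℝ => max 0 (1 - x) :=
    LipschitzWith.const_max (LipschitzWith.of_dist_le_mul fun x y => by
      rw [Real.dist_eq, Real.dist_eq, NNReal.coe_one, one_mul,
        show 1 - x - (1 - y) = -(x - y) by ring, abs_neg]) 0
  exact ChartLipschitz.comp (g := fun x => max 0 (1 - x)) h (ChartLipschitz.sum T fun p _ => hχ p)

end

/-- Data of a node: a chart around it, and a radius of a bidisc in the chart. -/
structure IsNodeChart (W : Set X) (F : X → ℂ) (φ : OpenPartialHomeomorph X (ℂ × ℂ)) (ε : ℝ) :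
    Prop where
  source_subset : φ.source ⊆ W
  eq_mul : ∀ q ∈ φ.source, F q = (φ q).1 * (φ q).2
  pos : 0 < ε
  ball_subset : Metric.ball 0 ε ⊆ φ.target

/-- Enlarging `T` by one node changes the locus only in the bidisc of that node. The bumps of the
other nodes vanish there by disjointness, so the change is exactly that of `euler_node`. -/
lemma euler_nodes [T2Space X] {W : Set X} {F : X → ℂ} {ι : Type*}
    {φ : ι → OpenPartialHomeomorph X (ℂ × ℂ)} {ε : ι → ℝ} (hφ : ∀ p, IsNodeChart W F (φ p) (ε p))
    {V : ι → Set X} (hV : ∀ p p', p ≠ p' → Disjoint (V p) (V p'))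
    (hφV : ∀ p, (φ p).source ∩ φ p ⁻¹' Metric.ball 0 (ε p) ⊆ V p)
    {c : ℂ} (hc0 : c ≠ 0) (hc : ∀ p, ‖c‖ < (ε p / 3) ^ 2) (T : Finset ι)
    (h : HasFiniteHomology (hybrid W F c fun _ => 1)) :
    HasFiniteHomology (hybrid W F c (complementSum T fun p => bump (φ p) 0 (ε p))) ∧
      eulerNumber (hybrid W F c (complementSum T fun p => bump (φ p) 0 (ε p))) =
        eulerNumber (hybrid W F c fun _ => 1) + T.card := by
  classical
  induction T using Finset.induction_on with
  | empty =>
    have : complementSum (∅ : Finset ι) (fun p => bump (φ p) 0 (ε p)) = fun _ => 1 := by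
      funext q
      simp [complementSum]
    rw [this]
    exact ⟨h, by simp⟩
  | insert p T hp ih =>
    have hzero : ∀ q ∈ (φ p).source, φ p q ∈ Metric.ball 0 (ε p) →
        ∑ p' ∈ T, bump (φ p') 0 (ε p') q = 0 := by
      intro q hq hqb
      refine Finset.sum_eq_zero fun p' hp' => bump_eq_zero (hφ p').pos fun hs => ?_
      have hne : p' ≠ p := fun e => hp (e ▸ hp')
      refine Set.disjoint_left.1 (hV p' p hne) (hφV p' ⟨hs.1, ?_⟩) (hφV p ⟨hq, hqb⟩)
      exact Metric.closedBall_subset_ball (by linarith [(hφ p').pos]) hs.2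
    have key := euler_node (φ p) (hφ p).pos hc0 (hc p) (hφ p).ball_subset
      (P := hybrid W F c (complementSum (insert p T) fun p => bump (φ p) 0 (ε p)))
      (Q := hybrid W F c (complementSum T fun p => bump (φ p) 0 (ε p)))
      (by
        intro q hq hqb
        have e : complementSum (insert p T) (fun p => bump (φ p) 0 (ε p)) q =
            1 - cutoff (‖φ p q‖ / ε p) := by
          rw [complementSum, Finset.sum_insert hp, hzero q hq hqb, bump_of_mem hq, add_zero,
            sub_zero, max_eq_right (by linarith [cutoff_le_one (‖φ p q‖ / ε p)])]
        rw [← (hφ p).eq_mul q hq, ← e]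
        exact ⟨fun h => h.2, fun h => ⟨(hφ p).source_subset hq, h⟩⟩)
      (by
        intro q hq hqb
        have e : complementSum T (fun p => bump (φ p) 0 (ε p)) q = 1 := by
          rw [complementSum, hzero q hq hqb, sub_zero, max_eq_right zero_le_one]
        rw [← (hφ p).eq_mul q hq]
        constructor
        · intro h
          rw [h.2, e, Complex.ofReal_one, mul_one]
        · intro h
          exact ⟨(hφ p).source_subset hq, by rw [h, e, Complex.ofReal_one, mul_one]⟩)
      (by
        intro q hq
        have e : complementSum (insert p T) (fun p => bump (φ p) 0 (ε p)) q =
            complementSum T (fun p => bump (φ p) 0 (ε p)) q := by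
          rw [complementSum, Finset.sum_insert hp, bump_eq_zero (hφ p).pos hq, zero_add]
          rfl
        rw [hybrid, hybrid, Set.mem_ofPred_eq, Set.mem_ofPred_eq, e])
      ih.1
    refine ⟨key.1, ?_⟩
    rw [key.2, ih.2, Finset.card_insert_of_notMem hp]
    push_cast
    ring

/-- A chart at a smooth point, in which `F` is the first coordinate, with the radius of a
bidisc. -/
structure IsSmoothChart (W : Set X) (F : X → ℂ) (ψ : OpenPartialHomeomorph X (ℂ × ℂ)) (z : ℂ)
    (r : ℝ) : Prop where
  source_subset : ψ.source ⊆ W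
  fst_eq : ∀ q ∈ ψ.source, (ψ q).1 = F q
  pos : 0 < r
  closedBall_subset : Metric.closedBall ((0 : ℂ), z) r ⊆ ψ.target

/-- Adding one bump changes `min τ (∑ bumps)` only inside one chart, so the sliding homeomorphism
applies to each step; finitely many smallness conditions on `c` arise. -/
lemma eventually_homeomorph_hybrid [T2Space X] {W : Set X} {F : X → ℂ}
    {𝒞 : Set (OpenPartialHomeomorph X (ℂ × ℂ))} (h𝒞 : LipschitzCompatible 𝒞)
    {κ : Type*} {ψ : κ → OpenPartialHomeomorph X (ℂ × ℂ)} (hψ𝒞 : ∀ i, ψ i ∈ 𝒞)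
    {z : κ → ℂ} {r : κ → ℝ} (hψ : ∀ i, IsSmoothChart W F (ψ i) (z i) (r i))
    {τ : X → ℝ} (hτ : ∀ q, τ q ∈ Set.Icc (0 : ℝ) 1) (hτc : Continuous τ)
    (hτl : ChartLipschitz 𝒞 τ) (t : Finset κ) :
    ∀ᶠ c : ℂ in 𝓝 0, Nonempty (hybrid W F c (fun _ => 0) ≃ₜ
      hybrid W F c fun q => min (τ q) (∑ i ∈ t, bump (ψ i) (0, z i) (r i) q)) := by
  classical
  have hT : ∀ i, Metric.ball ((0 : ℂ), z i) (r i) ⊆ (ψ i).target := fun i =>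
    Metric.ball_subset_closedBall.trans (hψ i).closedBall_subset
  have h01 : ∀ (t : Finset κ) q,
      min (τ q) (∑ i ∈ t, bump (ψ i) (0, z i) (r i) q) ∈ Set.Icc (0 : ℝ) 1 := fun t q =>
    ⟨le_min (hτ q).1 (Finset.sum_nonneg fun i _ => bump_nonneg q),
      (min_le_left _ _).trans (hτ q).2⟩
  have hcont : ∀ t : Finset κ, Continuous fun q =>
      min (τ q) (∑ i ∈ t, bump (ψ i) (0, z i) (r i) q) := fun t =>
    hτc.min (continuous_finsetSum _ fun i _ => continuous_bump (hψ i).pos (hT i))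
  have hlip : ∀ t : Finset κ, ChartLipschitz 𝒞 fun q =>
      min (τ q) (∑ i ∈ t, bump (ψ i) (0, z i) (r i) q) := fun t =>
    hτl.min (ChartLipschitz.sum t fun i _ => chartLipschitz_bump h𝒞 (hψ𝒞 i) (hψ i).pos (hT i))
  induction t using Finset.induction_on with
  | empty =>
    refine Eventually.of_forall fun c => ?_
    have : (fun q => min (τ q) (∑ i ∈ (∅ : Finset κ), bump (ψ i) (0, z i) (r i) q)) =
        fun _ => (0 : ℝ) := by
      funext q
      simpa using (hτ q).1
    rw [this]
    exact ⟨Homeomorph.refl _⟩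
  | insert a t ha ih =>
    have hKT : ∀ w ∈ Metric.closedBall (z a) (r a), ((0 : ℂ), w) ∈ (ψ a).target := by
      intro w hw
      refine (hψ a).closedBall_subset ?_
      rw [← closedBall_prod_same]
      exact ⟨Metric.mem_closedBall_self (hψ a).pos.le, hw⟩
    filter_upwards [ih, eventually_contraction (hlip t) (hψ𝒞 a) (isCompact_closedBall _ _) hKT,
      eventually_contraction (hlip (insert a t)) (hψ𝒞 a) (isCompact_closedBall _ _) hKT,
      Metric.closedBall_mem_nhds (0 : ℂ) (hψ a).pos] with c ⟨e⟩ h1 h2 h3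
    rw [mem_closedBall_zero_iff] at h3
    obtain ⟨e'⟩ := nonempty_homeomorph_hybrid (W := W) (F := F) (c := c) (ψ := ψ a)
      (Ω := Metric.ball (z a) (r a)) (A := bumpSupport (ψ a) (0, z a) (r a))
      (σ := fun q => min (τ q) (∑ i ∈ t, bump (ψ i) (0, z i) (r i) q))
      (σ' := fun q => min (τ q) (∑ i ∈ insert a t, bump (ψ i) (0, z i) (r i) q))
      (hψ a).source_subset (hψ a).fst_eq
      (by
        intro u hu w hw
        refine (hψ a).closedBall_subset ?_
        rw [← closedBall_prod_same]
        refine ⟨mem_closedBall_zero_iff.2 ?_, Metric.ball_subset_closedBall hw⟩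
        rw [norm_mul, Complex.norm_real, Real.norm_of_nonneg hu.1]
        exact (mul_le_of_le_one_right (norm_nonneg _) hu.2).trans h3)
      (by
        rintro q ⟨hq1, hq2⟩
        refine ⟨hq1, ?_⟩
        rw [Set.mem_preimage, ← closedBall_prod_same] at hq2
        exact Metric.closedBall_subset_ball (by linarith [(hψ a).pos]) hq2.2)
      (h01 t)
      (by
        intro q hq
        simp only [Finset.sum_insert ha, bump_eq_zero (hψ a).pos hq, zero_add])
      (isClosed_bumpSupport (hψ a).pos (hT a)) Metric.isOpen_ball (h01 _) (hcont _) (hcont _)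
      (fun w hw => h1 w (Metric.ball_subset_closedBall hw))
      (fun w hw => h2 w (Metric.ball_subset_closedBall hw))
    exact ⟨e.trans e'⟩

/-- The Euler number of a degenerate fibre. -/
theorem euler_degeneration [T2Space X] {W : Set X} {F : X → ℂ}
    {𝒞 : Set (OpenPartialHomeomorph X (ℂ × ℂ))} (h𝒞 : LipschitzCompatible 𝒞)
    (hcpt : IsCompact {q | q ∈ W ∧ F q = 0})
    (htube : ∀ O : Set X, IsOpen O → {q | q ∈ W ∧ F q = 0} ⊆ O →
      ∃ δ > 0, ∀ q ∈ W, ‖F q‖ < δ → q ∈ O)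
    (S : Finset X)
    (hnode : ∀ p ∈ S, ∃ φ ∈ 𝒞, p ∈ φ.source ∧ φ.source ⊆ W ∧ φ p = 0 ∧
      ∀ q ∈ φ.source, F q = (φ q).1 * (φ q).2)
    (hsmooth : ∀ p ∈ W, F p = 0 → p ∉ S → ∃ ψ ∈ 𝒞, p ∈ ψ.source ∧ ψ.source ⊆ W ∧
      ∀ q ∈ ψ.source, (ψ q).1 = F q) :
    ∀ᶠ c : ℂ in 𝓝 0, c ≠ 0 → HasFiniteHomology (hybrid W F c fun _ => 1) →
      HasFiniteHomology {q | q ∈ W ∧ F q = 0} ∧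
      eulerNumber {q | q ∈ W ∧ F q = 0} = eulerNumber (hybrid W F c fun _ => 1) + S.card := by
  classical
  obtain ⟨V, hV, hVd⟩ := S.finite_toSet.t2_separation
  have hex : ∀ p : S, ∃ φ ∈ 𝒞, ∃ ε, IsNodeChart W F φ ε ∧ p.1 ∈ φ.source ∧ φ p = 0 ∧
      φ.source ∩ φ ⁻¹' Metric.ball 0 ε ⊆ V p := by
    rintro ⟨p, hp⟩
    obtain ⟨φ, hφ, hpφ, hφW, hφp, hφF⟩ := hnode p hp
    have hO : IsOpen (φ.target ∩ φ.symm ⁻¹' V p) := φ.isOpen_inter_preimage_symm (hV p).2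
    obtain ⟨ε, hε, hball⟩ := Metric.isOpen_iff.1 hO 0
      ⟨hφp ▸ φ.map_source hpφ, by
        rw [Set.mem_preimage, ← hφp, φ.left_inv hpφ]
        exact (hV p).1⟩
    refine ⟨φ, hφ, ε, ⟨hφW, hφF, hε, hball.trans Set.inter_subset_left⟩, hpφ, hφp, ?_⟩
    rintro q ⟨hq1, hq2⟩
    have := (hball hq2).2
    rwa [Set.mem_preimage, φ.left_inv hq1] at this
  choose φ hφ𝒞 ε hφ hpφ hφp hφV using hex
  let χ : S → X → ℝ := fun p => bump (φ p) 0 (ε p)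
  let τ : X → ℝ := complementSum Finset.univ χ
  have hτ01 : ∀ q, τ q ∈ Set.Icc (0 : ℝ) 1 := complementSum_mem fun p q => bump_nonneg q
  -- the compact part of the special fibre away from the nodes
  let O₁ : Set X := ⋃ p, (φ p).source ∩ φ p ⁻¹' Metric.ball 0 (ε p / 3)
  have hO₁ : IsOpen O₁ :=
    isOpen_iUnion fun p => (φ p).isOpen_inter_preimage Metric.isOpen_ball
  have hK : IsCompact ({q | q ∈ W ∧ F q = 0} \ O₁) := hcpt.diff hO₁
  have hex : ∀ p : ↥({q | q ∈ W ∧ F q = 0} \ O₁), ∃ ψ ∈ 𝒞, ∃ z r, IsSmoothChart W F ψ z r ∧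
      p.1 ∈ ψ.source ∧ ψ p = (0, z) := by
    rintro ⟨p, ⟨hpW, hpF⟩, hpO⟩
    have hpS : p ∉ S := by
      intro hp
      refine hpO (Set.mem_iUnion.2 ⟨⟨p, hp⟩, hpφ ⟨p, hp⟩, ?_⟩)
      rw [Set.mem_preimage, hφp ⟨p, hp⟩]
      exact Metric.mem_ball_self (div_pos (hφ ⟨p, hp⟩).pos three_pos)
    obtain ⟨ψ, hψ, hpψ, hψW, hψF⟩ := hsmooth p hpW hpF hpS
    have hψp : ψ p = (0, (ψ p).2) := Prod.ext (by rw [hψF p hpψ, hpF]) rfl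
    obtain ⟨r, hr, hball⟩ := Metric.nhds_basis_closedBall.mem_iff.1
      (ψ.open_target.mem_nhds (ψ.map_source hpψ))
    exact ⟨ψ, hψ, (ψ p).2, r, ⟨hψW, hψF, hr, hψp ▸ hball⟩, hpψ, hψp⟩
  choose ψ hψ𝒞 z r hψ hpψ hψp using hex
  obtain ⟨t, ht⟩ := hK.elim_nhds_subcover'
    (fun p hp => (ψ ⟨p, hp⟩).source ∩ ψ ⟨p, hp⟩ ⁻¹' Metric.ball (0, z ⟨p, hp⟩) (r ⟨p, hp⟩ / 3))
    (fun p hp => ((ψ ⟨p, hp⟩).isOpen_inter_preimage Metric.isOpen_ball).mem_nhds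
      ⟨hpψ ⟨p, hp⟩, by
        rw [Set.mem_preimage, hψp ⟨p, hp⟩]
        exact Metric.mem_ball_self (div_pos (hψ _).pos three_pos)⟩)
  let O₂ : Set X := ⋃ p ∈ t, (ψ p).source ∩ ψ p ⁻¹' Metric.ball (0, z p) (r p / 3)
  have hO₂ : IsOpen O₂ :=
    isOpen_biUnion fun p _ => (ψ p).isOpen_inter_preimage Metric.isOpen_ball
  -- For `‖c‖ < δ` all loci in question lie in `O₁ ∪ O₂`, so it is enough that `σ` and `τ` agree
  -- there.
  obtain ⟨δ, hδ, htube⟩ := htube (O₁ ∪ O₂) (hO₁.union hO₂) (by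
    intro q hq
    by_cases h : q ∈ O₁
    exacts [Or.inl h, Or.inr (ht ⟨hq, h⟩)])
  let σ : X → ℝ := fun q => min (τ q) (∑ i ∈ t, bump (ψ i) (0, z i) (r i) q)
  -- On `O₁` some node bump is `1`, so `τ = 0`; on `O₂` some smooth bump is `1`, so the sum is at
  -- least `τ`.
  have hστ : ∀ q ∈ O₁ ∪ O₂, σ q = τ q := by
    rintro q (hq | hq)
    · obtain ⟨p, hq1, hq2⟩ := Set.mem_iUnion.1 hq
      have h1 : χ p q = 1 := bump_eq_one (hφ p).pos hq1 (Metric.ball_subset_closedBall hq2)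
      have h2 : χ p q ≤ ∑ p, χ p q :=
        Finset.single_le_sum (fun p _ => bump_nonneg q) (Finset.mem_univ p)
      have h3 : τ q = 0 := max_eq_left (by linarith)
      exact min_eq_left (h3 ▸ Finset.sum_nonneg fun i _ => bump_nonneg q)
    · obtain ⟨p, hp, hq1, hq2⟩ := Set.mem_iUnion₂.1 hq
      have h1 : bump (ψ p) (0, z p) (r p) q = 1 :=
        bump_eq_one (hψ p).pos hq1 (Metric.ball_subset_closedBall hq2)
      have h2 := Finset.single_le_sum (f := fun i => bump (ψ i) (0, z i) (r i) q)
        (fun p _ => bump_nonneg q) hp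
      exact min_eq_left ((hτ01 q).2.trans (h1 ▸ h2))
  have hσ01 : ∀ q, σ q ∈ Set.Icc (0 : ℝ) 1 := fun q =>
    ⟨le_min (hτ01 q).1 (Finset.sum_nonneg fun i _ => bump_nonneg q),
      (min_le_left _ _).trans (hτ01 q).2⟩
  have hsmall : ∀ᶠ c : ℂ in 𝓝 0, ∀ p, ‖c‖ < (ε p / 3) ^ 2 := by
    rw [eventually_all]
    intro p
    have := (hφ p).pos
    filter_upwards [Metric.ball_mem_nhds (0 : ℂ) (by positivity : 0 < (ε p / 3) ^ 2)] with c hc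
    exact mem_ball_zero_iff.1 hc
  filter_upwards [hsmall, Metric.ball_mem_nhds (0 : ℂ) hδ,
    eventually_homeomorph_hybrid h𝒞 hψ𝒞 hψ hτ01
      (continuous_complementSum fun p => continuous_bump (hφ p).pos (hφ p).ball_subset)
      (chartLipschitz_complementSum fun p =>
        chartLipschitz_bump h𝒞 (hφ𝒞 p) (hφ p).pos (hφ p).ball_subset) t] with c hc1 hc2 ⟨e⟩ hc0 hfin
  rw [mem_ball_zero_iff] at hc2
  obtain ⟨h1, h2⟩ := euler_nodes hφ (V := fun p : S => V p)
    (fun p p' hpp' => hVd p.2 p'.2 fun h => hpp' (Subtype.ext h)) hφV hc0 hc1 Finset.univ hfin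
  have hset0 : hybrid W F c (fun _ => 0) = {q | q ∈ W ∧ F q = 0} := by
    ext q
    simp [hybrid]
  have hle : ∀ ρ : X → ℝ, (∀ q, ρ q ∈ Set.Icc (0 : ℝ) 1) → ∀ q ∈ hybrid W F c ρ, q ∈ O₁ ∪ O₂ := by
    intro ρ hρ q hq
    refine htube q hq.1 (lt_of_le_of_lt ?_ hc2)
    rw [hq.2, norm_mul, Complex.norm_real, Real.norm_of_nonneg (hρ q).1]
    exact mul_le_of_le_one_right (norm_nonneg _) (hρ q).2
  have hset1 : hybrid W F c σ = hybrid W F c τ := by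
    ext q
    constructor
    · intro hq
      exact ⟨hq.1, by rw [hq.2, hστ q (hle σ hσ01 q hq)]⟩
    · intro hq
      exact ⟨hq.1, by rw [hq.2, hστ q (hle τ hτ01 q hq)]⟩
  -- The special fibre is homeomorphic to `F = c σ`, which is the same set as `F = c τ`, whose Euler
  -- number has been computed from the nodes.
  change hybrid W F c (fun _ => 0) ≃ₜ hybrid W F c σ at e
  rw [hset0, hset1] at e
  refine ⟨h1.of_homeomorph e.symm, (eulerNumber_congr_homeomorph e).trans (h2.trans ?_)⟩
  simp

end SurfaceFibration

end

section

/-! ### Local structure of a holomorphic map from a surface to a curve -/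

namespace SurfaceFibration

open Filter Topology

/-- The chart given by the second coordinate on the locus where the first coordinate is `c`. -/
lemma exists_sliceChart {X : Type*} [TopologicalSpace X] (ψ : OpenPartialHomeomorph X (ℂ × ℂ))
    (P : Set X) (c : ℂ) (hP : ∀ q ∈ ψ.source, q ∈ P ↔ (ψ q).1 = c) (q₀ : P) :
    ∃ e : OpenPartialHomeomorph P ℂ, ∀ q : P, q.1 ∈ ψ.source → q ∈ e.source := by
  classical
  have hmem : ∀ z, (c, z) ∈ ψ.target → ψ.symm (c, z) ∈ P := fun z hz =>
    (hP _ (ψ.map_target hz)).2 (by rw [ψ.right_inv hz])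
  have hfst : ∀ q : P, q.1 ∈ ψ.source → (c, (ψ q).2) = ψ q := fun q hq =>
    Prod.ext ((hP _ hq).1 q.2).symm rfl
  let inv : ℂ → P := fun z => if h : (c, z) ∈ ψ.target then ⟨ψ.symm (c, z), hmem z h⟩ else q₀
  have hinv : ∀ z, (c, z) ∈ ψ.target → (inv z : X) = ψ.symm (c, z) := fun z hz => by
    simp only [inv, dif_pos hz]
  refine ⟨{
    toFun q := (ψ q).2
    invFun := inv
    source := {q | q.1 ∈ ψ.source}
    target := {z | (c, z) ∈ ψ.target}
    map_source' := fun q hq => by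
      change (c, (ψ q).2) ∈ ψ.target
      rw [hfst q hq]
      exact ψ.map_source hq
    map_target' := fun z hz => by
      change (inv z : X) ∈ ψ.source
      rw [hinv z hz]
      exact ψ.map_target hz
    left_inv' := fun q hq => by
      have h : (c, (ψ q).2) ∈ ψ.target := by
        rw [hfst q hq]
        exact ψ.map_source hq
      refine Subtype.ext ?_
      rw [hinv _ h, hfst q hq, ψ.left_inv hq]
    right_inv' := fun z hz => by
      rw [hinv z hz, ψ.right_inv hz]
    open_source := ψ.open_source.preimage continuous_subtype_val
    open_target := ψ.open_target.preimage (by fun_prop)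
    continuousOn_toFun := continuous_snd.comp_continuousOn
      (ψ.continuousOn.comp continuous_subtype_val.continuousOn fun q hq => hq)
    continuousOn_invFun := by
      rw [Topology.IsInducing.subtypeVal.continuousOn_iff]
      refine ContinuousOn.congr (f := fun z => ψ.symm (c, z)) ?_ fun z hz => hinv z hz
      exact ψ.continuousOn_symm.comp (by fun_prop) fun z hz => hz }, fun q hq => hq⟩

variable {X B : Type u} [TopologicalSpace X] [ChartedSpace (ℂ × ℂ) X]
  [TopologicalSpace B] [ChartedSpace ℂ B]

variable (X) in
/-- Continuously differentiable charts. -/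
def smoothCharts : Set (OpenPartialHomeomorph X (ℂ × ℂ)) :=
  {ψ | ∀ q ∈ ψ.source, ContMDiffAt 𝓘(ℂ, ℂ × ℂ) 𝓘(ℂ, ℂ × ℂ) 1 ψ q ∧
    ContMDiffAt 𝓘(ℂ, ℂ × ℂ) 𝓘(ℂ, ℂ × ℂ) 1 ψ.symm (ψ q)}

/-- The transition maps are continuously differentiable, and such maps are locally Lipschitz. -/
lemma lipschitzCompatible_smoothCharts : LipschitzCompatible (smoothCharts X) := by
  intro ψ hψ ψ' hψ' q hq hq'
  have h1 := (hψ q hq).2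
  have h2 := (hψ' q hq').1
  have h3 : ContMDiffAt 𝓘(ℂ, ℂ × ℂ) 𝓘(ℂ, ℂ × ℂ) 1 (ψ' ∘ ψ.symm) (ψ q) :=
    ContMDiffAt.comp (ψ q) (by rwa [ψ.left_inv hq]) h1
  exact h3.contDiffAt.exists_lipschitzOnWith

lemma maximalAtlas_subset_smoothCharts [IsManifold 𝓘(ℂ, ℂ × ℂ) ω X] :
    IsManifold.maximalAtlas 𝓘(ℂ, ℂ × ℂ) ω X ⊆ smoothCharts X := by
  intro φ hφ q hq
  exact ⟨((contMDiffOn_of_mem_maximalAtlas hφ).contMDiffAt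
      (φ.open_source.mem_nhds hq)).of_le le_top,
    ((contMDiffOn_symm_of_mem_maximalAtlas hφ).contMDiffAt
      (φ.open_target.mem_nhds (φ.map_source hq))).of_le le_top⟩

section Local

variable [IsManifold 𝓘(ℂ, ℂ × ℂ) ω X] [IsManifold 𝓘(ℂ, ℂ) ω B] {f : X → B}
  (hf : ContMDiff 𝓘(ℂ, ℂ × ℂ) 𝓘(ℂ, ℂ) ω f) {φ : OpenPartialHomeomorph X (ℂ × ℂ)}
  (hφ : φ ∈ IsManifold.maximalAtlas 𝓘(ℂ, ℂ × ℂ) ω X) {s : B} {q : X} (hq : q ∈ φ.source)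
  (hfq : f q ∈ (chartAt ℂ s).source)

include hf hφ hq hfq

lemma contDiffAt_local (b : ℂ) :
    ContDiffAt ℂ 1 (fun v => chartAt ℂ s (f (φ.symm v)) - b) (φ q) := by
  have h1 : ContMDiffAt 𝓘(ℂ, ℂ × ℂ) 𝓘(ℂ, ℂ × ℂ) 1 φ.symm (φ q) :=
    (maximalAtlas_subset_smoothCharts hφ q hq).2
  have h2 : ContMDiffAt 𝓘(ℂ, ℂ × ℂ) 𝓘(ℂ, ℂ) 1 f (φ.symm (φ q)) :=
    (hf _).of_le le_top
  have h3 : ContMDiffAt 𝓘(ℂ, ℂ) 𝓘(ℂ, ℂ) 1 (chartAt ℂ s) (f (φ.symm (φ q))) := by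
    rw [φ.left_inv hq]
    exact ((contMDiffOn_of_mem_maximalAtlas
      (IsManifold.chart_mem_maximalAtlas (I := 𝓘(ℂ, ℂ)) (n := ω) s)).contMDiffAt
      ((chartAt ℂ s).open_source.mem_nhds hfq)).of_le le_top
  have h4 := ContMDiffAt.comp (φ q) h3 (ContMDiffAt.comp (φ q) h2 h1)
  exact h4.contDiffAt.sub contDiffAt_const

/-- The chain rule transports the vanishing of the derivative both ways: the local expression is a
composite of `f` with charts, and near `q` the map `f` is recovered by composing with the inverse
charts. The chart of `B` may be centred at another point `s`, which allows `q` to vary. -/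
lemma isSmoothPoint_iff (b : ℂ) :
    IsSmoothPoint f q ↔ fderiv ℂ (fun v => chartAt ℂ s (f (φ.symm v)) - b) (φ q) ≠ 0 := by
  have hβ := IsManifold.chart_mem_maximalAtlas (I := 𝓘(ℂ, ℂ)) (n := ω) s
  have h1 : MDifferentiableAt 𝓘(ℂ, ℂ × ℂ) 𝓘(ℂ, ℂ × ℂ) φ.symm (φ q) :=
    (maximalAtlas_subset_smoothCharts hφ q hq).2.mdifferentiableAt one_ne_zero
  have h1' : MDifferentiableAt 𝓘(ℂ, ℂ × ℂ) 𝓘(ℂ, ℂ × ℂ) φ q :=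
    (maximalAtlas_subset_smoothCharts hφ q hq).1.mdifferentiableAt one_ne_zero
  have h2 : MDifferentiableAt 𝓘(ℂ, ℂ × ℂ) 𝓘(ℂ, ℂ) f q :=
    (hf q).mdifferentiableAt (by simp)
  have h3 : MDifferentiableAt 𝓘(ℂ, ℂ) 𝓘(ℂ, ℂ) (chartAt ℂ s) (f q) :=
    ((contMDiffOn_of_mem_maximalAtlas hβ).contMDiffAt
      ((chartAt ℂ s).open_source.mem_nhds hfq)).mdifferentiableAt (by simp)
  have h3' : MDifferentiableAt 𝓘(ℂ, ℂ) 𝓘(ℂ, ℂ) (chartAt ℂ s).symm (chartAt ℂ s (f q)) :=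
    ((contMDiffOn_symm_of_mem_maximalAtlas hβ).contMDiffAt
      ((chartAt ℂ s).open_target.mem_nhds ((chartAt ℂ s).map_source hfq))).mdifferentiableAt
      (by simp)
  let G : ℂ × ℂ → ℂ := fun v => chartAt ℂ s (f (φ.symm v))
  have hG : DifferentiableAt ℂ G (φ q) := by
    have := (contDiffAt_local hf hφ hq hfq 0).differentiableAt one_ne_zero
    simpa [G] using this
  rw [fderiv_sub_const, IsSmoothPoint, not_iff_not]
  constructor
  · intro h
    have e1 : HasMFDerivAt 𝓘(ℂ, ℂ × ℂ) 𝓘(ℂ, ℂ) f (φ.symm (φ q)) 0 := by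
      have := h2.hasMFDerivAt
      rw [h] at this
      rw [φ.left_inv hq]
      exact this
    have e2 := e1.comp (φ q) h1.hasMFDerivAt
    have h3'' : MDifferentiableAt 𝓘(ℂ, ℂ) 𝓘(ℂ, ℂ) (chartAt ℂ s) ((f ∘ φ.symm) (φ q)) := by
      rw [Function.comp_apply, φ.left_inv hq]
      exact h3
    have e3 : HasMFDerivAt 𝓘(ℂ, ℂ × ℂ) 𝓘(ℂ, ℂ) G (φ q) _ := h3''.hasMFDerivAt.comp (φ q) e2
    exact (mfderiv_eq_fderiv.symm.trans e3.mfderiv).trans (ContinuousLinearMap.ext fun v =>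
      (mfderiv 𝓘(ℂ, ℂ) 𝓘(ℂ, ℂ) (chartAt ℂ s) ((f ∘ φ.symm) (φ q))).map_zero)
  · intro h
    have e1 : HasMFDerivAt 𝓘(ℂ, ℂ × ℂ) 𝓘(ℂ, ℂ) G (φ q) (0 : ℂ × ℂ →L[ℂ] ℂ) := by
      have := hG.hasFDerivAt
      rw [h] at this
      exact this.hasMFDerivAt
    have e2 := e1.comp q h1'.hasMFDerivAt
    have hGq : (G ∘ φ) q = chartAt ℂ s (f q) := by simp [G, φ.left_inv hq]
    have h3'' : MDifferentiableAt 𝓘(ℂ, ℂ) 𝓘(ℂ, ℂ) (chartAt ℂ s).symm ((G ∘ φ) q) := by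
      rw [hGq]
      exact h3'
    have e3 := h3''.hasMFDerivAt.comp q e2
    have hev : f =ᶠ[𝓝 q] (chartAt ℂ s).symm ∘ (G ∘ φ) := by
      filter_upwards [φ.open_source.mem_nhds hq,
        hf.continuous.continuousAt ((chartAt ℂ s).open_source.mem_nhds hfq)] with p hp hp'
      simp only [Function.comp_apply, G, φ.left_inv hp]
      exact ((chartAt ℂ s).left_inv hp').symm
    have e4 := (e3.congr_of_eventuallyEq hev).mfderiv
    exact e4.trans (ContinuousLinearMap.ext fun v =>
      (mfderiv 𝓘(ℂ, ℂ) 𝓘(ℂ, ℂ) (chartAt ℂ s).symm ((G ∘ φ) q)).map_zero)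

end Local

end SurfaceFibration

end

/-! ### Smooth and nodal fibres, and the comparison with nearby fibres -/

section

namespace SurfaceFibration

open Filter Topology

/-- A nonzero linear form on the plane completes to a coordinate system. -/
lemma exists_complementary_form (l : ℂ × ℂ →L[ℂ] ℂ) (hl : l ≠ 0) :
    ∃ (m : ℂ × ℂ →L[ℂ] ℂ) (e : (ℂ × ℂ) ≃L[ℂ] ℂ × ℂ), (e : ℂ × ℂ →L[ℂ] ℂ × ℂ) = l.prod m := by
  have key : ∃ m : ℂ × ℂ →L[ℂ] ℂ, Function.Injective (l.prod m) := by
    have hdec : ∀ v : ℂ × ℂ, l v = v.1 * l (1, 0) + v.2 * l (0, 1) := by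
      intro v
      have : v = v.1 • ((1, 0) : ℂ × ℂ) + v.2 • ((0, 1) : ℂ × ℂ) := by ext <;> simp
      calc l v = l (v.1 • ((1, 0) : ℂ × ℂ) + v.2 • ((0, 1) : ℂ × ℂ)) := congrArg l this
        _ = _ := by rw [map_add, map_smul, map_smul, smul_eq_mul, smul_eq_mul]
    by_cases h : l (1, 0) = 0
    · refine ⟨ContinuousLinearMap.fst ℂ ℂ ℂ, (injective_iff_map_eq_zero _).2 fun v hv => ?_⟩
      have h0 : l (0, 1) ≠ 0 := fun h' => hl (ContinuousLinearMap.ext fun v => by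
        rw [hdec, h, h']
        simp)
      have h1 : l v = 0 := congrArg Prod.fst hv
      have h2 : v.1 = 0 := congrArg Prod.snd hv
      rw [hdec, h2, zero_mul, zero_add] at h1
      exact Prod.ext h2 ((mul_eq_zero.1 h1).resolve_right h0)
    · refine ⟨ContinuousLinearMap.snd ℂ ℂ ℂ, (injective_iff_map_eq_zero _).2 fun v hv => ?_⟩
      have h1 : l v = 0 := congrArg Prod.fst hv
      have h2 : v.2 = 0 := congrArg Prod.snd hv
      rw [hdec, h2, zero_mul, add_zero] at h1
      exact Prod.ext ((mul_eq_zero.1 h1).resolve_right h) h2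
  obtain ⟨m, hm⟩ := key
  refine ⟨m, (LinearEquiv.ofInjectiveEndo (l.prod m).toLinearMap hm).toContinuousLinearEquiv, ?_⟩
  exact ContinuousLinearMap.ext fun v => rfl

variable {X B : Type u} [TopologicalSpace X] [ChartedSpace (ℂ × ℂ) X]
  [TopologicalSpace B] [ChartedSpace ℂ B]
  [IsManifold 𝓘(ℂ, ℂ × ℂ) ω X] [IsManifold 𝓘(ℂ, ℂ) ω B] {f : X → B}
  (hf : ContMDiff 𝓘(ℂ, ℂ × ℂ) 𝓘(ℂ, ℂ) ω f)

include hf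

/-- At a smooth point the map is the first coordinate of a chart. -/
lemma exists_smoothChart {s : B} {q : X} (hfq : f q ∈ (chartAt ℂ s).source)
    (hq : IsSmoothPoint f q) (b : ℂ) :
    ∃ ψ ∈ smoothCharts X, q ∈ ψ.source ∧ ψ.source ⊆ f ⁻¹' (chartAt ℂ s).source ∧
      ∀ p ∈ ψ.source, (ψ p).1 = chartAt ℂ s (f p) - b := by
  let φ := chartAt (ℂ × ℂ) q
  have hφ : φ ∈ IsManifold.maximalAtlas 𝓘(ℂ, ℂ × ℂ) ω X := IsManifold.chart_mem_maximalAtlas q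
  have hqφ : q ∈ φ.source := mem_chart_source _ q
  let G : ℂ × ℂ → ℂ := fun v => chartAt ℂ s (f (φ.symm v)) - b
  have hG : ContDiffAt ℂ 1 G (φ q) := contDiffAt_local hf hφ hqφ hfq b
  obtain ⟨m, e, he⟩ := exists_complementary_form _ ((isSmoothPoint_iff hf hφ hqφ hfq b).1 hq)
  -- Completed by a linear form, the local expression of `f` has invertible derivative, and the
  -- inverse function theorem makes it a chart.
  let H : ℂ × ℂ → ℂ × ℂ := fun v => (G v, m v)
  have hH : ContDiffAt ℂ 1 H (φ q) := hG.prodMk m.contDiff.contDiffAt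
  have hH' : HasFDerivAt H (e : ℂ × ℂ →L[ℂ] ℂ × ℂ) (φ q) := by
    rw [he]
    exact (hG.differentiableAt one_ne_zero).hasFDerivAt.prodMk m.hasFDerivAt
  let h := hH.toOpenPartialHomeomorph H hH' one_ne_zero
  have hh : ∀ v, h v = H v := fun v => rfl
  have hsrc : φ q ∈ h.source := hH.mem_toOpenPartialHomeomorph_source hH' one_ne_zero
  have hinv : ContDiffAt ℂ 1 h.symm (H (φ q)) := hH.to_localInverse hH' one_ne_zero
  -- The chart is shrunk to where the local inverse is continuously differentiable, so that the
  -- condition in `smoothCharts` holds at every point of the source.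
  let O : Set (ℂ × ℂ) := interior {w | ContDiffAt ℂ 1 h.symm w}
  have hO : H (φ q) ∈ O := mem_interior_iff_mem_nhds.2 (hinv.eventually (by simp))
  let ψ₀ := φ.trans h
  have hopen : IsOpen (f ⁻¹' (chartAt ℂ s).source ∩ (ψ₀.source ∩ ψ₀ ⁻¹' O)) :=
    ((chartAt ℂ s).open_source.preimage hf.continuous).inter
      (ψ₀.isOpen_inter_preimage isOpen_interior)
  have hqψ₀ : q ∈ ψ₀.source := by
    rw [OpenPartialHomeomorph.trans_source]
    exact ⟨hqφ, hsrc⟩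
  refine ⟨ψ₀.restrOpen _ hopen, ?_, ⟨hqψ₀, hfq, hqψ₀, hO⟩, fun p hp => hp.2.1, fun p hp => ?_⟩
  · rintro p ⟨-, hp1, hp2, hp3⟩
    have hpφ : p ∈ φ.source := by
      rw [OpenPartialHomeomorph.trans_source] at hp2
      exact hp2.1
    have hpC := maximalAtlas_subset_smoothCharts hφ p hpφ
    constructor
    · have h1 : ContDiffAt ℂ 1 H (φ p) :=
        (contDiffAt_local hf hφ hpφ hp1 b).prodMk m.contDiff.contDiffAt
      exact ContMDiffAt.comp (g := H) (f := φ) p h1.contMDiffAt hpC.1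
    · have h1 : ContDiffAt ℂ 1 h.symm (ψ₀ p) := interior_subset hp3
      have h2 : h.symm (ψ₀ p) = φ p := by
        rw [OpenPartialHomeomorph.trans_source] at hp2
        exact h.left_inv hp2.2
      exact ContMDiffAt.comp (g := φ.symm) (f := h.symm) (ψ₀ p) (by rw [h2]; exact hpC.2)
        h1.contMDiffAt
  · have hpφ : p ∈ φ.source := by
      have := hp.1
      rw [OpenPartialHomeomorph.trans_source] at this
      exact this.1
    change chartAt ℂ s (f (φ.symm (φ p))) - b = _
    rw [φ.left_inv hpφ]

lemma eventually_isSmoothPoint {q : X} (hq : IsSmoothPoint f q) :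
    ∀ᶠ p in 𝓝 q, IsSmoothPoint f p := by
  let φ := chartAt (ℂ × ℂ) q
  have hφ : φ ∈ IsManifold.maximalAtlas 𝓘(ℂ, ℂ × ℂ) ω X := IsManifold.chart_mem_maximalAtlas q
  have hqφ : q ∈ φ.source := mem_chart_source _ q
  have hfq : f q ∈ (chartAt ℂ (f q)).source := mem_chart_source _ _
  have h1 := (isSmoothPoint_iff hf hφ hqφ hfq 0).1 hq
  have h2 := (contDiffAt_local hf hφ hqφ hfq 0).continuousAt_fderiv one_ne_zero
  have h3 := (φ.continuousAt hqφ).eventually (h2.eventually_ne h1)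
  filter_upwards [h3, φ.open_source.mem_nhds hqφ, hf.continuous.continuousAt
    ((chartAt ℂ (f q)).open_source.mem_nhds hfq)] with p hp1 hp2 hp3
  exact (isSmoothPoint_iff hf hφ hp2 hp3 0).2 hp1

/-- The differential of `x y` is `x dy + y dx`, which vanishes only at the origin. -/
lemma isSmoothPoint_iff_of_node {φ : OpenPartialHomeomorph X (ℂ × ℂ)}
    (hφ : φ ∈ IsManifold.maximalAtlas 𝓘(ℂ, ℂ × ℂ) ω X) {s : B} {b : ℂ}
    (hφF : ∀ q ∈ φ.source, f q ∈ (chartAt ℂ s).source ∧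
      chartAt ℂ s (f q) - b = (φ q).1 * (φ q).2) {q : X} (hq : q ∈ φ.source) :
    IsSmoothPoint f q ↔ φ q ≠ 0 := by
  rw [isSmoothPoint_iff hf hφ hq (hφF q hq).1 b]
  have hev : (fun v => chartAt ℂ s (f (φ.symm v)) - b) =ᶠ[𝓝 (φ q)] fun v => v.1 * v.2 := by
    filter_upwards [φ.open_target.mem_nhds (φ.map_source hq)] with v hv
    rw [(hφF _ (φ.map_target hv)).2, φ.right_inv hv]
  have hd : HasFDerivAt (fun v : ℂ × ℂ => v.1 * v.2) _ (φ q) :=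
    (hasFDerivAt_fst (𝕜 := ℂ) (p := φ q)).mul (hasFDerivAt_snd (𝕜 := ℂ) (p := φ q))
  rw [hev.fderiv_eq, hd.fderiv, not_iff_not]
  constructor
  · intro h
    have h1 := congrArg (fun l : ℂ × ℂ →L[ℂ] ℂ => l (0, 1)) h
    have h2 := congrArg (fun l : ℂ × ℂ →L[ℂ] ℂ => l (1, 0)) h
    simp at h1 h2
    exact Prod.ext h1 h2
  · intro h
    rw [h]
    refine ContinuousLinearMap.ext fun v => ?_
    change (0 : ℂ) * v.2 + 0 * v.1 = 0
    rw [zero_mul, zero_mul, add_zero]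

lemma IsDoublePoint.not_isSmoothPoint {p : X} (hp : IsDoublePoint f p) : ¬ IsSmoothPoint f p := by
  obtain ⟨φ, hφ, hpφ, hφp, hφF⟩ := hp
  rw [isSmoothPoint_iff_of_node hf hφ hφF hpφ, not_not]
  exact hφp

lemma IsDoublePoint.eventually_isSmoothPoint {p : X} (hp : IsDoublePoint f p) :
    ∀ᶠ q in 𝓝 p, q ≠ p → IsSmoothPoint f q := by
  obtain ⟨φ, hφ, hpφ, hφp, hφF⟩ := hp
  filter_upwards [φ.open_source.mem_nhds hpφ] with q hq hqp
  rw [isSmoothPoint_iff_of_node hf hφ hφF hq, ← hφp]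
  exact fun h => hqp (φ.injOn hq hpφ h)

/-- Compact smooth fibres have finite dimensional homology. -/
lemma IsSmoothFibre.hasFiniteHomology [T2Space X] [CompactSpace X] [T2Space B] {s : B}
    (hs : IsSmoothFibre f s) : HasFiniteHomology (fibre f s) := by
  have hclosed : IsClosed (fibre f s) := isClosed_singleton.preimage hf.continuous
  have := isCompact_iff_compactSpace.1 hclosed.isCompact
  refine hasFiniteHomology_of_charts fun q => ?_
  have hfq : f q = s := q.2
  obtain ⟨ψ, -, hqψ, hψW, hψF⟩ := exists_smoothChart hf (s := s)
    (by rw [hfq]; exact mem_chart_source _ _) (hs q q.2) 0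
  obtain ⟨e, he⟩ := exists_sliceChart ψ (fibre f s) (chartAt ℂ s s) (fun p hp => by
    rw [hψF p hp, sub_zero]
    exact ⟨fun h => by rw [show f p = s from h],
      fun h => (chartAt ℂ s).injOn (hψW hp) (mem_chart_source _ _) h⟩) q
  exact ⟨e, he q hqψ⟩

omit [IsManifold 𝓘(ℂ, ℂ × ℂ) ω X] [IsManifold 𝓘(ℂ, ℂ) ω B] in
/-- Nearby fibres lie in a given neighbourhood of a fibre. -/
lemma eventually_fibre_subset [CompactSpace X] [T2Space B] {s : B} {O : Set X} (hO : IsOpen O)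
    (h : fibre f s ⊆ O) : ∀ᶠ s' in 𝓝 s, fibre f s' ⊆ O := by
  have hc : IsClosed (f '' Oᶜ) := (hO.isClosed_compl.isCompact.image hf.continuous).isClosed
  filter_upwards [hc.isOpen_compl.mem_nhds (show s ∈ (f '' Oᶜ)ᶜ by
    rintro ⟨q, hq, hqs⟩
    exact hq (h hqs))] with s' hs' q hq
  by_contra hqO
  exact hs' ⟨q, hqO, hq⟩

section Nodal

variable {s : B} (hs : ∀ p ∈ fibre f s, IsSmoothPoint f p ∨ IsDoublePoint f p)

include hs

lemma eventually_punctured_isSmoothPoint {p : X} (hp : p ∈ fibre f s) :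
    ∀ᶠ q in 𝓝 p, q ≠ p → IsSmoothPoint f q := by
  rcases hs p hp with h | h
  · exact (SurfaceFibration.eventually_isSmoothPoint hf h).mono fun q hq _ => hq
  · exact h.eventually_isSmoothPoint hf

/-- Double points are critical, and each point of the compact fibre has a neighbourhood with no
critical point except possibly itself. -/
lemma finite_doublePoints [CompactSpace X] [T2Space B] : (doublePoints f s).Finite := by
  have hclosed : IsClosed (fibre f s) := isClosed_singleton.preimage hf.continuous
  obtain ⟨t, -, ht⟩ := hclosed.isCompact.elim_nhds_subcover
    (fun p => {q | q ≠ p → IsSmoothPoint f q})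
    (fun p hp => eventually_punctured_isSmoothPoint hf hs hp)
  refine t.finite_toSet.subset fun q hq => ?_
  obtain ⟨p, hp, hqp⟩ := Set.mem_iUnion₂.1 (ht hq.1)
  have : q = p := by
    by_contra h
    exact hq.2.not_isSmoothPoint hf (hqp h)
  exact this ▸ hp

/-- Every point in a neighbourhood of `X_s` lies on `X_s` or is a smooth point. Fibres over nearby
points lie in that neighbourhood and, being different from `X_s`, do not meet it. -/
lemma eventually_isSmoothFibre [CompactSpace X] [T2Space B] :
    ∀ᶠ s' in 𝓝 s, s' ≠ s → IsSmoothFibre f s' := by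
  have h : fibre f s ⊆ interior {q | q ∈ fibre f s ∨ IsSmoothPoint f q} := by
    intro p hp
    rw [mem_interior_iff_mem_nhds]
    filter_upwards [eventually_punctured_isSmoothPoint hf hs hp] with q hq
    by_cases h : q = p
    · exact Or.inl (h ▸ hp)
    · exact Or.inr (hq h)
  filter_upwards [eventually_fibre_subset hf isOpen_interior h] with s' hs' hne q hq
  refine (interior_subset (hs' hq)).resolve_left fun hq' => hne ?_
  exact (show f q = s' from hq).symm.trans hq'

/-- The Euler numbers of a nodal fibre and of the nearby fibres. -/
lemma eventually_euler [T2Space X] [CompactSpace X] [T2Space B] :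
    ∀ᶠ s' in 𝓝 s, s' ≠ s → IsSmoothFibre f s' ∧ HasFiniteHomology (fibre f s) ∧
      eulerNumber (fibre f s) = eulerNumber (fibre f s') + (doublePoints f s).ncard := by
  let β := chartAt ℂ s
  let W := f ⁻¹' β.source
  let F : X → ℂ := fun q => β (f q) - β s
  have hsβ : s ∈ β.source := mem_chart_source _ _
  -- With `c` the coordinate difference of `s'` and `s`, the locus for `σ = 1` is exactly the fibre
  -- over `s'`.
  have hfib : ∀ s' ∈ β.source, hybrid W F (β s' - β s) (fun _ => 1) = fibre f s' := by
    intro s' hs'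
    ext q
    constructor
    · rintro ⟨h1, h2⟩
      refine β.injOn h1 hs' ?_
      simpa [F] using h2
    · intro h
      have h : f q = s' := h
      exact ⟨by rw [Set.mem_preimage, h]; exact hs', by simp [F, h]⟩
  have hzero : {q | q ∈ W ∧ F q = 0} = fibre f s := by
    ext q
    constructor
    · rintro ⟨h1, h2⟩
      exact β.injOn h1 hsβ (sub_eq_zero.1 h2)
    · intro h
      have h : f q = s := h
      exact ⟨by rw [Set.mem_preimage, h]; exact hsβ, by simp [F, h]⟩
  have hclosed : IsClosed (fibre f s) := isClosed_singleton.preimage hf.continuous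
  have hfin := finite_doublePoints hf hs
  have key := euler_degeneration (W := W) (F := F) (lipschitzCompatible_smoothCharts (X := X))
    (hzero ▸ hclosed.isCompact)
    (by
      intro O hO hsub
      rw [hzero] at hsub
      -- The tube condition in terms of `F` is the properness statement for nearby fibres, read
      -- through the chart of `B`.
      have h1 : Tendsto β.symm (𝓝 (β s)) (𝓝 s) := by
        have := β.symm.continuousAt (β.map_source hsβ)
        rwa [ContinuousAt, β.left_inv hsβ] at this
      obtain ⟨δ, hδ, h2⟩ := Metric.eventually_nhds_iff.1
        (h1.eventually (eventually_fibre_subset hf hO hsub))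
      refine ⟨δ, hδ, fun q hq hqδ => ?_⟩
      refine h2 (y := β (f q)) (by rwa [dist_eq_norm]) ?_
      rw [β.left_inv hq]
      rfl)
    hfin.toFinset
    (by
      intro p hp
      obtain ⟨hpf, φ, hφ, hpφ, hφp, hφF⟩ := hfin.mem_toFinset.1 hp
      rw [show f p = s from hpf] at hφF
      exact ⟨φ, maximalAtlas_subset_smoothCharts hφ, hpφ, fun q hq => (hφF q hq).1, hφp,
        fun q hq => (hφF q hq).2⟩)
    (by
      intro p hpW hpF hpS
      have hpf : p ∈ fibre f s := hzero ▸ (show p ∈ {q | q ∈ W ∧ F q = 0} from ⟨hpW, hpF⟩)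
      have hsm := (hs p hpf).resolve_right fun h => hpS (hfin.mem_toFinset.2 ⟨hpf, h⟩)
      exact exists_smoothChart hf hpW hsm (β s))
  have hlim : Tendsto (fun s' => β s' - β s) (𝓝 s) (𝓝 0) := by
    have := Tendsto.sub_const (β.continuousAt hsβ) (β s)
    rwa [sub_self] at this
  filter_upwards [hlim.eventually key, eventually_isSmoothFibre hf hs,
    β.open_source.mem_nhds hsβ] with s' h1 h2 h3 hne
  have hsm := h2 hne
  rw [hfib s' h3, hzero, ← Set.ncard_eq_toFinset_card _ hfin] at h1
  exact ⟨hsm, h1 (sub_ne_zero.2 fun h => hne (β.injOn h3 hsβ h)) (hsm.hasFiniteHomology hf)⟩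

end Nodal

omit hf [IsManifold 𝓘(ℂ, ℂ × ℂ) ω X] [IsManifold 𝓘(ℂ, ℂ) ω B] in
/-- A complex curve has no isolated points. -/
lemma exists_ne_of_eventually {s : B} {P : B → Prop} (h : ∀ᶠ s' in 𝓝 s, P s') :
    ∃ s', s' ≠ s ∧ P s' := by
  let β := chartAt ℂ s
  have hsβ : s ∈ β.source := mem_chart_source _ _
  have h1 : Tendsto β.symm (𝓝 (β s)) (𝓝 s) := by
    have := β.symm.continuousAt (β.map_source hsβ)
    rwa [ContinuousAt, β.left_inv hsβ] at this
  have h2 : ∀ᶠ w in 𝓝[≠] (β s), w ≠ β s ∧ w ∈ β.target ∧ P (β.symm w) := by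
    filter_upwards [self_mem_nhdsWithin, mem_nhdsWithin_of_mem_nhds (h1.eventually h),
      mem_nhdsWithin_of_mem_nhds (β.open_target.mem_nhds (β.map_source hsβ))] with w hw1 hw2 hw3
    exact ⟨hw1, hw3, hw2⟩
  obtain ⟨w, hw1, hw2, hw3⟩ := h2.exists
  refine ⟨β.symm w, fun h => hw1 ?_, hw3⟩
  rw [← h, β.right_inv hw2]

end SurfaceFibration

end

end

theorem lemma1p3 {X B : Type u}
    [TopologicalSpace X] [T2Space X] [CompactSpace X] [ConnectedSpace X]
    [ChartedSpace (ℂ × ℂ) X] [IsManifold 𝓘(ℂ, ℂ × ℂ) ω X]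
    [TopologicalSpace B] [T2Space B] [CompactSpace B] [ConnectedSpace B]
    [ChartedSpace ℂ B] [IsManifold 𝓘(ℂ, ℂ) ω B]
    (g : ℕ) (f : X → B) (hf : SurfaceFibration.IsSemistableFibration g f)
    (s t : B) (ht : SurfaceFibration.IsSmoothFibre f t) :
    SurfaceFibration.HasFiniteHomology (SurfaceFibration.fibre f s) ∧
    SurfaceFibration.HasFiniteHomology (SurfaceFibration.fibre f t) ∧
    (SurfaceFibration.doublePoints f s).Finite ∧
    SurfaceFibration.eulerNumber (SurfaceFibration.fibre f s) -
        SurfaceFibration.eulerNumber (SurfaceFibration.fibre f t) =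
      ((SurfaceFibration.doublePoints f s).ncard : ℤ) := by
  have hol := hf.holomorphic
  have hnod := fun s => (hf.semistable s).nodal
  have hsm : ∀ t, SurfaceFibration.IsSmoothFibre f t →
      (SurfaceFibration.doublePoints f t).ncard = 0 := by
    intro t ht
    have : SurfaceFibration.doublePoints f t = ∅ :=
      Set.eq_empty_iff_forall_notMem.2 fun p hp => hp.2.not_isSmoothPoint hol (ht p hp.1)
    rw [this, Set.ncard_empty]
  -- Near `s` the other fibres have no double points, so the comparison with `X_s` says precisely
  -- that this difference is constant there.
  have hloc : IsLocallyConstant fun s : B =>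
      SurfaceFibration.eulerNumber (SurfaceFibration.fibre f s) -
        ((SurfaceFibration.doublePoints f s).ncard : ℤ) := by
    rw [IsLocallyConstant.iff_eventually_eq]
    intro s
    filter_upwards [SurfaceFibration.eventually_euler hol (hnod s)] with s' hs'
    by_cases hne : s' = s
    · rw [hne]
    · obtain ⟨h1, -, h3⟩ := hs' hne
      rw [hsm s' h1, h3]
      push_cast
      ring
  have hfin : SurfaceFibration.HasFiniteHomology (SurfaceFibration.fibre f s) := by
    -- The comparison gives the finiteness of `X_s` only in the presence of a nearby fibre with `s'
    -- ≠ s`, so a second base point close to `s` is needed.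
    obtain ⟨s', hne, hs'⟩ := SurfaceFibration.exists_ne_of_eventually
      (SurfaceFibration.eventually_euler hol (hnod s))
    exact (hs' hne).2.1
  refine ⟨hfin, ht.hasFiniteHomology hol, SurfaceFibration.finite_doublePoints hol (hnod s), ?_⟩
  have h := hloc.apply_eq_of_preconnectedSpace s t
  simp only [hsm t ht, Nat.cast_zero, sub_zero] at h
  linarith
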